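/- **Theorem (Equivalence of fine symbols).** A *$2$-adic lattice* is a finite-dimensional free $\mathbb{Z}_2$-module with a nondegenerate symmetric $\mathbb{Q}_2$-valued bilinear form. For $q=2^k$ with $k\in\mathbb{Z}$, let $q^{+2}_{\rm II}$ and $q^{-2}_{\rm II}$ denote the lattices with inner product matrices $q\begin{pmatrix}0&1\\1&0\end{pmatrix}$ and $q\begin{pmatrix}2&1\\1&2\end{pmatrix}$ (type II), and let $q^{+}_G,\ q^{-}_G,\ q^{+}_R,\ q^{-}_R$ denote the one-dimensional lattices $\langle q\rangle,\ \langle -3q\rangle,\ \langle -q\rangle,\ \langle 3q\rangle$ (type I); those with subscript $G$ are called givers and those with subscript $R$ receivers. The number $q$ is the *scale* of the term and $\pm$ is its *sign*. A *fine symbol* is a finite sequence of such terms, considered up to permutation of the terms, in which any two terms of the same scale have the same type. It represents the orthogonal direct sum of its terms. A *compartment* of a fine symbol is a nonempty collection of type I terms whose set of scales consists of consecutive powers of $2$, and which is maximal with these properties. Consider the following operations on fine symbols. 1. *Sign walking*: negate the signs of two terms which (0) have the same scale; or (1) have adjacent scales (that is, scales with ratio $2$) and different types; or (2) have adjacent scales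 and are both givers or both receivers, in which case one also changes both from givers to receivers or vice versa; or (3) have scales differing by a factor of $4$ and are both of type I. Apart from the change in case (2), subscripts are unchanged. 2. *Giver permutation*: permute the subscripts $G$ and $R$ within a compartment, keeping all scales and signs. 3. *Giver conversion*: change four $G$'s in a compartment to $R$'s, or four $R$'s in a compartment to $G$'s, keeping all scales and signs. Then two fine symbols represent isometric lattices if and only if they are related by a finite (possibly empty) sequence of sign walking, giver permutation and giver conversion operations. -/

import Mathlib

/-- A `2`-adic lattice: a finite-dimensional free `ℤ₂`-module with a nondegenerate symmetric
bilinear form with values in `ℚ₂`. -/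
structure TwoAdicLattice where
  carrier : Type
  [addCommGroup : AddCommGroup carrier]
  [module : Module ℤ_[2] carrier]
  [free : Module.Free ℤ_[2] carrier]
  [finite : Module.Finite ℤ_[2] carrier]
  form : carrier →ₗ[ℤ_[2]] carrier →ₗ[ℤ_[2]] ℚ_[2]
  symm : ∀ x y, form x y = form y x
  nondegenerate : ∀ x, (∀ y, form x y = 0) → x = 0

attribute [instance] TwoAdicLattice.addCommGroup TwoAdicLattice.module TwoAdicLattice.free
  TwoAdicLattice.finite

/-- Two lattices are isometric if some `ℤ₂`-linear isomorphism preserves inner products. -/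
def TwoAdicLattice.Isometric (L M : TwoAdicLattice) : Prop :=
  ∃ e : L.carrier ≃ₗ[ℤ_[2]] M.carrier, ∀ x y, M.form (e x) (e y) = L.form x y

/-- The sign of a term. -/
inductive FineSign
  | plus
  | minus
  deriving DecidableEq

def FineSign.neg : FineSign → FineSign
  | plus => minus
  | minus => plus

/-- The subscript of a one-dimensional term: `G` (giver) or `R` (receiver). -/
inductive FineSubscript
  | G
  | R
  deriving DecidableEq

def FineSubscript.swap : FineSubscript → FineSubscript
  | G => R
  | R => G

/-- The terms of fine symbols. With `q = 2 ^ k`, where `k` is any (possibly negative) integer,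
`typeII k ε` is `q^{ε2}_{II}` and `typeI k ε s` is `q^{ε1}_s`. -/
inductive FineTerm
  | typeII (k : ℤ) (ε : FineSign)
  | typeI (k : ℤ) (ε : FineSign) (s : FineSubscript)
  deriving DecidableEq

/-- The numerical subscript (oddity): `1^+_G = 1^+_1`, `1^-_G = 1^-_{-3}`, `1^+_R = 1^+_{-1}`,
`1^-_R = 1^-_3`. -/
def FineSign.oddity : FineSign → FineSubscript → ℤ
  | plus, .G => 1
  | minus, .G => -3
  | plus, .R => -1
  | minus, .R => 3

namespace FineTerm

/-- The base `2` logarithm of the scale of a term. -/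
def logScale : FineTerm → ℤ
  | typeII k _ => k
  | typeI k _ _ => k

/-- The term has type I, i.e. is a giver or a receiver. -/
def IsTypeI : FineTerm → Prop
  | typeII _ _ => False
  | typeI _ _ _ => True

def IsGiver : FineTerm → Prop
  | typeI _ _ .G => True
  | _ => False

def IsReceiver : FineTerm → Prop
  | typeI _ _ .R => True
  | _ => False

/-- Negate the sign of a term, keeping its scale, type and giver/receiver status. -/
def negSign : FineTerm → FineTerm
  | typeII k ε => typeII k ε.neg
  | typeI k ε s => typeI k ε.neg s

/-- Turn a giver into a receiver and vice versa, keeping its scale and sign. -/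
def swapSubscript : FineTerm → FineTerm
  | typeII k ε => typeII k ε
  | typeI k ε s => typeI k ε s.swap

def dim : FineTerm → ℕ
  | typeII _ _ => 2
  | typeI _ _ _ => 1

/-- The inner product matrix of the lattice denoted by a term. -/
noncomputable def gram : (t : FineTerm) → Matrix (Fin t.dim) (Fin t.dim) ℚ_[2]
  | typeII k .plus => ((2 : ℚ_[2]) ^ k • !![0, 1; 1, 0] : Matrix (Fin 2) (Fin 2) ℚ_[2])
  | typeII k .minus => ((2 : ℚ_[2]) ^ k • !![2, 1; 1, 2] : Matrix (Fin 2) (Fin 2) ℚ_[2])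
  | typeI k ε s =>
      ((2 : ℚ_[2]) ^ k • !![((ε.oddity s : ℤ) : ℚ_[2])] : Matrix (Fin 1) (Fin 1) ℚ_[2])

theorem gram_symm (t : FineTerm) (a b : Fin t.dim) : t.gram a b = t.gram b a := by
  rcases t with ⟨k, ε⟩ | ⟨k, ε, s⟩
  · change Fin 2 at a b
    cases ε <;> fin_cases a <;> fin_cases b <;> simp [gram]
  · change Fin 1 at a b
    rw [Subsingleton.elim a b]

theorem gram_nondegenerate (t : FineTerm) (x : Fin t.dim → ℤ_[2])
    (h : ∀ b, ∑ a, (x a : ℚ_[2]) * t.gram a b = 0) : x = 0 := by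
  have h2 : ∀ k : ℤ, (2 : ℚ_[2]) ^ k ≠ 0 := fun k => zpow_ne_zero k two_ne_zero
  rcases t with ⟨k, ε⟩ | ⟨k, ε, s⟩
  · change Fin 2 → ℤ_[2] at x
    change ∀ b : Fin 2, ∑ a : Fin 2, (x a : ℚ_[2]) * _ = 0 at h
    have h0 := h 0
    have h1 := h 1
    have key : (x 0 : ℚ_[2]) = 0 ∧ (x 1 : ℚ_[2]) = 0 := by
      cases ε
      · simp [gram, Fin.sum_univ_two, h2] at h0 h1
        simp [h0, h1]
      · simp only [gram, Fin.sum_univ_two, Matrix.smul_apply, Matrix.of_apply,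
          Matrix.cons_val_zero, Matrix.cons_val_one, smul_eq_mul, Matrix.cons_val'] at h0 h1
        have e0 : (2 : ℚ_[2]) ^ k * (2 * (x 0 : ℚ_[2]) + x 1) = 0 := by linear_combination h0
        have e1 : (2 : ℚ_[2]) ^ k * ((x 0 : ℚ_[2]) + 2 * x 1) = 0 := by linear_combination h1
        have f0 := (mul_eq_zero.mp e0).resolve_left (h2 k)
        have f1 := (mul_eq_zero.mp e1).resolve_left (h2 k)
        have g0 : (3 : ℚ_[2]) * (x 0 : ℚ_[2]) = 0 := by linear_combination 2 * f0 - f1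
        have g1 : (3 : ℚ_[2]) * (x 1 : ℚ_[2]) = 0 := by linear_combination 2 * f1 - f0
        exact ⟨(mul_eq_zero.mp g0).resolve_left three_ne_zero,
          (mul_eq_zero.mp g1).resolve_left three_ne_zero⟩
    funext a
    change Fin 2 at a
    fin_cases a
    · exact Subtype.ext key.1
    · exact Subtype.ext key.2
  · change Fin 1 → ℤ_[2] at x
    change ∀ b : Fin 1, ∑ a : Fin 1, (x a : ℚ_[2]) * _ = 0 at h
    have h0 := h 0
    have h3 : ((ε.oddity s : ℤ) : ℚ_[2]) ≠ 0 := by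
      cases ε <;> cases s <;> simp [FineSign.oddity]
    simp [gram, h2, h3] at h0
    funext a
    change Fin 1 at a
    rw [Subsingleton.elim a 0]
    exact h0

/-- The orthogonal direct sum of the lattices denoted by a finite family of terms. -/
noncomputable def sumLattice {ι : Type} [Fintype ι] (t : ι → FineTerm) : TwoAdicLattice where
  carrier := ∀ i, Fin (t i).dim → ℤ_[2]
  form := LinearMap.mk₂ ℤ_[2]
    (fun x y => ∑ i, ∑ b, (∑ a, (x i a : ℚ_[2]) * (t i).gram a b) * (y i b : ℚ_[2]))
    (by intro x x' y; simp [add_mul, Finset.sum_add_distrib])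
    (by intro c x y; simp [Finset.mul_sum, Finset.sum_mul, Algebra.smul_def, mul_assoc])
    (by intro x y y'; simp [mul_add, Finset.sum_add_distrib])
    (by intro c x y; simp [Finset.mul_sum, Algebra.smul_def, mul_left_comm])
  symm := by
    intro x y
    simp only [LinearMap.mk₂_apply, Finset.sum_mul]
    refine Finset.sum_congr rfl fun i _ => ?_
    rw [Finset.sum_comm]
    refine Finset.sum_congr rfl fun a _ => Finset.sum_congr rfl fun b _ => ?_
    rw [gram_symm (t i) a b]
    ring
  nondegenerate := by
    classical
    intro x h
    funext i
    refine gram_nondegenerate (t i) (x i) fun b => ?_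
    have := h (Pi.single i (Pi.single b 1))
    rw [LinearMap.mk₂_apply, Finset.sum_eq_single i, Finset.sum_eq_single b] at this
    · simpa using this
    · intro b' _ hb; simp [Pi.single_eq_of_ne hb]
    · simp
    · intro j _ hj; simp [Pi.single_eq_of_ne hj]
    · simp

end FineTerm

/-- A fine symbol: a finite collection of terms, up to order, in which all terms of any one scale
have the same type (as in the fine decompositions which the symbols describe). -/
@[ext]
structure FineSymbol where
  terms : Multiset FineTerm
  same_type : ∀ t ∈ terms, ∀ u ∈ terms, t.logScale = u.logScale → (t.IsTypeI ↔ u.IsTypeI)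

namespace FineSymbol

/-- The lattice represented by a fine symbol: the orthogonal direct sum of the lattices denoted by
its terms. (`Multiset.ToType` is the index type that lists each term with its multiplicity.) -/
noncomputable def lattice (F : FineSymbol) : TwoAdicLattice :=
  FineTerm.sumLattice fun i : F.terms.ToType => i.1

/-- A collection of type I terms of `F`, the set of whose scales is a nonempty set of
consecutive powers of `2`. -/
def IsConsecutive (F : FineSymbol) (C : Multiset FineTerm) : Prop :=
  C ≤ F.terms ∧ C ≠ 0 ∧ (∀ t ∈ C, t.IsTypeI) ∧
    {k : ℤ | ∃ t ∈ C, t.logScale = k}.OrdConnected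

/-- A compartment: a maximal such collection. -/
def IsCompartment (F : FineSymbol) (C : Multiset FineTerm) : Prop :=
  Maximal F.IsConsecutive C

/-- Two scales are adjacent if they differ by a factor of `2`. -/
def Adjacent (t u : FineTerm) : Prop :=
  t.logScale = u.logScale + 1 ∨ u.logScale = t.logScale + 1

/-- Two scales differ by a factor of `4`. -/
def DifferByFour (t u : FineTerm) : Prop :=
  t.logScale = u.logScale + 2 ∨ u.logScale = t.logScale + 2

/-- Sign walking between two terms `t`, `u` of a symbol `F`; the other terms are `S`. -/
inductive SignWalk (F F' : FineSymbol) : Prop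
  | sameScale (t u : FineTerm) (S : Multiset FineTerm)
      (hscale : t.logScale = u.logScale)
      (hF : F.terms = t ::ₘ u ::ₘ S)
      (hF' : F'.terms = t.negSign ::ₘ u.negSign ::ₘ S)
  | adjacentDifferentTypes (t u : FineTerm) (S : Multiset FineTerm)
      (hscale : Adjacent t u)
      (htype : ¬ (t.IsTypeI ↔ u.IsTypeI))
      (hF : F.terms = t ::ₘ u ::ₘ S)
      (hF' : F'.terms = t.negSign ::ₘ u.negSign ::ₘ S)
  | adjacentSameStatus (t u : FineTerm) (S : Multiset FineTerm)
      (hscale : Adjacent t u)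
      (hstatus : (t.IsGiver ∧ u.IsGiver) ∨ (t.IsReceiver ∧ u.IsReceiver))
      (hF : F.terms = t ::ₘ u ::ₘ S)
      (hF' : F'.terms = t.negSign.swapSubscript ::ₘ u.negSign.swapSubscript ::ₘ S)
  | differByFour (t u : FineTerm) (S : Multiset FineTerm)
      (hscale : DifferByFour t u)
      (htype : t.IsTypeI ∧ u.IsTypeI)
      (hF : F.terms = t ::ₘ u ::ₘ S)
      (hF' : F'.terms = t.negSign ::ₘ u.negSign ::ₘ S)

/-- Giver permutation: permute the subscripts `G` and `R` within a compartment, whose terms are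
listed here as the `typeI (k i) (ε i) (s i)`; the other terms are `S`. -/
def GiverPermutation (F F' : FineSymbol) : Prop :=
  ∃ (n : ℕ) (k : Fin n → ℤ) (ε : Fin n → FineSign) (s : Fin n → FineSubscript)
    (σ : Equiv.Perm (Fin n)) (S : Multiset FineTerm),
    F.IsCompartment (Finset.univ.val.map fun i => FineTerm.typeI (k i) (ε i) (s i)) ∧
    F.terms = (Finset.univ.val.map fun i => FineTerm.typeI (k i) (ε i) (s i)) + S ∧
    F'.terms = (Finset.univ.val.map fun i => FineTerm.typeI (k i) (ε i) (s (σ i))) + S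

/-- Giver conversion: convert four givers `A` of a compartment `C` to receivers, or four receivers
to givers; the other terms of the symbol are `S`. -/
def GiverConversion (F F' : FineSymbol) : Prop :=
  ∃ C A S : Multiset FineTerm, F.IsCompartment C ∧ A ≤ C ∧ A.card = 4 ∧
    ((∀ t ∈ A, t.IsGiver) ∨ (∀ t ∈ A, t.IsReceiver)) ∧
    F.terms = A + S ∧ F'.terms = A.map FineTerm.swapSubscript + S

/-- One sign walking, giver permutation or giver conversion operation. -/
def Move (F F' : FineSymbol) : Prop :=
  F.SignWalk F' ∨ F.GiverPermutation F' ∨ F.GiverConversion F'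

/-- Two fine symbols are related by a (possibly empty) sequence of operations. -/
def Related (F F' : FineSymbol) : Prop :=
  Relation.ReflTransGen Move F F'

end FineSymbol

/-! ### Orthogonal sums and explicit isometries -/

namespace TwoAdicLattice

/-! Both directions pass through the same invariants of a symbol: the number of terms of each scale
and type, and, for each m such that no type I term has scale 2^m, the phase in `ZMod 8` of a
quadratic Gauss sum.

These depend only on the lattice. Multiply the form by 2^K to make it integral and reduce modulo
2^n. The radical has order 2 to the power Σ dim · min(n, k + K), summed over terms of scale 2^k, and
second differences in n recover the rank at each scale (`dimAt_eq_of_isometric`). The Gauss sum of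
exp(2πi (z,z) / 2^n) with n = m + 1 + K is a product over the terms. It vanishes exactly when some
type I term has scale 2^m (`hasTypeI_iff_of_isometric`); otherwise it is a positive real times an
eighth root of unity (`totalPhase_eq_of_isometric`). Terms of scale below 2^m contribute ±1 to its
exponent for a giver or receiver, and 4 for a minus sign when the distance to m has the right
parity; the other terms contribute nothing.

Conversely, two symbols with equal invariants may be indexed by one set with common scales and types
(`ScaleShape`), so that only signs and subscripts differ. Let D(c), which is 0 or 4, record the
parity of the number of sign disagreements at scales up to 2^c (`signDiff`). Comparing phases at c
and c + 1 shows that D(c) = 0 unless one of these scales carries type I terms. Hence wherever D(c) ≠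
0 a sign walk across the gap is available; the one obstruction, a compartment consisting of just two
adjacent terms with opposite subscripts, is excluded by the phases. Each such walk shrinks the
finite set where D ≠ 0. Once D = 0, disagreements at each scale are even in number and same-scale
walks remove them. With equal signs, the phases on the two sides of a compartment say that the sums
of ±1 over its subscripts agree modulo 8. Opposite mismatches can therefore be exchanged, and
mismatches all of one kind come in multiples of four (`equivalent_of_phaseEq`).

The operations used here are built from sign walks, exchanges of subscripts at equal or adjacent
scales, and conversions within one scale, all of which are isometries by explicit changes of basis.
So equal invariants imply both relatedness and isometry (`SameInvariants.equivalent`). General giver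
permutations and conversions visibly preserve the invariants, and are isometries for that reason. -/

theorem Isometric.refl (L : TwoAdicLattice) : L.Isometric L :=
  ⟨LinearEquiv.refl _ _, fun _ _ => rfl⟩

theorem Isometric.symm {L M : TwoAdicLattice} : L.Isometric M → M.Isometric L := by
  rintro ⟨e, he⟩
  exact ⟨e.symm, fun x y => by rw [← he, e.apply_symm_apply, e.apply_symm_apply]⟩

theorem Isometric.trans {L M N : TwoAdicLattice} :
    L.Isometric M → M.Isometric N → L.Isometric N := by
  rintro ⟨e, he⟩ ⟨f, hf⟩
  exact ⟨e.trans f, fun x y => by simp [he, hf]⟩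

/-- A form-preserving linear map is injective, so it is an isometry as soon as it is surjective. -/
theorem Isometric.of_surjective {L M : TwoAdicLattice} (f : L.carrier →ₗ[ℤ_[2]] M.carrier)
    (hf : ∀ x y, M.form (f x) (f y) = L.form x y) (hs : ∀ y, ∃ x, f x = y) : L.Isometric M := by
  have hi : Function.Injective f := by
    rw [injective_iff_map_eq_zero]
    intro x hx
    refine L.nondegenerate x fun y => ?_
    rw [← hf, hx]; simp
  exact ⟨LinearEquiv.ofBijective f ⟨hi, hs⟩, hf⟩

/-- The orthogonal sum of two lattices. -/
@[reducible] noncomputable def osum (L M : TwoAdicLattice) : TwoAdicLattice where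
  carrier := L.carrier × M.carrier
  form := LinearMap.mk₂ ℤ_[2] (fun x y => L.form x.1 y.1 + M.form x.2 y.2)
    (by intro x x' y; simp; ring) (by intro c x y; simp)
    (by intro x y y'; simp; ring) (by intro c x y; simp)
  symm x y := by simp [L.symm x.1, M.symm x.2]
  nondegenerate := by
    intro x h
    refine Prod.ext (L.nondegenerate _ fun y => ?_) (M.nondegenerate _ fun y => ?_)
    · simpa using h (y, 0)
    · simpa using h (0, y)

theorem osum_congr {L L' M M' : TwoAdicLattice} :
    L.Isometric L' → M.Isometric M' → (osum L M).Isometric (osum L' M') := by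
  rintro ⟨e, he⟩ ⟨f, hf⟩
  exact ⟨e.prodCongr f, fun x y => by simp [he, hf]⟩

theorem osum_comm (L M : TwoAdicLattice) : (osum L M).Isometric (osum M L) :=
  ⟨LinearEquiv.prodComm _ _ _, fun x y => by simp [add_comm]⟩

theorem osum_assoc (L M N : TwoAdicLattice) :
    (osum (osum L M) N).Isometric (osum L (osum M N)) :=
  ⟨LinearEquiv.prodAssoc _ _ _ _, fun x y => by simp [add_assoc]⟩

/-- The lattice of rank zero. -/
@[reducible] noncomputable def zeroLattice : TwoAdicLattice where
  carrier := PUnit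
  form := 0
  symm _ _ := rfl
  nondegenerate _ _ := rfl

/-- The rank one lattice `⟨a⟩`. -/
@[reducible] noncomputable def rankOne (a : ℚ_[2]) (ha : a ≠ 0) : TwoAdicLattice where
  carrier := ℤ_[2]
  form := LinearMap.mk₂ ℤ_[2] (fun x y => a * (x : ℚ_[2]) * y)
    (by intro x x' y; push_cast; ring)
    (by intro c x y; simp [Algebra.smul_def]; ring)
    (by intro x y y'; push_cast; ring)
    (by intro c x y; simp [Algebra.smul_def]; ring)
  symm x y := by simp; ring
  nondegenerate := by
    intro x h
    simpa [ha] using h 1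

/-- The lattice with inner product matrix `c * !![2 * a, 1; 1, 2 * a]`. -/
@[reducible] noncomputable def evenPlane (a : ℤ) (c : ℚ_[2]) (hc : c ≠ 0) : TwoAdicLattice where
  carrier := ℤ_[2] × ℤ_[2]
  form := LinearMap.mk₂ ℤ_[2] (fun x y => c * (2 * a * (x.1 : ℚ_[2]) * y.1 + x.1 * y.2 + x.2 * y.1
      + 2 * a * (x.2 : ℚ_[2]) * y.2))
    (by intro x x' y; push_cast [Prod.fst_add, Prod.snd_add]; ring)
    (by intro c x y; simp [Algebra.smul_def]; ring)
    (by intro x y y'; push_cast [Prod.fst_add, Prod.snd_add]; ring)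
    (by intro c x y; simp [Algebra.smul_def]; ring)
  symm x y := by simp; ring_nf; simp
  nondegenerate := by
    intro x h
    have h0 := (mul_eq_zero.mp (h (1, 0))).resolve_left hc
    have h1 := (mul_eq_zero.mp (h (0, 1))).resolve_left hc
    simp at h0 h1
    have hd : (1 - 4 * (a : ℚ_[2]) ^ 2) ≠ 0 := by
      have : (1 - 4 * a ^ 2 : ℤ) ≠ 0 := by intro h; omega
      exact_mod_cast this
    have e0 : (1 - 4 * (a : ℚ_[2]) ^ 2) * x.1 = 0 := by linear_combination h1 - 2 * a * h0
    have e1 : (1 - 4 * (a : ℚ_[2]) ^ 2) * x.2 = 0 := by linear_combination h0 - 2 * a * h1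
    simp [hd] at e0 e1
    exact Prod.ext e0 e1

/-! ### Unit squares in ℤ₂ and explicit changes of basis -/

theorem isUnit_intCast_of_odd {n : ℤ} (hn : Odd n) : IsUnit (n : ℤ_[2]) := by
  rw [PadicInt.isUnit_iff]
  by_contra h
  have := lt_of_le_of_ne (PadicInt.norm_le_one (n : ℤ_[2])) h
  rw [PadicInt.norm_intCast_lt_one_iff] at this
  have : (2 : ℤ) ∣ n := by exact_mod_cast this
  rcases hn with ⟨k, rfl⟩
  omega

/-- Hensel's lemma for X² - n at 1: the value has norm at most 1/8, while the derivative 2 has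
squared norm 1/4. -/
theorem exists_sq_eq_intCast {n : ℤ} (hn : n ≡ 1 [ZMOD 8]) : ∃ v : ℤ_[2], v * v = n := by
  obtain ⟨k, hk⟩ := hn.symm.dvd
  have hF := hensels_lemma (p := 2) (R := ℤ_[2]) (F := Polynomial.X ^ 2 - Polynomial.C (n : ℤ_[2]))
    (a := 1) (by
      have h2 : ‖(2 : ℤ_[2])‖ = 2⁻¹ := by simpa using PadicInt.norm_p (p := 2)
      have h1 : (1 - n : ℤ_[2]) = 2 * 2 * 2 * (-k : ℤ) := by
        have : (1 - n : ℤ) = 2 * 2 * 2 * (-k) := by linarith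
        exact_mod_cast congrArg (Int.cast : ℤ → ℤ_[2]) this
      have h3 := PadicInt.norm_le_one ((-k : ℤ) : ℤ_[2])
      simp only [map_sub, map_pow, Polynomial.aeval_X, Polynomial.aeval_C, 
        Polynomial.derivative_X_pow, Polynomial.derivative_C]
      simp only [one_pow, Algebra.algebraMap_self, RingHom.id_apply, h1, norm_mul, h2]
      simp [h2]
      simp at h3
      nlinarith)
  obtain ⟨z, hz, -⟩ := hF
  refine ⟨z, ?_⟩
  simp [sub_eq_zero] at hz
  rw [← hz]; ring

/-- Scaling the generator of a rank one lattice by a unit. -/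
theorem rankOne_isometric_of_unit {a b : ℚ_[2]} (ha : a ≠ 0) (hb : b ≠ 0) (v : ℤ_[2]ˣ)
    (h : a = b * v * v) : (rankOne a ha).Isometric (rankOne b hb) := by
  refine Isometric.of_surjective (LinearMap.lsmul ℤ_[2] ℤ_[2] (v : ℤ_[2])) ?_ fun y => ⟨(v⁻¹ : ℤ_[2]ˣ) * y, by simp⟩
  intro x y
  simp [h]
  ring

theorem zpow_two_mul_ne_zero (k : ℤ) {n : ℤ} (hn : Odd n) : (2 : ℚ_[2]) ^ k * n ≠ 0 := by
  refine mul_ne_zero (zpow_ne_zero _ two_ne_zero) ?_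
  have : n ≠ 0 := by rintro rfl; simp at hn
  exact_mod_cast this

/-- Since n² ≡ 1 modulo 8, the product mn is a unit square v², and m = n (v/n)². -/
theorem rankOne_isometric_of_modEq (k : ℤ) {m n : ℤ} (hm : Odd m) (hn : Odd n)
    (h : m ≡ n [ZMOD 8]) : (rankOne _ (zpow_two_mul_ne_zero k hm)).Isometric
      (rankOne _ (zpow_two_mul_ne_zero k hn)) := by
  have hmn : m * n ≡ 1 [ZMOD 8] := by
    have h1 : n % 8 = 1 ∨ n % 8 = 3 ∨ n % 8 = 5 ∨ n % 8 = 7 := by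
      rcases hn with ⟨l, rfl⟩; omega
    unfold Int.ModEq at h ⊢
    rw [Int.mul_emod, h]
    rcases h1 with h1 | h1 | h1 | h1 <;> rw [h1] <;> rfl
  obtain ⟨v, hv⟩ := exists_sq_eq_intCast hmn
  obtain ⟨w, hw⟩ := isUnit_intCast_of_odd hn
  have hu : IsUnit v := by
    have : IsUnit (v * v) := by rw [hv]; exact isUnit_intCast_of_odd (hm.mul hn)
    exact isUnit_of_mul_isUnit_left this
  obtain ⟨v, rfl⟩ := hu
  refine rankOne_isometric_of_unit _ _ (v * w⁻¹) ?_
  have e1 : (w : ℚ_[2]) = n := by simpa using congrArg (Subtype.val) hw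
  have e2 : (v : ℚ_[2]) * v = m * n := by simpa using congrArg (Subtype.val) hv
  have e3 : (w : ℚ_[2]) * ((w⁻¹ : ℤ_[2]ˣ) : ℤ_[2]) = 1 := by
    have : (w : ℤ_[2]) * ((w⁻¹ : ℤ_[2]ˣ) : ℤ_[2]) = 1 := by simp
    exact_mod_cast congrArg (Subtype.val) this
  push_cast
  set i : ℚ_[2] := (((w⁻¹ : ℤ_[2]ˣ) : ℤ_[2]) : ℚ_[2])
  rw [e1] at e3
  linear_combination (-(2 : ℚ_[2]) ^ k * n * i * i) * e2 + (-(2 : ℚ_[2]) ^ k * m) * (n * i + 1) * e3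

theorem two_pow_ne_zero (k : ℤ) : (2 : ℚ_[2]) ^ k ≠ 0 := zpow_ne_zero _ two_ne_zero

/-- `⟨m⟩ ⊕ ⟨2 ^ r n⟩ ≅ ⟨N⟩ ⊕ ⟨2 ^ r m n N⟩` for `N = m + 2 ^ r c ^ 2 n`. -/
theorem rankOne_osum_isometric (k : ℤ) (r : ℕ) (c : ℤ) {m n m' n' : ℤ} (hm : Odd m) (hn : Odd n)
    (hm' : Odd m') (hn' : Odd n')
    (h1 : m' ≡ m + 2 ^ r * c ^ 2 * n [ZMOD 8]) (h2 : n' ≡ m * n * m' [ZMOD 8]) :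
    (osum (rankOne _ (zpow_two_mul_ne_zero k hm)) (rankOne _ (zpow_two_mul_ne_zero (k + r) hn))).Isometric
    (osum (rankOne _ (zpow_two_mul_ne_zero k hm')) (rankOne _ (zpow_two_mul_ne_zero (k + r) hn'))) := by
  set N := m + 2 ^ r * c ^ 2 * n with hN
  have hNo : Odd N := by
    unfold Int.ModEq at h1; rw [Int.odd_iff] at hm' ⊢; omega
  have h3 : Odd (m * n * N) := (hm.mul hn).mul hNo
  refine Isometric.trans (Isometric.symm ?_) (osum_congr (rankOne_isometric_of_modEq k hNo hm' h1.symm)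
    (rankOne_isometric_of_modEq (k + r) h3 hn'
      ((Int.ModEq.mul_left _ h1.symm).trans h2.symm)))
  obtain ⟨w, hw⟩ := isUnit_intCast_of_odd hNo
  -- The new basis is e + c f and the orthogonal vector 2^r c n e - m f, of norms proportional to N
  -- and 2^r m n N. The determinant is -N, a unit because N is odd.
  refine Isometric.of_surjective
    { toFun := fun p => (p.1 + 2 ^ r * c * n * p.2, c * p.1 - m * p.2)
      map_add' := by intro x y; ext <;> simp <;> ring
      map_smul' := by intro a x; ext <;> simp <;> ring } ?_ ?_
  · intro x y
    simp only [LinearMap.mk₂_apply, LinearMap.coe_mk, AddHom.coe_mk, hN]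
    have h2 : ((2 : ℤ_[2]) : ℚ_[2]) = 2 := rfl
    push_cast [zpow_add₀ (two_ne_zero : (2 : ℚ_[2]) ≠ 0), zpow_natCast, h2]
    ring
  · intro y
    have hw' : (w : ℤ_[2]) = m + 2 ^ r * c ^ 2 * n := by rw [hw, hN]; push_cast; ring
    have hi : (w⁻¹ : ℤ_[2]ˣ) * (w : ℤ_[2]) = 1 := by simp
    rw [hw'] at hi
    refine ⟨((w⁻¹ : ℤ_[2]ˣ) * (m * y.1 + 2 ^ r * c * n * y.2), (w⁻¹ : ℤ_[2]ˣ) * (c * y.1 - y.2)), ?_⟩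
    ext1
    · simp only [LinearMap.coe_mk, AddHom.coe_mk]
      linear_combination y.1 * hi
    · simp only [LinearMap.coe_mk, AddHom.coe_mk]
      linear_combination y.2 * hi

theorem exists_three_mul_eq_one : ∃ w : ℤ_[2], 3 * w = 1 := by
  obtain ⟨w, hw⟩ := (isUnit_intCast_of_odd (n := 3) (by decide)).exists_right_inv
  exact ⟨w, by exact_mod_cast hw⟩

theorem coe_two : ((2 : ℤ_[2]) : ℚ_[2]) = 2 := rfl

theorem intCast_ne_zero_of_odd {u : ℤ} (hu : Odd u) : (u : ℚ_[2]) ≠ 0 := by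
  have : u ≠ 0 := by rintro rfl; simp at hu
  exact_mod_cast this

theorem evenPlane_zero_scale {c : ℚ_[2]} (hc : c ≠ 0) {u : ℤ} (hu : Odd u) :
    (evenPlane 0 (c * u) (mul_ne_zero hc (intCast_ne_zero_of_odd hu))).Isometric
      (evenPlane 0 c hc) := by
  obtain ⟨w, hw⟩ := (isUnit_intCast_of_odd hu).exists_right_inv
  refine Isometric.of_surjective
    { toFun := fun p => (u * p.1, p.2)
      map_add' := by intro x y; ext <;> simp; ring
      map_smul' := by intro a x; ext <;> simp; ring } ?_ ?_
  · intro x y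
    simp only [LinearMap.mk₂_apply, LinearMap.coe_mk, AddHom.coe_mk]
    push_cast
    ring
  · intro y
    refine ⟨(w * y.1, y.2), ?_⟩
    ext1
    · simp only [LinearMap.coe_mk, AddHom.coe_mk]
      linear_combination y.1 * hw
    · rfl

/-- The form is twice the norm form x² + xy + y² of ℤ₂[ω], where ω² = ω - 1. Multiplication by an
element scales it by the norm of that element, norms meet every odd class modulo 8, and what is left
is a unit square. -/
theorem evenPlane_one_scale {c : ℚ_[2]} (hc : c ≠ 0) {u : ℤ} (hu : Odd u) :
    (evenPlane 1 (c * u) (mul_ne_zero hc (intCast_ne_zero_of_odd hu))).Isometric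
      (evenPlane 1 c hc) := by
  obtain ⟨p, q, hpq⟩ : ∃ p q : ℤ, (p * p + p * q + q * q) * u ≡ 1 [ZMOD 8] := by
    have h1 : u % 8 = 1 ∨ u % 8 = 3 ∨ u % 8 = 5 ∨ u % 8 = 7 := by
      rcases hu with ⟨l, rfl⟩; omega
    rcases h1 with h1 | h1 | h1 | h1
    · exact ⟨1, 0, by simp [Int.ModEq, h1]⟩
    · exact ⟨1, 1, by simp [Int.ModEq, Int.mul_emod, h1]⟩
    · exact ⟨4, 1, by simp [Int.ModEq, Int.mul_emod, h1]⟩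
    · exact ⟨2, 1, by simp [Int.ModEq, Int.mul_emod, h1]⟩
  obtain ⟨v, hv⟩ := exists_sq_eq_intCast hpq
  have hpo : Odd ((p * p + p * q + q * q) * u) := by
    rw [Int.odd_iff]; unfold Int.ModEq at hpq; omega
  obtain ⟨i, hi⟩ := (isUnit_intCast_of_odd (Int.odd_mul.mp hpo).1).exists_right_inv
  obtain ⟨j, hj⟩ := (isUnit_intCast_of_odd hu).exists_right_inv
  push_cast at hv hi
  have hv' : (v : ℚ_[2]) * v = (p * p + p * q + q * q) * u := by
    exact_mod_cast congrArg Subtype.val hv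
  have hi' : ((p : ℚ_[2]) * p + p * q + q * q) * i = 1 := by
    exact_mod_cast congrArg Subtype.val hi
  -- Multiplication by (v/ν)(p + qω), where ν = p² + pq + q² and v² = νu; its norm is v²/ν = u.
  refine Isometric.of_surjective
    { toFun := fun x => (v * i * (p * x.1 - q * x.2), v * i * (q * x.1 + (p + q) * x.2))
      map_add' := by intro x y; ext <;> simp <;> ring
      map_smul' := by intro a x; ext <;> simp <;> ring } ?_ ?_
  · intro x y
    simp only [LinearMap.mk₂_apply, LinearMap.coe_mk, AddHom.coe_mk]
    push_cast
    set ν : ℚ_[2] := p * p + p * q + q * q with hν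
    have e : (v : ℚ_[2]) * v * i * i * ν = u := by
      rw [hv']; linear_combination (u : ℚ_[2]) * (ν * i + 1) * hi'
    rw [hν] at e
    linear_combination (c * (2 * (x.1 : ℚ_[2]) * y.1 + x.1 * y.2 + x.2 * y.1
      + 2 * (x.2 : ℚ_[2]) * y.2)) * e
  · intro y
    refine ⟨(v * i * j * ((p + q) * y.1 + q * y.2), v * i * j * (-q * y.1 + p * y.2)), ?_⟩
    have e : v * v * i * i * j * (p * p + p * q + q * q) = 1 := by
      rw [hv]
      linear_combination ((p * p + p * q + q * q) * i + 1) * u * j * hi + hj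
    ext1
    · simp only [LinearMap.coe_mk, AddHom.coe_mk]
      linear_combination y.1 * e
    · simp only [LinearMap.coe_mk, AddHom.coe_mk]
      linear_combination y.2 * e

/-- The vectors (1;1,-1), (2;1,0), (2;0,-1) of the right-hand lattice have the required Gram matrix,
and determinant 3, a unit. This is sign walking from a type I term to a type II term of twice the
scale. -/
theorem rankOne_osum_evenPlane_aux {c : ℚ_[2]} (hc : c ≠ 0) :
    (osum (rankOne (c * (-3)) (mul_ne_zero hc (by norm_num)))
      (evenPlane 1 (c * 2) (mul_ne_zero hc two_ne_zero))).Isometric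
    (osum (rankOne c hc) (evenPlane 0 (c * 2) (mul_ne_zero hc two_ne_zero))) := by
  obtain ⟨w, hw⟩ := exists_three_mul_eq_one
  refine Isometric.of_surjective
    { toFun := fun p => (p.1 + 2 * p.2.1 + 2 * p.2.2, p.1 + p.2.1, -p.1 - p.2.2)
      map_add' := by intro x y; ext <;> simp <;> ring
      map_smul' := by intro a x; ext <;> simp <;> ring } ?_ ?_
  · intro x y
    simp only [LinearMap.mk₂_apply, LinearMap.coe_mk, AddHom.coe_mk]
    push_cast [coe_two]
    ring
  · intro y
    refine ⟨(-w * (y.1 - 2 * y.2.1 + 2 * y.2.2), y.2.1 + w * (y.1 - 2 * y.2.1 + 2 * y.2.2),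
      -y.2.2 + w * (y.1 - 2 * y.2.1 + 2 * y.2.2)), ?_⟩
    refine Prod.ext ?_ (Prod.ext ?_ ?_)
    · simp only [LinearMap.coe_mk, AddHom.coe_mk]
      linear_combination (y.1 - 2 * y.2.1 + 2 * y.2.2) * hw
    · simp only [LinearMap.coe_mk, AddHom.coe_mk]
      ring
    · simp only [LinearMap.coe_mk, AddHom.coe_mk]
      ring

/-- The same with (1;2,-2), (1;1,0), (1;0,-1), again of determinant 3; here the type II term has
half the scale. -/
theorem rankOne_two_osum_evenPlane_aux {c : ℚ_[2]} (hc : c ≠ 0) :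
    (osum (rankOne (c * 2 * (-3)) (mul_ne_zero (mul_ne_zero hc two_ne_zero) (by norm_num)))
      (evenPlane 1 c hc)).Isometric
    (osum (rankOne (c * 2) (mul_ne_zero hc two_ne_zero)) (evenPlane 0 c hc)) := by
  obtain ⟨w, hw⟩ := exists_three_mul_eq_one
  refine Isometric.of_surjective
    { toFun := fun p => (p.1 + p.2.1 + p.2.2, 2 * p.1 + p.2.1, -2 * p.1 - p.2.2)
      map_add' := by intro x y; ext <;> simp <;> ring
      map_smul' := by intro a x; ext <;> simp <;> ring } ?_ ?_
  · intro x y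
    simp only [LinearMap.mk₂_apply, LinearMap.coe_mk, AddHom.coe_mk]
    push_cast [coe_two]
    ring
  · intro y
    refine ⟨(-w * (y.1 - y.2.1 + y.2.2), y.2.1 + 2 * w * (y.1 - y.2.1 + y.2.2),
      -y.2.2 + 2 * w * (y.1 - y.2.1 + y.2.2)), ?_⟩
    refine Prod.ext ?_ (Prod.ext ?_ ?_)
    · simp only [LinearMap.coe_mk, AddHom.coe_mk]
      linear_combination (y.1 - y.2.1 + y.2.2) * hw
    · simp only [LinearMap.coe_mk, AddHom.coe_mk]
      ring
    · simp only [LinearMap.coe_mk, AddHom.coe_mk]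
      ring

/-- The four image vectors are isotropic and split into two orthogonal pairs with inner product 3c.
Up to unit factors, which do not matter for even planes, this negates the signs of two type II terms
of one scale. -/
theorem evenPlane_one_osum_neg {c : ℚ_[2]} (hc : c ≠ 0) :
    (osum (evenPlane 0 (c * 3) (mul_ne_zero hc three_ne_zero))
      (evenPlane 0 (c * 3) (mul_ne_zero hc three_ne_zero))).Isometric
    (osum (evenPlane 1 c hc) (evenPlane 1 (c * (-1)) (mul_ne_zero hc (by norm_num)))) := by
  obtain ⟨w, hw⟩ := exists_three_mul_eq_one
  refine Isometric.of_surjective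
    { toFun := fun p => ((p.1.1 + p.1.2 - p.2.2, p.2.1 + p.2.2),
        (p.1.1 - p.1.2, p.1.2 + p.2.1 - p.2.2))
      map_add' := by intro x y; ext <;> simp <;> ring
      map_smul' := by intro a x; ext <;> simp <;> ring } ?_ ?_
  · intro x y
    simp only [LinearMap.mk₂_apply, LinearMap.coe_mk, AddHom.coe_mk]
    push_cast
    ring
  · intro y
    refine ⟨((y.2.1 + w * (2 * (y.1.1 - y.2.1) + (y.1.2 - y.2.2)),
      w * (2 * (y.1.1 - y.2.1) + (y.1.2 - y.2.2))),
      (y.1.2 - w * (2 * (y.1.2 - y.2.2) + (y.1.1 - y.2.1)),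
      w * (2 * (y.1.2 - y.2.2) + (y.1.1 - y.2.1)))), ?_⟩
    refine Prod.ext (Prod.ext ?_ ?_) (Prod.ext ?_ ?_)
    · simp only [LinearMap.coe_mk, AddHom.coe_mk]
      linear_combination (y.1.1 - y.2.1) * hw
    · simp only [LinearMap.coe_mk, AddHom.coe_mk]
      ring
    · simp only [LinearMap.coe_mk, AddHom.coe_mk]
      ring
    · simp only [LinearMap.coe_mk, AddHom.coe_mk]
      linear_combination (y.2.2 - y.1.2) * hw

/-- The vector (1,1,1) has norm 3c, and its orthogonal complement is spanned by (1,-1,0) and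
(1,0,-1). Together they have index 3 over ℤ, which is invertible over ℤ₂. -/
theorem rankOne_cubed_isometric {c : ℚ_[2]} (hc : c ≠ 0) :
    (osum (rankOne (c * 3) (mul_ne_zero hc three_ne_zero)) (evenPlane 1 c hc)).Isometric
    (osum (rankOne c hc) (osum (rankOne c hc) (rankOne c hc))) := by
  obtain ⟨w, hw⟩ := exists_three_mul_eq_one
  refine Isometric.of_surjective
    { toFun := fun p => (p.1 + p.2.1 + p.2.2, p.1 - p.2.1, p.1 - p.2.2)
      map_add' := by intro x y; ext <;> simp <;> ring
      map_smul' := by intro a x; ext <;> simp <;> ring } ?_ ?_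
  · intro x y
    simp only [LinearMap.mk₂_apply, LinearMap.coe_mk, AddHom.coe_mk]
    push_cast
    ring
  · intro y
    refine ⟨(w * (y.1 + y.2.1 + y.2.2), w * (y.1 + y.2.1 + y.2.2) - y.2.1,
      w * (y.1 + y.2.1 + y.2.2) - y.2.2), ?_⟩
    refine Prod.ext ?_ (Prod.ext ?_ ?_)
    · simp only [LinearMap.coe_mk, AddHom.coe_mk]
      linear_combination (y.1 + y.2.1 + y.2.2) * hw
    · simp only [LinearMap.coe_mk, AddHom.coe_mk]
      ring
    · simp only [LinearMap.coe_mk, AddHom.coe_mk]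
      ring

end TwoAdicLattice

/-! ### The lattice of a fine symbol as an iterated orthogonal sum -/

theorem FineSign.odd_oddity (ε : FineSign) (s : FineSubscript) : Odd (ε.oddity s) := by
  cases ε <;> cases s <;> decide

/-- The parameter `a` for which `q^{ε2}_{II}` has inner product matrix `q * !![2 * a, 1; 1, 2 * a]`. -/
def FineSign.evenParam : FineSign → ℤ
  | plus => 0
  | minus => 1

namespace FineTerm

open TwoAdicLattice

/-- The lattice denoted by a term, in coordinates convenient for computation. -/
@[reducible] noncomputable def lattice : FineTerm → TwoAdicLattice
  | typeII k ε => evenPlane ε.evenParam (2 ^ k) (two_pow_ne_zero k)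
  | typeI k ε s => rankOne (2 ^ k * (ε.oddity s : ℤ)) (zpow_two_mul_ne_zero k (ε.odd_oddity s))

/-- The bilinear form of the lattice denoted by a term. -/
noncomputable def termForm (t : FineTerm) (x y : Fin t.dim → ℤ_[2]) : ℚ_[2] :=
  ∑ b, (∑ a, (x a : ℚ_[2]) * t.gram a b) * (y b : ℚ_[2])

theorem sumLattice_form {ι : Type} [Fintype ι] (t : ι → FineTerm)
    (x y : ∀ i, Fin (t i).dim → ℤ_[2]) :
    (sumLattice t).form x y = ∑ i, termForm (t i) (x i) (y i) := rfl

theorem exists_lattice_equiv (t : FineTerm) :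
    ∃ e : (Fin t.dim → ℤ_[2]) ≃ₗ[ℤ_[2]] t.lattice.carrier,
      ∀ x y, t.lattice.form (e x) (e y) = termForm t x y := by
  rcases t with ⟨k, ε⟩ | ⟨k, ε, s⟩
  · refine ⟨LinearEquiv.finTwoArrow ℤ_[2] ℤ_[2], fun x y => ?_⟩
    change Fin 2 → ℤ_[2] at x y
    change (evenPlane ε.evenParam (2 ^ k) (two_pow_ne_zero k)).form (x 0, x 1) (y 0, y 1) =
      ∑ b : Fin 2, (∑ a : Fin 2, (x a : ℚ_[2]) * _) * (y b : ℚ_[2])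
    cases ε <;>
    simp only [gram, Fin.sum_univ_two, Matrix.smul_apply, Matrix.of_apply, FineSign.evenParam,
      Matrix.cons_val_zero, Matrix.cons_val_one, smul_eq_mul, Matrix.cons_val',
      LinearMap.mk₂_apply] <;>
    push_cast <;> ring
  · refine ⟨LinearEquiv.funUnique (Fin 1) ℤ_[2] ℤ_[2], fun x y => ?_⟩
    change Fin 1 → ℤ_[2] at x y
    change (2 : ℚ_[2]) ^ k * (ε.oddity s : ℤ) * (x 0 : ℚ_[2]) * (y 0 : ℚ_[2]) =
      ∑ b : Fin 1, (∑ a : Fin 1, (x a : ℚ_[2]) * _) * (y b : ℚ_[2])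
    simp only [gram, Fin.sum_univ_one, Matrix.smul_apply, Matrix.of_apply, Matrix.cons_val_zero,
      smul_eq_mul]
    ring_nf

/-- The orthogonal sum of a list of terms. -/
noncomputable def listLattice (l : List FineTerm) : TwoAdicLattice :=
  l.foldr (fun t L => osum t.lattice L) zeroLattice

theorem sumLattice_isometric_osum {ι : Type} [Fintype ι] [DecidableEq ι] (t : ι → FineTerm)
    (i₀ : ι) : (sumLattice t).Isometric
      (osum (t i₀).lattice (sumLattice fun i : {i // i ≠ i₀} => t i)) := by
  obtain ⟨e, he⟩ := exists_lattice_equiv (t i₀)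
  refine Isometric.of_surjective (L := sumLattice t)
    (M := osum (t i₀).lattice (sumLattice fun i : {i // i ≠ i₀} => t i))
    { toFun := fun (x : ∀ i, Fin (t i).dim → ℤ_[2]) => (e (x i₀), fun i => x i.1)
      map_add' := fun x y => Prod.ext (map_add e (x i₀) (y i₀)) rfl
      map_smul' := fun a x => Prod.ext (map_smul e a (x i₀)) rfl } ?_ ?_
  · intro x y
    change (t i₀).lattice.form (e (x i₀)) (e (y i₀)) + (sumLattice fun i : {i // i ≠ i₀} => t i).form
      (fun i => x i.1) (fun i => y i.1) = _
    rw [he]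
    exact (Fintype.sum_eq_add_sum_subtype_ne (fun i => termForm (t i) (x i) (y i)) i₀).symm
  · rintro ⟨y, z⟩
    refine ⟨Function.update (β := fun i => Fin (t i).dim → ℤ_[2])
      (fun i => if h : i ≠ i₀ then z ⟨i, h⟩ else 0) i₀ (e.symm y), ?_⟩
    refine Prod.ext ?_ ?_
    · change e (Function.update (β := fun i => Fin (t i).dim → ℤ_[2]) _ i₀ (e.symm y) i₀) = y
      rw [Function.update_self, e.apply_symm_apply]
    · funext i
      exact (Function.update_of_ne (β := fun i => Fin (t i).dim → ℤ_[2]) i.2 (e.symm y)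
        (fun i => if h : i ≠ i₀ then z ⟨i, h⟩ else 0)).trans (dif_pos (c := i.1 ≠ i₀) i.2)

theorem sumLattice_isometric_listLattice (l : List FineTerm) :
    ∀ {ι : Type} [Fintype ι] (t : ι → FineTerm), Finset.univ.val.map t = (l : Multiset FineTerm) →
      (sumLattice t).Isometric (listLattice l) := by
  classical
  induction l with
  | nil =>
    intro ι _ t h
    have : IsEmpty ι := by
      have := congrArg Multiset.card h
      simp at this
      exact Fintype.card_eq_zero_iff.mp this
    refine Isometric.of_surjective (L := sumLattice t) (M := zeroLattice) 0 (fun x y => ?_)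
      fun y => ⟨0, rfl⟩
    exact (Finset.sum_of_isEmpty (s := Finset.univ)
      (f := fun i => termForm (t i) (x i) (y i))).symm
  | cons a l ih =>
    intro ι _ t h
    have ha : a ∈ Finset.univ.val.map t := by rw [h]; simp
    obtain ⟨i₀, -, rfl⟩ := Multiset.mem_map.mp ha
    refine (sumLattice_isometric_osum t i₀).trans (osum_congr (Isometric.refl _) (ih _ ?_))
    have h1 : (Finset.univ : Finset ι).val = i₀ ::ₘ (Finset.univ.erase i₀).val := by
      rw [Finset.erase_val, Multiset.cons_erase (Finset.mem_univ_val _)]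
    rw [h1, Multiset.map_cons, ← Multiset.cons_coe, Multiset.cons_inj_right] at h
    rw [← h]
    have h2 : (Finset.univ : Finset {i // i ≠ i₀}).map (Function.Embedding.subtype _)
        = Finset.univ.erase i₀ := by ext; simp
    rw [← h2, Finset.map_val, Multiset.map_map]
    rfl

end FineTerm

namespace FineSymbol

open FineTerm TwoAdicLattice

theorem lattice_isometric_listLattice (F : FineSymbol) {l : List FineTerm}
    (h : F.terms = l) : F.lattice.Isometric (listLattice l) := by
  refine sumLattice_isometric_listLattice l _ ?_
  rw [← h]
  exact Multiset.map_univ_coe F.terms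

/-- Replacing two terms by two others with an isometric sum. -/
theorem isometric_of_pair {F F' : FineSymbol} {t u t' u' : FineTerm} {S : Multiset FineTerm}
    (hF : F.terms = t ::ₘ u ::ₘ S) (hF' : F'.terms = t' ::ₘ u' ::ₘ S)
    (h : (osum t.lattice u.lattice).Isometric (osum t'.lattice u'.lattice)) :
    F.lattice.Isometric F'.lattice := by
  induction S using Quotient.inductionOn with | _ l
  refine (F.lattice_isometric_listLattice (l := t :: u :: l) hF).trans
    (.trans ?_ (F'.lattice_isometric_listLattice (l := t' :: u' :: l) hF').symm)
  exact (osum_assoc _ _ _).symm.trans ((osum_congr h (.refl _)).trans (osum_assoc _ _ _))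

/-- Replacing four terms by four others with an isometric sum. -/
theorem isometric_of_quadruple {F F' : FineSymbol} {t u v w t' u' v' w' : FineTerm}
    {S : Multiset FineTerm}
    (hF : F.terms = t ::ₘ u ::ₘ v ::ₘ w ::ₘ S) (hF' : F'.terms = t' ::ₘ u' ::ₘ v' ::ₘ w' ::ₘ S)
    (h : (osum t.lattice (osum u.lattice (osum v.lattice w.lattice))).Isometric
      (osum t'.lattice (osum u'.lattice (osum v'.lattice w'.lattice)))) :
    F.lattice.Isometric F'.lattice := by
  induction S using Quotient.inductionOn with | _ l
  refine (F.lattice_isometric_listLattice (l := t :: u :: v :: w :: l) hF).trans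
    (.trans ?_ (F'.lattice_isometric_listLattice (l := t' :: u' :: v' :: w' :: l) hF').symm)
  have key : ∀ A B C D L : TwoAdicLattice, (osum A (osum B (osum C (osum D L)))).Isometric
      (osum (osum A (osum B (osum C D))) L) := fun A B C D L => by
    refine .trans (osum_congr (.refl _) (.trans (osum_congr (.refl _) (osum_assoc _ _ _).symm)
      (osum_assoc _ _ _).symm)) (osum_assoc _ _ _).symm
  exact (key _ _ _ _ _).trans ((osum_congr h (.refl _)).trans (key _ _ _ _ _).symm)

end FineSymbol

/-! ### Isometries between small sums of terms -/

theorem FineSign.neg_neg (ε : FineSign) : ε.neg.neg = ε := by cases ε <;> rfl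

namespace FineTerm

open TwoAdicLattice

theorem evenPlane_scale (ε : FineSign) {c c' : ℚ_[2]} (hc : c ≠ 0) (hc' : c' ≠ 0) {u : ℤ}
    (hu : Odd u) (h : c' = c * u) :
    (evenPlane ε.evenParam c' hc').Isometric (evenPlane ε.evenParam c hc) := by
  subst h
  cases ε
  · exact evenPlane_zero_scale hc hu
  · exact evenPlane_one_scale hc hu

theorem rankOne_isometric_of_eq {k m' n : ℤ} {a : ℚ_[2]} (ha : a ≠ 0) (hm : Odd m') (hn : Odd n)
    (h : a = 2 ^ k * n) (h' : n ≡ m' [ZMOD 8]) :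
    (rankOne a ha).Isometric (rankOne (2 ^ k * m') (zpow_two_mul_ne_zero k hm)) := by
  subst h
  exact rankOne_isometric_of_modEq k hn hm h'

/-- Multiplying an odd number by -3 adds 4 modulo 8. The residue modulo 4, which tells givers from
receivers, is unchanged. -/
theorem oddity_neg_modEq (ε : FineSign) (s : FineSubscript) :
    ε.oddity s * (-3) ≡ ε.neg.oddity s [ZMOD 8] := by
  cases ε <;> cases s <;> decide

theorem two_zpow_succ (k : ℤ) : (2 : ℚ_[2]) ^ (k + 1) = 2 ^ k * 2 := zpow_add_one₀ two_ne_zero k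

/-- Reduces isometry of binary sums to two congruences modulo 8, so that the rules below become
finite checks after a choice of r (the exponent of the ratio of scales) and c. -/
theorem typeI_osum_typeI {k k' : ℤ} {ε ε' δ δ' : FineSign} {s s' σ σ' : FineSubscript} (r : ℕ)
    (c : ℤ) (hk : k' = k + r)
    (h1 : δ.oddity σ ≡ ε.oddity s + 2 ^ r * c ^ 2 * ε'.oddity s' [ZMOD 8])
    (h2 : δ'.oddity σ' ≡ ε.oddity s * ε'.oddity s' * δ.oddity σ [ZMOD 8]) :
    (osum (typeI k ε s).lattice (typeI k' ε' s').lattice).Isometric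
      (osum (typeI k δ σ).lattice (typeI k' δ' σ').lattice) := by
  subst hk
  exact rankOne_osum_isometric k r c (ε.odd_oddity s) (ε'.odd_oddity s') (δ.odd_oddity σ)
    (δ'.odd_oddity σ') h1 h2

theorem typeII_osum_typeII (k : ℤ) (ε ε' : FineSign) :
    (osum (typeII k ε).lattice (typeII k ε').lattice).Isometric
      (osum (typeII k ε.neg).lattice (typeII k ε'.neg).lattice) := by
  have key : (osum (typeII k .plus).lattice (typeII k .plus).lattice).Isometric
      (osum (typeII k .minus).lattice (typeII k .minus).lattice) := by
    have h3 : (evenPlane 0 ((2 : ℚ_[2]) ^ k * 3) (mul_ne_zero (two_pow_ne_zero k) three_ne_zero)).Isometric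
      (typeII k .plus).lattice := evenPlane_scale .plus (two_pow_ne_zero _) _ (u := 3) (by decide) (by norm_num)
    refine (osum_congr h3 h3).symm.trans ((evenPlane_one_osum_neg (two_pow_ne_zero k)).trans (osum_congr (.refl _) ?_))
    exact evenPlane_scale .minus (two_pow_ne_zero _) _ (u := -1) (by decide) (by norm_num)
  cases ε <;> cases ε'
  · exact key
  · exact osum_comm _ _
  · exact osum_comm _ _
  · exact key.symm

theorem typeI_osum_typeII_succ (k : ℤ) (ε ε' : FineSign) (s : FineSubscript) :
    (osum (typeI k ε s).lattice (typeII (k + 1) ε').lattice).Isometric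
      (osum (typeI k ε.neg s).lattice (typeII (k + 1) ε'.neg).lattice) := by
  have key : ∀ ε : FineSign, (osum (typeI k ε s).lattice (typeII (k + 1) .plus).lattice).Isometric
      (osum (typeI k ε.neg s).lattice (typeII (k + 1) .minus).lattice) := fun ε => by
    have h := (rankOne_osum_evenPlane_aux (zpow_two_mul_ne_zero k (ε.odd_oddity s))).symm
    refine .trans (osum_congr (.refl _) (Isometric.symm ?_)) (h.trans (osum_congr ?_ ?_))
    · exact evenPlane_scale .plus (two_pow_ne_zero _) _ (ε.odd_oddity s) (by rw [two_zpow_succ]; ring)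
    · exact rankOne_isometric_of_eq (n := ε.oddity s * (-3)) _ (FineSign.odd_oddity _ _)
        ((ε.odd_oddity s).mul (by decide)) (by push_cast; ring) (oddity_neg_modEq ε s)
    · exact evenPlane_scale .minus (two_pow_ne_zero _) _ (ε.odd_oddity s) (by rw [two_zpow_succ]; ring)
  cases ε'
  · exact key ε
  · have := (key ε.neg).symm
    rwa [FineSign.neg_neg] at this

theorem typeI_succ_osum_typeII (k : ℤ) (ε ε' : FineSign) (s : FineSubscript) :
    (osum (typeI (k + 1) ε s).lattice (typeII k ε').lattice).Isometric
      (osum (typeI (k + 1) ε.neg s).lattice (typeII k ε'.neg).lattice) := by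
  have key : ∀ ε : FineSign, (osum (typeI (k + 1) ε s).lattice (typeII k .plus).lattice).Isometric
      (osum (typeI (k + 1) ε.neg s).lattice (typeII k .minus).lattice) := fun ε => by
    have h := (rankOne_two_osum_evenPlane_aux (zpow_two_mul_ne_zero k (ε.odd_oddity s))).symm
    refine .trans (osum_congr (Isometric.symm ?_) (Isometric.symm ?_)) (h.trans (osum_congr ?_ ?_))
    · exact rankOne_isometric_of_eq (n := ε.oddity s) _ (FineSign.odd_oddity _ _)
        (ε.odd_oddity s) (by rw [two_zpow_succ]; ring) rfl
    · exact evenPlane_scale .plus (two_pow_ne_zero _) _ (ε.odd_oddity s) rfl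
    · exact rankOne_isometric_of_eq (n := ε.oddity s * (-3)) _ (FineSign.odd_oddity _ _)
        ((ε.odd_oddity s).mul (by decide)) (by rw [two_zpow_succ]; push_cast; ring)
        (oddity_neg_modEq ε s)
    · exact evenPlane_scale .minus (two_pow_ne_zero _) _ (ε.odd_oddity s) rfl
  cases ε'
  · exact key ε
  · have := (key ε.neg).symm
    rwa [FineSign.neg_neg] at this

/-- With r = 0, c = 2, as with r = 2, c = 1 for scales in ratio 4, the first entry gains 4 times an
odd number, which alters only its sign. -/
theorem typeI_osum_typeI_neg_same (k : ℤ) (ε ε' : FineSign) (s s' : FineSubscript) :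
    (osum (typeI k ε s).lattice (typeI k ε' s').lattice).Isometric
      (osum (typeI k ε.neg s).lattice (typeI k ε'.neg s').lattice) :=
  typeI_osum_typeI 0 2 (by simp) (by cases ε <;> cases ε' <;> cases s <;> cases s' <;> decide)
    (by cases ε <;> cases ε' <;> cases s <;> cases s' <;> decide)

theorem typeI_osum_typeI_neg_four (k : ℤ) (ε ε' : FineSign) (s s' : FineSubscript) :
    (osum (typeI k ε s).lattice (typeI (k + 2) ε' s').lattice).Isometric
      (osum (typeI k ε.neg s).lattice (typeI (k + 2) ε'.neg s').lattice) :=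
  typeI_osum_typeI 2 1 (by simp) (by cases ε <;> cases ε' <;> cases s <;> cases s' <;> decide)
    (by cases ε <;> cases ε' <;> cases s <;> cases s' <;> decide)

/-- If n ≡ m modulo 4 then m + 2n ≡ 3m modulo 8, so sign and subscript both change. -/
theorem typeI_osum_typeI_neg_adjacent (k : ℤ) (ε ε' : FineSign) (s : FineSubscript) :
    (osum (typeI k ε s).lattice (typeI (k + 1) ε' s).lattice).Isometric
      (osum (typeI k ε.neg s.swap).lattice (typeI (k + 1) ε'.neg s.swap).lattice) :=
  typeI_osum_typeI 1 1 (by simp) (by cases ε <;> cases ε' <;> cases s <;> decide)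
    (by cases ε <;> cases ε' <;> cases s <;> decide)

/-- If n ≡ -m modulo 4 then m + 2n ≡ -m modulo 8, so the subscript changes and the sign does not. -/
theorem typeI_osum_typeI_swap (k : ℤ) (ε ε' : FineSign) (s s' : FineSubscript) :
    (osum (typeI k ε s).lattice (typeI (k + 1) ε' s').lattice).Isometric
      (osum (typeI k ε s').lattice (typeI (k + 1) ε' s).lattice) := by
  by_cases h : s = s'
  · subst h; exact .refl _
  · have hs : s' = s.swap := by cases s <;> cases s' <;> first | exact absurd rfl h | rfl
    subst hs
    exact typeI_osum_typeI 1 1 (by simp) (by cases ε <;> cases ε' <;> cases s <;> decide)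
      (by cases ε <;> cases ε' <;> cases s <;> decide)

/-- `⟨a⟩ ⊕ ⟨b⟩ ⊕ ⟨c⟩ ⊕ ⟨d⟩`, for terms of one scale and one subscript, depends only on the
product of the signs. -/
theorem typeI_four_normalize (k : ℤ) (ε₁ ε₂ ε₃ ε₄ : FineSign) :
    ∃ ε : FineSign, ∀ s : FineSubscript,
    (osum (typeI k ε₁ s).lattice (osum (typeI k ε₂ s).lattice (osum (typeI k ε₃ s).lattice
      (typeI k ε₄ s).lattice))).Isometric
    (osum (typeI k .plus s).lattice (osum (typeI k .plus s).lattice (osum (typeI k .plus s).lattice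
      (typeI k ε s).lattice))) := by
  have h1 : ∀ δ : FineSign, ∃ ε : FineSign, ∀ δ' s, (osum (typeI k δ' s).lattice
      (typeI k δ s).lattice).Isometric (osum (typeI k .plus s).lattice
        (typeI k (if δ' = .plus then δ else ε) s).lattice) := fun δ => by
    refine ⟨δ.neg, fun δ' s => ?_⟩
    cases δ'
    · exact .refl _
    · exact typeI_osum_typeI_neg_same k .minus δ s s
  have h2 : ∀ δ' δ : FineSign, ∃ ε : FineSign, ∀ s, (osum (typeI k δ' s).lattice
      (typeI k δ s).lattice).Isometric (osum (typeI k .plus s).lattice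
        (typeI k ε s).lattice) := fun δ' δ => by
    obtain ⟨ε, h⟩ := h1 δ
    exact ⟨_, h δ'⟩
  obtain ⟨δ₃, h3⟩ := h2 ε₃ ε₄
  obtain ⟨δ₂, h4⟩ := h2 ε₂ δ₃
  obtain ⟨δ₁, h5⟩ := h2 ε₁ δ₂
  refine ⟨δ₁, fun s => ?_⟩
  have comm3 : ∀ A B C : TwoAdicLattice, (osum A (osum B C)).Isometric (osum B (osum A C)) :=
    fun A B C => (osum_assoc _ _ _).symm.trans ((osum_congr (osum_comm _ _) (.refl _)).trans
      (osum_assoc _ _ _))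
  have step : ∀ (A : TwoAdicLattice) {B C D E : TwoAdicLattice}, (osum B C).Isometric (osum D E) →
      (osum B (osum A C)).Isometric (osum A (osum D E)) := fun A B C D E h =>
    (comm3 _ _ _).trans (osum_congr (.refl _) h)
  refine (osum_congr (.refl _) (osum_congr (.refl _) (h3 s))).trans ?_
  refine (osum_congr (.refl _) (step _ (h4 s))).trans ?_
  refine (comm3 _ _ _).trans (osum_congr (.refl _) (step _ (h5 s)))

/-- After normalizing three signs to plus, three equal unary forms split off an even plane with
minus sign that is the same for givers and receivers. Only a comparison of binary forms remains. -/
theorem typeI_four_givers (k : ℤ) (ε₁ ε₂ ε₃ ε₄ : FineSign) :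
    (osum (typeI k ε₁ .G).lattice (osum (typeI k ε₂ .G).lattice (osum (typeI k ε₃ .G).lattice
      (typeI k ε₄ .G).lattice))).Isometric
    (osum (typeI k ε₁ .R).lattice (osum (typeI k ε₂ .R).lattice (osum (typeI k ε₃ .R).lattice
      (typeI k ε₄ .R).lattice))) := by
  obtain ⟨ε, h⟩ := typeI_four_normalize k ε₁ ε₂ ε₃ ε₄
  refine (h .G).trans (Isometric.trans ?_ (h .R).symm)
  have key : ∀ s : FineSubscript, (osum (typeI k .plus s).lattice (osum (typeI k .plus s).lattice
      (osum (typeI k .plus s).lattice (typeI k ε s).lattice))).Isometric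
      (osum (osum (typeI k .minus s.swap).lattice (typeI k ε s).lattice)
        (typeII k .minus).lattice) := fun s => by
    have h := (rankOne_cubed_isometric
      (zpow_two_mul_ne_zero k (FineSign.plus.odd_oddity s))).symm
    have e1 : (osum (typeI k .plus s).lattice (osum (typeI k .plus s).lattice
      (typeI k .plus s).lattice)).Isometric
      (osum (typeI k .minus s.swap).lattice (typeII k .minus).lattice) := by
      refine h.trans (osum_congr ?_ ?_)
      · exact rankOne_isometric_of_eq (n := FineSign.plus.oddity s * 3) _ (FineSign.odd_oddity _ _)
          ((FineSign.plus.odd_oddity s).mul (by decide)) (by push_cast; ring)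
          (by cases s <;> decide)
      · exact evenPlane_scale .minus (two_pow_ne_zero _) _ (FineSign.plus.odd_oddity s) rfl
    refine (osum_congr (.refl _) (osum_assoc _ _ _).symm).trans ((osum_assoc _ _ _).symm.trans ?_)
    refine (osum_congr e1 (.refl _)).trans ?_
    exact (osum_assoc _ _ _).trans ((osum_congr (.refl _) (osum_comm _ _)).trans
      (osum_assoc _ _ _).symm)
  refine (key .G).trans (Isometric.trans (osum_congr ?_ (.refl _)) (key .R).symm)
  -- Left to compare: ⟨3⟩ ⊕ ⟨u⟩ with ⟨-3⟩ ⊕ ⟨-u⟩, up to the scale. For u = 1 use 3 + 4 · 1 ≡ -1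
  -- modulo 8; for u = -3 the summands are merely reordered.
  cases ε
  · exact (typeI_osum_typeI 0 2 (by simp) (δ := .plus) (σ := .R) (δ' := .minus) (σ' := .G)
      (by decide) (by decide)).trans (osum_comm _ _)
  · exact osum_comm _ _

theorem lattice_osum_negSign_of_adjacent {t u : FineTerm} (h : u.logScale = t.logScale + 1)
    (htype : ¬ (t.IsTypeI ↔ u.IsTypeI)) : (osum t.lattice u.lattice).Isometric
      (osum t.negSign.lattice u.negSign.lattice) := by
  rcases t with ⟨k, ε⟩ | ⟨k, ε, s⟩ <;> rcases u with ⟨k', ε'⟩ | ⟨k', ε', s'⟩ <;>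
    simp only [logScale, IsTypeI] at h htype <;> first | exact absurd trivial htype | subst h
  · exact (osum_comm _ _).trans ((typeI_succ_osum_typeII k ε' ε s').trans (osum_comm _ _))
  · exact typeI_osum_typeII_succ k ε ε' s

theorem lattice_osum_negSign_of_differ {t u : FineTerm} (h : u.logScale = t.logScale + 2)
    (ht : t.IsTypeI) (hu : u.IsTypeI) : (osum t.lattice u.lattice).Isometric
      (osum t.negSign.lattice u.negSign.lattice) := by
  rcases t with ⟨k, ε⟩ | ⟨k, ε, s⟩ <;> rcases u with ⟨k', ε'⟩ | ⟨k', ε', s'⟩ <;>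
    simp only [logScale, IsTypeI] at h ht hu
  subst h
  exact typeI_osum_typeI_neg_four k ε ε' s s'

theorem lattice_osum_negSign_swap {t u : FineTerm} (h : u.logScale = t.logScale + 1)
    (hs : (t.IsGiver ∧ u.IsGiver) ∨ (t.IsReceiver ∧ u.IsReceiver)) :
    (osum t.lattice u.lattice).Isometric
      (osum t.negSign.swapSubscript.lattice u.negSign.swapSubscript.lattice) := by
  rcases t with ⟨k, ε⟩ | ⟨k, ε, _ | _⟩ <;> rcases u with ⟨k', ε'⟩ | ⟨k', ε', _ | _⟩ <;>
    simp [logScale, IsGiver, IsReceiver] at h hs <;> subst h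
  · exact typeI_osum_typeI_neg_adjacent k ε ε' .G
  · exact typeI_osum_typeI_neg_adjacent k ε ε' .R

end FineTerm

namespace FineSymbol

open FineTerm TwoAdicLattice

theorem SignWalk.isometric {F F' : FineSymbol} (h : F.SignWalk F') :
    F.lattice.Isometric F'.lattice := by
  rcases h with ⟨t, u, S, hs, hF, hF'⟩ | ⟨t, u, S, hs, ht, hF, hF'⟩ | ⟨t, u, S, hs, ht, hF, hF'⟩ |
    ⟨t, u, S, hs, ht, hF, hF'⟩
  · refine isometric_of_pair hF hF' ?_
    have ht := F.same_type t (by simp [hF]) u (by simp [hF]) hs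
    rcases t with ⟨k, ε⟩ | ⟨k, ε, s⟩ <;> rcases u with ⟨k', ε'⟩ | ⟨k', ε', s'⟩ <;>
      simp only [logScale, IsTypeI] at hs ht <;> first | exact (ht.mp trivial).elim | exact (ht.mpr trivial).elim | subst hs
    · exact typeII_osum_typeII k ε ε'
    · exact typeI_osum_typeI_neg_same k ε ε' s s'
  · refine isometric_of_pair hF hF' ?_
    rcases hs with hs | hs
    · exact (osum_comm _ _).trans ((lattice_osum_negSign_of_adjacent hs
        (fun h => ht h.symm)).trans (osum_comm _ _))
    · exact lattice_osum_negSign_of_adjacent hs ht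
  · refine isometric_of_pair hF hF' ?_
    rcases hs with hs | hs
    · exact (osum_comm _ _).trans ((lattice_osum_negSign_swap hs
        (by tauto)).trans (osum_comm _ _))
    · exact lattice_osum_negSign_swap hs ht
  · refine isometric_of_pair hF hF' ?_
    rcases hs with hs | hs
    · exact (osum_comm _ _).trans ((lattice_osum_negSign_of_differ hs ht.2 ht.1).trans
        (osum_comm _ _))
    · exact lattice_osum_negSign_of_differ hs ht.1 ht.2

end FineSymbol

/-! ### Reduction modulo powers of two -/

namespace FineTerm

/-- The inner product matrix of a term of scale `1`. -/
def intGram : (t : FineTerm) → Matrix (Fin t.dim) (Fin t.dim) ℤ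
  | typeII _ .plus => (!![0, 1; 1, 0] : Matrix (Fin 2) (Fin 2) ℤ)
  | typeII _ .minus => (!![2, 1; 1, 2] : Matrix (Fin 2) (Fin 2) ℤ)
  | typeI _ ε s => (!![ε.oddity s] : Matrix (Fin 1) (Fin 1) ℤ)

theorem gram_eq (t : FineTerm) (a b : Fin t.dim) :
    t.gram a b = 2 ^ t.logScale * (t.intGram a b : ℚ_[2]) := by
  rcases t with ⟨k, _ | _⟩ | ⟨k, ε, s⟩
  · change Fin 2 at a b
    fin_cases a <;> fin_cases b <;> simp [gram, intGram, logScale]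
  · change Fin 2 at a b
    fin_cases a <;> fin_cases b <;> simp [gram, intGram, logScale]
  · change Fin 1 at a b
    rw [Subsingleton.elim a 0, Subsingleton.elim b 0]
    simp [gram, intGram, logScale]

section

variable {R : Type*} [CommRing R]

/-- The unscaled form of a term over a commutative ring. -/
def baseForm (R : Type*) [CommRing R] (t : FineTerm) (x y : Fin t.dim → R) : R :=
  ∑ b, (∑ a, x a * (t.intGram a b : R)) * y b

/-- The form of a family of terms over a commutative ring, with scales multiplied by `2 ^ K`. -/
def familyForm {ι : Type} [Fintype ι] (R : Type*) [CommRing R] (t : ι → FineTerm) (K : ℤ)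
    (x y : ∀ i, Fin (t i).dim → R) : R :=
  ∑ i, 2 ^ ((t i).logScale + K).toNat * baseForm R (t i) (x i) (y i)

theorem map_familyForm {S : Type*} [CommRing S] (φ : R →+* S) {ι : Type} [Fintype ι]
    (t : ι → FineTerm) (K : ℤ) (x y : ∀ i, Fin (t i).dim → R) :
    φ (familyForm R t K x y) = familyForm S t K (fun i a => φ (x i a)) (fun i a => φ (y i a)) := by
  have h2 : φ 2 = 2 := map_ofNat φ 2
  simp [familyForm, baseForm, h2]

theorem coe_familyForm {ι : Type} [Fintype ι] (t : ι → FineTerm) {K : ℤ}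
    (hK : ∀ i, 0 ≤ (t i).logScale + K) (x y : ∀ i, Fin (t i).dim → ℤ_[2]) :
    (familyForm ℤ_[2] t K x y : ℚ_[2]) = 2 ^ K * (sumLattice t).form x y := by
  rw [sumLattice_form, familyForm, Finset.mul_sum, PadicInt.coe_sum]
  refine Finset.sum_congr rfl fun i _ => ?_
  have h2 : ((2 : ℤ_[2]) : ℚ_[2]) = 2 := rfl
  have h3 : (2 : ℚ_[2]) ^ ((t i).logScale + K).toNat = 2 ^ (t i).logScale * 2 ^ K := by
    rw [← zpow_add₀ two_ne_zero, ← zpow_natCast, Int.toNat_of_nonneg (hK i)]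
  rw [PadicInt.coe_mul, PadicInt.coe_pow, h2, h3, baseForm, termForm, PadicInt.coe_sum]
  simp only [PadicInt.coe_mul, PadicInt.coe_sum, PadicInt.coe_intCast]
  simp only [gram_eq, Finset.mul_sum, Finset.sum_mul]
  refine Finset.sum_congr rfl fun b _ => Finset.sum_congr rfl fun a _ => ?_
  ring

end

/-- An isometry of lattices induces isometries modulo powers of `2`. -/
theorem exists_zmod_equiv {ι κ : Type} [Fintype ι] [Fintype κ] {t : ι → FineTerm}
    {t' : κ → FineTerm} (h : (sumLattice t).Isometric (sumLattice t')) {K : ℤ}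
    (hK : ∀ i, 0 ≤ (t i).logScale + K) (hK' : ∀ i, 0 ≤ (t' i).logScale + K) (n : ℕ) :
    ∃ e : (∀ i, Fin (t i).dim → ZMod (2 ^ n)) ≃ (∀ i, Fin (t' i).dim → ZMod (2 ^ n)),
      ∀ z w, familyForm _ t' K (e z) (e w) = familyForm _ t K z w := by
  obtain ⟨e, he⟩ : ∃ e : (∀ i, Fin (t i).dim → ℤ_[2]) ≃ₗ[ℤ_[2]] (∀ i, Fin (t' i).dim → ℤ_[2]),
    ∀ x y, (sumLattice t').form (e x) (e y) = (sumLattice t).form x y := h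
  have he' : ∀ x y, familyForm ℤ_[2] t' K (e x) (e y) = familyForm ℤ_[2] t K x y := fun x y => by
    apply Subtype.ext
    have h1 := coe_familyForm t' hK' (e x) (e y)
    have h2 := coe_familyForm t hK x y
    rw [he] at h1
    exact h1.trans h2.symm
  let π : ∀ {α : Type} [Fintype α] (u : α → FineTerm), (∀ i, Fin (u i).dim → ℤ_[2]) →
    (∀ i, Fin (u i).dim → ZMod (2 ^ n)) := fun u x i a => PadicInt.toZModPow n (x i a)
  let lift : ∀ {α : Type} [Fintype α] (u : α → FineTerm), (∀ i, Fin (u i).dim → ZMod (2 ^ n)) →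
    (∀ i, Fin (u i).dim → ℤ_[2]) := fun u z i a => ((z i a).val : ℤ_[2])
  have hπ : ∀ {α : Type} [Fintype α] (u : α → FineTerm) z, π u (lift u z) = z := fun u z => by
    funext i a
    simp [π, lift]
  -- By linearity, vectors congruent modulo 2^n have congruent images, so the choice of lift is
  -- immaterial.
  have key : ∀ {α β : Type} [Fintype α] [Fintype β] (u : α → FineTerm) (v : β → FineTerm)
      (f : (∀ i, Fin (u i).dim → ℤ_[2]) →ₗ[ℤ_[2]] (∀ i, Fin (v i).dim → ℤ_[2])) x y,
      π u x = π u y → π v (f x) = π v (f y) := fun u v f x y hxy => by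
    have h1 : ∀ i a, ∃ w, x i a - y i a = 2 ^ n * w := fun i a => by
      have h2 : PadicInt.toZModPow n (x i a - y i a) = 0 := by
        rw [map_sub, sub_eq_zero]; exact congrFun (congrFun hxy i) a
      rw [← RingHom.mem_ker, PadicInt.ker_toZModPow, Ideal.mem_span_singleton] at h2
      exact_mod_cast h2
    choose w hw using h1
    have h3 : x = y + (2 ^ n : ℤ_[2]) • w := by
      funext i a
      simp [← hw]
    funext j b
    have h4 : ((2 : ZMod (2 ^ n)) ^ n) = 0 := by
      exact_mod_cast ZMod.natCast_self (2 ^ n)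
    have h5 : PadicInt.toZModPow (p := 2) n 2 = 2 := map_ofNat _ 2
    simp [π, h3, h4, h5]
  refine ⟨⟨fun z => π t' (e (lift t z)), fun w => π t (e.symm (lift t' w)), fun z => ?_,
    fun w => ?_⟩, fun z w => ?_⟩
  · refine (key t' t e.symm.toLinearMap _ (e (lift t z)) (hπ _ _)).trans ?_
    exact (congrArg (π t) (e.symm_apply_apply _)).trans (hπ t z)
  · refine (key t t' e.toLinearMap _ (e.symm (lift t' w)) (hπ _ _)).trans ?_
    exact (congrArg (π t') (e.apply_symm_apply _)).trans (hπ t' w)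
  · refine (map_familyForm (PadicInt.toZModPow n) t' K (e (lift t z)) (e (lift t w))).symm.trans ?_
    rw [he']
    refine (map_familyForm (PadicInt.toZModPow n) t K (lift t z) (lift t w)).trans ?_
    exact congrArg₂ _ (hπ t z) (hπ t w)

end FineTerm

/-! ### The radical modulo powers of two and the dimensions of the constituents -/

namespace FineTerm

theorem isUnit_intCast_zmod {u : ℤ} (hu : Odd u) (n : ℕ) : IsUnit (u : ZMod (2 ^ n)) := by
  refine (ZMod.coe_int_isUnit_iff_isCoprime u (2 ^ n)).mpr ?_
  push_cast
  refine IsCoprime.pow_left ?_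
  rcases hu with ⟨k, rfl⟩
  exact ⟨-k, 1, by ring⟩

theorem card_two_pow_torsion (n j : ℕ) :
    Nat.card {z : ZMod (2 ^ n) // 2 ^ j * z = 0} = 2 ^ min n j := by
  have h := IsAddCyclic.card_nsmulAddMonoidHom_ker (G := ZMod (2 ^ n)) (2 ^ j)
  rw [Nat.card_zmod, Nat.gcd_comm] at h
  have h2 : Nat.gcd (2 ^ j) (2 ^ n) = 2 ^ min n j := by
    rcases le_total n j with hl | hl
    · rw [min_eq_left hl, Nat.gcd_eq_right (pow_dvd_pow 2 hl)]
    · rw [min_eq_right hl, Nat.gcd_eq_left (pow_dvd_pow 2 hl)]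
  rw [← h2, ← h]
  refine Nat.card_congr (Equiv.subtypeEquivRight fun z => ?_)
  rw [AddMonoidHom.mem_ker]
  simp

/-- The unscaled Gram matrices have odd determinant, hence are invertible modulo 2^n. -/
theorem baseForm_left_eq_zero {n : ℕ} (t : FineTerm) (c : ZMod (2 ^ n))
    (x : Fin t.dim → ZMod (2 ^ n)) :
    (∀ b, c * ∑ a, x a * (t.intGram a b : ZMod (2 ^ n)) = 0) ↔ ∀ a, c * x a = 0 := by
  constructor
  · intro h
    rcases t with ⟨k, _ | _⟩ | ⟨k, ε, s⟩
    · change Fin 2 → ZMod (2 ^ n) at x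
      change ∀ b : Fin 2, c * ∑ a : Fin 2, x a * _ = 0 at h
      change ∀ a : Fin 2, c * x a = 0
      have h0 := h 0
      have h1 := h 1
      simp [intGram, Fin.sum_univ_two] at h0 h1
      simp [Fin.forall_fin_two, h0, h1]
    · change Fin 2 → ZMod (2 ^ n) at x
      change ∀ b : Fin 2, c * ∑ a : Fin 2, x a * _ = 0 at h
      change ∀ a : Fin 2, c * x a = 0
      have h0 := h 0
      have h1 := h 1
      simp [intGram, Fin.sum_univ_two] at h0 h1
      have h3 := (isUnit_intCast_zmod (u := 3) (by decide) n)
      push_cast at h3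
      rw [Fin.forall_fin_two]
      constructor
      · refine (h3.mul_right_eq_zero).mp ?_
        linear_combination 2 * h0 - h1
      · refine (h3.mul_right_eq_zero).mp ?_
        linear_combination 2 * h1 - h0
    · change Fin 1 → ZMod (2 ^ n) at x
      change ∀ b : Fin 1, c * ∑ a : Fin 1, x a * _ = 0 at h
      change ∀ a : Fin 1, c * x a = 0
      intro a
      rw [Subsingleton.elim a 0]
      have h0 := h 0
      have hu := isUnit_intCast_zmod (ε.odd_oddity s) n
      simp only [intGram, Fin.sum_univ_one, ← mul_assoc] at h0
      exact hu.mul_left_eq_zero.mp h0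
  · intro h b
    rw [Finset.mul_sum]
    refine Finset.sum_eq_zero fun a _ => ?_
    rw [← mul_assoc, h, zero_mul]

theorem familyForm_left_eq_zero {ι : Type} [Fintype ι] (t : ι → FineTerm) (K : ℤ) (n : ℕ)
    (z : ∀ i, Fin (t i).dim → ZMod (2 ^ n)) :
    (∀ w, familyForm _ t K z w = 0) ↔ ∀ i a, 2 ^ ((t i).logScale + K).toNat * z i a = 0 := by
  classical
  constructor
  · intro h i
    rw [← baseForm_left_eq_zero]
    intro b
    have := h (Pi.single i (Pi.single b 1))
    rw [familyForm, Finset.sum_eq_single i, baseForm, Finset.sum_eq_single b] at this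
    · simpa using this
    · intro b' _ hb; simp [Pi.single_eq_of_ne hb]
    · simp
    · intro j _ hj; simp [Pi.single_eq_of_ne hj, baseForm]
    · simp
  · intro h w
    refine Finset.sum_eq_zero fun i _ => ?_
    rw [baseForm, Finset.mul_sum]
    refine Finset.sum_eq_zero fun b _ => ?_
    rw [← mul_assoc, (baseForm_left_eq_zero (t i) _ (z i)).mpr (h i) b, zero_mul]

/-- By unimodularity of the unscaled forms the radical is a product of torsion subgroups of ℤ/2^n,
one for each coordinate. -/
theorem card_radical {ι : Type} [Fintype ι] (t : ι → FineTerm) (K : ℤ) (n : ℕ) :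
    Nat.card {z : ∀ i, Fin (t i).dim → ZMod (2 ^ n) // ∀ w, familyForm _ t K z w = 0} =
      2 ^ ∑ i, (t i).dim * min n ((t i).logScale + K).toNat := by
  have e1 := Nat.card_congr (Equiv.subtypeEquivRight (familyForm_left_eq_zero t K n))
  have e2 := Nat.card_congr (Equiv.subtypePiEquivPi
    (p := fun i (x : Fin (t i).dim → ZMod (2 ^ n)) => ∀ a, 2 ^ ((t i).logScale + K).toNat * x a = 0))
  rw [e1, e2, Nat.card_pi, ← Finset.prod_pow_eq_pow_sum]
  refine Finset.prod_congr rfl fun i _ => ?_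
  have e3 := Nat.card_congr (Equiv.subtypePiEquivPi
    (p := fun (_ : Fin (t i).dim) (x : ZMod (2 ^ n)) => 2 ^ ((t i).logScale + K).toNat * x = 0))
  rw [e3, Nat.card_pi]
  rw [Finset.prod_const, card_two_pow_torsion, pow_mul', Finset.card_univ, Fintype.card_fin]

theorem sum_dim_mul_min_eq {ι κ : Type} [Fintype ι] [Fintype κ] {t : ι → FineTerm}
    {t' : κ → FineTerm} (h : (sumLattice t).Isometric (sumLattice t')) {K : ℤ}
    (hK : ∀ i, 0 ≤ (t i).logScale + K) (hK' : ∀ i, 0 ≤ (t' i).logScale + K) (n : ℕ) :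
    ∑ i, (t i).dim * min n ((t i).logScale + K).toNat =
      ∑ i, (t' i).dim * min n ((t' i).logScale + K).toNat := by
  obtain ⟨e, he⟩ := exists_zmod_equiv h hK hK' n
  have h1 := Nat.card_congr (e.subtypeEquiv (p := fun z => ∀ w, familyForm _ t K z w = 0)
    (q := fun z => ∀ w, familyForm _ t' K z w = 0) fun z => by
      constructor
      · intro h w
        rw [← e.apply_symm_apply w, he, h]
      · intro h w
        rw [← he, h])
  rw [card_radical, card_radical] at h1
  exact Nat.pow_right_injective le_rfl h1

end FineTerm

namespace FineSymbol

open FineTerm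

theorem sum_terms {M : Type*} [AddCommMonoid M] (F : FineSymbol) (f : FineTerm → M) :
    ∑ i : F.terms.ToType, f i.1 = (F.terms.map f).sum := by
  rw [Finset.sum, ← Multiset.map_univ_coe F.terms, Multiset.map_map]
  simp

theorem exists_shift (F F' : FineSymbol) (N : ℤ) :
    ∃ K : ℤ, N ≤ K ∧ (∀ t ∈ F.terms, 1 ≤ t.logScale + K) ∧ ∀ t ∈ F'.terms, 1 ≤ t.logScale + K := by
  have h : ∀ S : Multiset FineTerm, ∃ K : ℤ, ∀ t ∈ S, 1 ≤ t.logScale + K := fun S => by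
    induction S using Multiset.induction_on with
    | empty => exact ⟨0, by simp⟩
    | cons a S ih =>
      obtain ⟨K, hK⟩ := ih
      refine ⟨max K (1 - a.logScale), fun t ht => ?_⟩
      rcases Multiset.mem_cons.mp ht with rfl | ht
      · have := le_max_right K (1 - t.logScale); omega
      · have := le_max_left K (1 - a.logScale); have := hK t ht; omega
  obtain ⟨K, hK⟩ := h F.terms
  obtain ⟨K', hK'⟩ := h F'.terms
  refine ⟨max N (max K K'), le_max_left _ _, fun t ht => ?_, fun t ht => ?_⟩
  · have := hK t ht; omega
  · have := hK' t ht; omega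

/-- The rank of the constituent of scale `2 ^ k`. -/
def dimAt (F : FineSymbol) (k : ℤ) : ℕ :=
  (F.terms.map fun t => if t.logScale = k then t.dim else 0).sum

/-- As a function of n, min(n, a) has second difference -1 at n = a and 0 at other n ≥ 1; applied to
the exponent of the order of the radical, this isolates the terms of scale 2^k. -/
theorem dimAt_eq_of_isometric {F F' : FineSymbol} (h : F.lattice.Isometric F'.lattice) (k : ℤ) :
    F.dimAt k = F'.dimAt k := by
  -- The bound 1 - k gives k + K ≥ 1, so the truncated subtraction of 1 below is a true one.
  obtain ⟨K, hk, hK, hK'⟩ := exists_shift F F' (1 - k)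
  have hsum : ∀ n : ℕ, (F.terms.map fun t => t.dim * min n (t.logScale + K).toNat).sum =
      (F'.terms.map fun t => t.dim * min n (t.logScale + K).toNat).sum := fun n => by
    have h2 := sum_dim_mul_min_eq h (K := K)
      (fun i => by have := hK i.1 Multiset.coe_mem; omega)
      (fun i => by have := hK' i.1 Multiset.coe_mem; omega) n
    rwa [sum_terms F fun t => t.dim * min n (t.logScale + K).toNat,
      sum_terms F' fun t => t.dim * min n (t.logScale + K).toNat] at h2
  have hdiff : ∀ G : FineSymbol, (∀ t ∈ G.terms, 1 ≤ t.logScale + K) →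
      2 * (G.terms.map fun t => t.dim * min (k + K).toNat (t.logScale + K).toNat).sum =
      (G.terms.map fun t => t.dim * min ((k + K).toNat - 1) (t.logScale + K).toNat).sum +
      (G.terms.map fun t => t.dim * min ((k + K).toNat + 1) (t.logScale + K).toNat).sum +
      G.dimAt k := fun G hG => by
    rw [dimAt, ← Multiset.sum_map_add, ← Multiset.sum_map_add, ← Multiset.sum_map_mul_left]
    refine congrArg _ (Multiset.map_congr rfl fun t ht => ?_)
    have h1 := hG t ht
    have h2 : 2 * min (k + K).toNat (t.logScale + K).toNat =
        min ((k + K).toNat - 1) (t.logScale + K).toNat +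
        min ((k + K).toNat + 1) (t.logScale + K).toNat + if t.logScale = k then 1 else 0 := by
      split_ifs <;> omega
    rw [mul_left_comm, h2]
    split_ifs <;> ring
  have h1 := hdiff F hK
  have h2 := hdiff F' hK'
  rw [hsum, hsum, hsum] at h1
  omega

end FineSymbol

/-! ### Quadratic Gauss sums modulo powers of two -/

section GaussSums

open ZMod

theorem ZMod.sum_eq_sum_range (M : ℕ) [NeZero M] (f : ZMod M → ℂ) :
    ∑ z, f z = ∑ i ∈ Finset.range M, f (i : ZMod M) := by
  refine Finset.sum_nbij' (fun z => z.val) (fun i => (i : ZMod M)) ?_ ?_ ?_ ?_ ?_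
  · intro z _; exact Finset.mem_range.mpr z.val_lt
  · intro i _; exact Finset.mem_univ _
  · intro z _; simp
  · intro i hi; exact ZMod.val_cast_of_lt (Finset.mem_range.mp hi)
  · intro z _; simp

theorem sum_range_two_mul (m : ℕ) (f : ℕ → ℂ) :
    ∑ i ∈ Finset.range (2 * m), f i = ∑ i ∈ Finset.range m, (f (2 * i) + f (2 * i + 1)) := by
  induction m with
  | zero => simp
  | succ m ih =>
    rw [Nat.mul_succ, Finset.sum_range_succ, Finset.sum_range_succ, ih, Finset.sum_range_succ]
    ring

/-- Splitting a sum modulo `2 ^ n` by parity. -/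
theorem two_mul_sum_zmod {n : ℕ} (hn : 1 ≤ n) (f : ZMod (2 ^ n) → ℂ) :
    2 * ∑ z, f z = ∑ w, (f (2 * w) + f (2 * w + 1)) := by
  obtain ⟨m, rfl⟩ : ∃ m, n = m + 1 := ⟨n - 1, by omega⟩
  have h2 : (2 : ZMod (2 ^ (m + 1))) * 2 ^ m = 0 := by
    rw [← pow_succ']; exact_mod_cast ZMod.natCast_self (2 ^ (m + 1))
  have hr : ∀ g : ℕ → ℂ, ∑ i ∈ Finset.range (2 ^ (m + 1)), g i =
      ∑ i ∈ Finset.range (2 ^ m), (g i + g (2 ^ m + i)) := fun g => by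
    rw [pow_succ, mul_two, Finset.sum_range_add, Finset.sum_add_distrib]
  have hr2 : Finset.range (2 ^ (m + 1)) = Finset.range (2 * 2 ^ m) := by rw [pow_succ']
  rw [ZMod.sum_eq_sum_range _ f, hr2, sum_range_two_mul, ZMod.sum_eq_sum_range, hr, Finset.mul_sum]
  refine Finset.sum_congr rfl fun i _ => ?_
  have h3 : (2 : ZMod (2 ^ (m + 1))) * ((2 ^ m + i : ℕ) : ZMod (2 ^ (m + 1))) = 2 * i := by
    push_cast
    rw [mul_add, h2, zero_add]
  rw [h3]
  push_cast
  ring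

theorem sum_eq_zero_of_shift {n : ℕ} (f : ZMod (2 ^ n) → ℂ) (c : ZMod (2 ^ n))
    (h : ∀ w, f (w + c) = -f w) : ∑ w, f w = 0 := by
  have h1 : ∑ w, f (w + c) = ∑ w, f w := Equiv.sum_comp (Equiv.addRight c) f
  rw [Finset.sum_congr rfl fun w _ => h w, Finset.sum_neg_distrib] at h1
  linear_combination (-1 / 2 : ℂ) * h1

theorem two_pow_eq_zero_of_le {n j : ℕ} (h : n ≤ j) : (2 : ZMod (2 ^ n)) ^ j = 0 := by
  obtain ⟨e, rfl⟩ := Nat.exists_eq_add_of_le h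
  rw [pow_add]
  have : (2 : ZMod (2 ^ n)) ^ n = 0 := by exact_mod_cast ZMod.natCast_self (2 ^ n)
  rw [this, zero_mul]

theorem stdAddChar_two_pow_mul {n j r : ℕ} (h : n = j + r) (a : ℤ) :
    stdAddChar ((2 : ZMod (2 ^ n)) ^ j * (a : ZMod (2 ^ n))) = stdAddChar (a : ZMod (2 ^ r)) := by
  have h1 : (2 : ZMod (2 ^ n)) ^ j * (a : ZMod (2 ^ n)) = ((2 ^ j * a : ℤ) : ZMod (2 ^ n)) := by push_cast; rfl
  rw [h1, stdAddChar_coe, stdAddChar_coe]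
  congr 1
  subst h
  push_cast
  rw [pow_add]
  field_simp

theorem stdAddChar_half {n j : ℕ} (h : n = j + 1) {a : ℤ} (ha : Odd a) :
    stdAddChar ((2 : ZMod (2 ^ n)) ^ j * (a : ZMod (2 ^ n))) = -1 := by
  rw [stdAddChar_two_pow_mul h]
  have h1 : (a : ZMod (2 ^ 1)) = ((1 : ℤ) : ZMod (2 ^ 1)) := by
    rcases ha with ⟨k, rfl⟩
    push_cast
    have : (2 : ZMod (2 ^ 1)) = 0 := rfl
    rw [this]; ring
  rw [h1, stdAddChar_coe]
  have : 2 * (Real.pi : ℂ) * Complex.I * (1 : ℤ) / ((2 ^ 1 : ℕ) : ℂ) = Real.pi * Complex.I := by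
    push_cast; ring
  rw [this, Complex.exp_pi_mul_I]

theorem mul_add_one_eq_two_mul {n : ℕ} (w : ZMod (2 ^ n)) : ∃ v, w * (w + 1) = 2 * v := by
  obtain ⟨k, hk⟩ := Nat.even_mul_succ_self w.val
  refine ⟨k, ?_⟩
  have := congrArg (Nat.cast : ℕ → ZMod (2 ^ n)) hk
  push_cast at this
  rw [ZMod.natCast_zmod_val] at this
  rw [this]; ring

theorem odd_sq_eq {n : ℕ} (w : ZMod (2 ^ n)) : ∃ v, (2 * w + 1) ^ 2 = 1 + 8 * v := by
  obtain ⟨v, hv⟩ := mul_add_one_eq_two_mul w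
  exact ⟨v, by linear_combination 4 * hv⟩

/-- The Gauss sum of `2 ^ j * u * z ^ 2` modulo `2 ^ n`. -/
noncomputable def gaussI (n j : ℕ) (u : ℤ) : ℂ :=
  ∑ z : ZMod (2 ^ n), stdAddChar (2 ^ j * ((u : ZMod (2 ^ n)) * z ^ 2))

theorem gaussI_of_le {n j : ℕ} (h : n ≤ j) (u : ℤ) : gaussI n j u = 2 ^ n := by
  simp [gaussI, two_pow_eq_zero_of_le h]

/-- Split z by parity. As w runs over all residues modulo 2^n, each of 2w and 2w + 1 takes its
values twice, whence the factor 2. -/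
theorem gaussI_step {n : ℕ} (hn : 1 ≤ n) (j : ℕ) (u : ℤ) :
    2 * gaussI n j u = gaussI n (j + 2) u +
      ∑ w : ZMod (2 ^ n), stdAddChar (2 ^ j * ((u : ZMod (2 ^ n)) * (2 * w + 1) ^ 2)) := by
  rw [gaussI, two_mul_sum_zmod hn, Finset.sum_add_distrib]
  congr 1
  refine Finset.sum_congr rfl fun w _ => ?_
  congr 1
  ring

/-- Odd squares are 1 modulo 8, so every summand is the same. -/
theorem sum_stdAddChar_odd_sq {n j : ℕ} (h : n ≤ j + 3) (u : ℤ) :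
    ∑ w : ZMod (2 ^ n), stdAddChar (2 ^ j * ((u : ZMod (2 ^ n)) * (2 * w + 1) ^ 2)) =
      2 ^ n * stdAddChar ((2 : ZMod (2 ^ n)) ^ j * (u : ZMod (2 ^ n))) := by
  have : ∀ w : ZMod (2 ^ n), (2 : ZMod (2 ^ n)) ^ j * (u * (2 * w + 1) ^ 2) = 2 ^ j * u := fun w => by
    obtain ⟨v, hv⟩ := odd_sq_eq w
    have h8 := two_pow_eq_zero_of_le h
    rw [hv]
    linear_combination (u * v) * h8
  simp [this]

theorem sum_stdAddChar_odd_sq_eq_zero {n j : ℕ} (h : j + 4 ≤ n) {u : ℤ} (hu : Odd u) :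
    ∑ w : ZMod (2 ^ n), stdAddChar (2 ^ j * ((u : ZMod (2 ^ n)) * (2 * w + 1) ^ 2)) = 0 := by
  obtain ⟨e, rfl⟩ := Nat.exists_eq_add_of_le h
  -- With n = j + 4 + e, this shift adds 2^(n-1) u to the argument, half a period since u is odd.
  refine sum_eq_zero_of_shift _ (2 ^ (e + 1)) fun w => ?_
  have h1 : (2 : ZMod (2 ^ (j + 4 + e))) ^ (j + 4 + e) = 0 := two_pow_eq_zero_of_le le_rfl
  have h2 : (2 : ZMod (2 ^ (j + 4 + e))) ^ j * (u * (2 * (w + 2 ^ (e + 1)) + 1) ^ 2) =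
      2 ^ j * (u * (2 * w + 1) ^ 2) + 2 ^ (j + 3 + e) * u := by
    ring_nf at h1 ⊢
    linear_combination ((w : ZMod (2 ^ (j + 4 + e))) * u + u * 2 ^ e) * h1
  rw [h2, AddChar.map_add_eq_mul, stdAddChar_half (by ring) hu]
  ring

/-- The residue `±1` modulo `8` attached to a subscript. -/
def FineSubscript.beta : FineSubscript → ZMod 8
  | G => 1
  | R => -1

/-- The residue `0` or `4` modulo `8` attached to a sign. -/
def FineSign.four : FineSign → ZMod 8
  | plus => 0
  | minus => 4

theorem stdAddChar_eight_one : stdAddChar (1 : ZMod 8) =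
    (Real.sqrt 2 / 2 : ℝ) + (Real.sqrt 2 / 2 : ℝ) * Complex.I := by
  have := stdAddChar_coe (N := 8) 1
  push_cast at this
  rw [this]
  have h : 2 * (Real.pi : ℂ) * Complex.I * 1 / 8 = ((Real.pi / 4 : ℝ) : ℂ) * Complex.I := by
    push_cast; ring
  rw [h, Complex.exp_mul_I, ← Complex.ofReal_cos, ← Complex.ofReal_sin, Real.cos_pi_div_four,
    Real.sin_pi_div_four]

/-- For ζ = exp(±πi/4), 1 + ζ² = ζ(ζ⁻¹ + ζ) = √2 ζ. -/
theorem one_add_stdAddChar_eight (s : FineSubscript) :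
    1 + stdAddChar (2 * s.beta) = Real.sqrt 2 * stdAddChar s.beta := by
  have h2 : (Real.sqrt 2 : ℂ) * Real.sqrt 2 = 2 := by
    rw [← Complex.ofReal_mul, Real.mul_self_sqrt zero_le_two]; norm_num
  have h1 : 1 + stdAddChar (2 : ZMod 8) = Real.sqrt 2 * stdAddChar (1 : ZMod 8) := by
    have : (2 : ZMod 8) = 1 + 1 := rfl
    rw [this, AddChar.map_add_eq_mul, stdAddChar_eight_one]
    push_cast
    linear_combination (1 / 4 + Complex.I / 2 + Complex.I ^ 2 / 4 - 1/2 - Complex.I / 2) * h2 +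
      (1 / 2) * Complex.I_sq
  have hm : stdAddChar (-1 : ZMod 8) * stdAddChar (1 : ZMod 8) = 1 := by
    rw [← AddChar.map_add_eq_mul]; simp
  have h4 : stdAddChar (2 : ZMod 8) = stdAddChar (1 : ZMod 8) * stdAddChar (1 : ZMod 8) := by
    rw [← AddChar.map_add_eq_mul]; rfl
  have h5 : stdAddChar (2 * (-1) : ZMod 8) = stdAddChar (-1 : ZMod 8) * stdAddChar (-1 : ZMod 8) := by
    rw [← AddChar.map_add_eq_mul]; rfl
  cases s
  · simpa [FineSubscript.beta] using h1
  · change 1 + stdAddChar (2 * (-1) : ZMod 8) = Real.sqrt 2 * stdAddChar (-1 : ZMod 8)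
    rw [h5]
    rw [h4] at h1
    linear_combination (stdAddChar (-1 : ZMod 8)) ^ 2 * h1 - (stdAddChar (-1 : ZMod 8) * stdAddChar (1 : ZMod 8) + 1 - Real.sqrt 2 * stdAddChar (-1 : ZMod 8)) * hm

/-- Even z contribute +1 and odd z contribute -1, in equal numbers. -/
theorem gaussI_of_eq_add_one {n j : ℕ} (h : n = j + 1) {u : ℤ} (hu : Odd u) : gaussI n j u = 0 := by
  have h1 := gaussI_step (n := n) (by omega) j u
  rw [gaussI_of_le (n := n) (j := j + 2) (by omega), sum_stdAddChar_odd_sq (n := n) (j := j) (by omega), stdAddChar_half h hu] at h1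
  linear_combination (1 / 2 : ℂ) * h1

/-- The value of the Gauss sum of `2 ^ j * u * z ^ 2` modulo `2 ^ n`, up to a positive factor. -/
theorem gaussI_eq {n : ℕ} (hn : 3 ≤ n) (ε : FineSign) (s : FineSubscript) (r : ℕ) :
    ∀ j, n = j + r → r ≠ 1 → ∃ ρ : ℝ, 0 < ρ ∧ gaussI n j (ε.oddity s) =
      ρ * stdAddChar (if 2 ≤ r then s.beta + (r : ZMod 8) * ε.four else 0) := by
  induction r using Nat.strong_induction_on with
  | _ r ih =>
    intro j hj hr
    have h1 := gaussI_step (n := n) (by omega) j (ε.oddity s)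
    -- For r = 2 the sum is proportional to 1 + i^u and sees only u modulo 4, the subscript. For r =
    -- 3 the even part vanishes and the odd part gives exp(2πi u/8), which also sees the sign. For r
    -- ≥ 4 the odd part cancels and r drops by 2, so the sign enters according to the parity of r.
    obtain rfl | rfl | rfl | hr4 : r = 0 ∨ r = 2 ∨ r = 3 ∨ 4 ≤ r := by omega
    · exact ⟨2 ^ n, by positivity, by rw [gaussI_of_le (n := n) (j := j) (by omega)]; simp [AddChar.map_zero_eq_one]⟩
    · rw [gaussI_of_le (n := n) (j := j + 2) (by omega), sum_stdAddChar_odd_sq (n := n) (j := j) (by omega)] at h1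
      -- Here n ≥ 3 is needed: it frees a factor 2, so that the fourth root of unity is written as a
      -- character value on `ZMod 8`.
      obtain ⟨i, rfl⟩ : ∃ i, j = i + 1 := ⟨j - 1, by omega⟩
      have h2 : (2 : ZMod (2 ^ n)) ^ (i + 1) * ((ε.oddity s : ℤ) : ZMod (2 ^ n)) =
          2 ^ i * ((2 * ε.oddity s : ℤ) : ZMod (2 ^ n)) := by push_cast; ring
      rw [h2, stdAddChar_two_pow_mul (r := 3) (by omega)] at h1
      have h3 : stdAddChar ((2 * ε.oddity s : ℤ) : ZMod (2 ^ 3)) = stdAddChar (2 * s.beta) :=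
        congrArg (stdAddChar (N := 8)) (show ((2 * ε.oddity s : ℤ) : ZMod 8) = 2 * s.beta by
          cases ε <;> cases s <;> decide)
      rw [h3] at h1
      have h4 := one_add_stdAddChar_eight s
      have h5 : (if 2 ≤ 2 then s.beta + ((2 : ℕ) : ZMod 8) * ε.four else 0 : ZMod 8) = s.beta := by
        cases ε <;> cases s <;> decide
      refine ⟨2 ^ n / 2 * Real.sqrt 2, by positivity, ?_⟩
      rw [h5]
      push_cast
      linear_combination (1 / 2 : ℂ) * h1 + (2 ^ n / 2 : ℂ) * h4
    · rw [gaussI_of_eq_add_one (n := n) (j := j + 2) (by omega) (ε.odd_oddity s), sum_stdAddChar_odd_sq (n := n) (j := j) (by omega),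
        stdAddChar_two_pow_mul (r := 3) (by omega)] at h1
      have h3 : stdAddChar ((ε.oddity s : ℤ) : ZMod (2 ^ 3)) =
          stdAddChar (s.beta + ((3 : ℕ) : ZMod 8) * ε.four) :=
        congrArg (stdAddChar (N := 8)) (show ((ε.oddity s : ℤ) : ZMod 8) = _ by
          cases ε <;> cases s <;> decide)
      rw [h3] at h1
      refine ⟨2 ^ n / 2, by positivity, ?_⟩
      rw [if_pos (by norm_num), Complex.ofReal_div, Complex.ofReal_pow, Complex.ofReal_ofNat]
      linear_combination (1 / 2 : ℂ) * h1
    · obtain ⟨r, rfl⟩ : ∃ r', r = r' + 2 := ⟨r - 2, by omega⟩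
      obtain ⟨ρ, hρ, h2⟩ := ih r (by omega) (j + 2) (by omega) (by omega)
      rw [h2, sum_stdAddChar_odd_sq_eq_zero (n := n) (j := j) (by omega) (ε.odd_oddity s)] at h1
      refine ⟨ρ / 2, by positivity, ?_⟩
      have h3 : (2 : ZMod 8) * ε.four = 0 := by cases ε <;> decide
      have h4 : s.beta + ((r + 2 : ℕ) : ZMod 8) * ε.four = s.beta + (r : ZMod 8) * ε.four := by
        push_cast; linear_combination h3
      rw [if_pos (by omega)] at h1 ⊢
      rw [h4]
      push_cast
      linear_combination (1 / 2 : ℂ) * h1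

end GaussSums

/-! ### Gauss sums of even planes -/

section GaussSumsEven

open ZMod

/-- The Gauss sum of `2 ^ j * (x * y + a * (x ^ 2 + y ^ 2))` modulo `2 ^ n`. -/
noncomputable def gaussII (n j : ℕ) (a : ℤ) : ℂ :=
  ∑ x : ZMod (2 ^ n), ∑ y : ZMod (2 ^ n),
    stdAddChar (2 ^ j * (x * y + (a : ZMod (2 ^ n)) * (x ^ 2 + y ^ 2)))

theorem gaussII_of_le {n j : ℕ} (h : n ≤ j) (a : ℤ) : gaussII n j a = 2 ^ n * 2 ^ n := by
  simp [gaussII, two_pow_eq_zero_of_le h]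

theorem four_mul_sum_zmod {n : ℕ} (hn : 1 ≤ n) (f : ZMod (2 ^ n) → ZMod (2 ^ n) → ℂ) :
    4 * ∑ x, ∑ y, f x y = (∑ x, ∑ y, f (2 * x) (2 * y)) + (∑ x, ∑ y, f (2 * x) (2 * y + 1)) +
      (∑ x, ∑ y, f (2 * x + 1) (2 * y)) + ∑ x, ∑ y, f (2 * x + 1) (2 * y + 1) := by
  have h1 := two_mul_sum_zmod hn fun x => ∑ y, f x y
  have h2 : ∑ w, (∑ y, f (2 * w) y + ∑ y, f (2 * w + 1) y) * 2 =
      ∑ w, ((∑ y, f (2 * w) (2 * y) + ∑ y, f (2 * w) (2 * y + 1)) +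
        (∑ y, f (2 * w + 1) (2 * y) + ∑ y, f (2 * w + 1) (2 * y + 1))) := by
    refine Finset.sum_congr rfl fun w _ => ?_
    rw [← Finset.sum_add_distrib (f := fun y => f (2 * w) (2 * y)),
      ← Finset.sum_add_distrib (f := fun y => f (2 * w + 1) (2 * y)), ← two_mul_sum_zmod hn,
      ← two_mul_sum_zmod hn]
    ring
  rw [← Finset.sum_mul, ← h1] at h2
  simp only [Finset.sum_add_distrib] at h2
  linear_combination h2

/-- Modulo 2 the form xy + a(x² + y²) takes the values 0, a, a, 1 on the four parity classes, so the
sum is proportional to 1 + 2(-1)^a - 1: the sign is the Arf invariant. -/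
theorem gaussII_of_eq_add_one {n j : ℕ} (h : n = j + 1) (ε : FineSign) :
    gaussII n j ε.evenParam = 2 ^ n * 2 ^ n / 2 * stdAddChar ε.four := by
  have h1 := four_mul_sum_zmod (n := n) (by omega) fun x y =>
    stdAddChar (2 ^ j * (x * y + (ε.evenParam : ZMod (2 ^ n)) * (x ^ 2 + y ^ 2)))
  have h0 : (2 : ZMod (2 ^ n)) ^ j * 2 = 0 := by
    rw [← pow_succ]; exact two_pow_eq_zero_of_le (by omega)
  have ha := stdAddChar_half h (a := 1) (by decide)
  have e00 : ∀ x y : ZMod (2 ^ n), 2 ^ j * ((2 * x) * (2 * y) +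
      (ε.evenParam : ZMod (2 ^ n)) * ((2 * x) ^ 2 + (2 * y) ^ 2)) = 0 := fun x y => by
    linear_combination (2 * x * y + (ε.evenParam : ZMod (2 ^ n)) * (2 * x ^ 2 + 2 * y ^ 2)) * h0
  have e01 : ∀ x y : ZMod (2 ^ n), 2 ^ j * ((2 * x) * (2 * y + 1) +
      (ε.evenParam : ZMod (2 ^ n)) * ((2 * x) ^ 2 + (2 * y + 1) ^ 2)) =
      2 ^ j * (ε.evenParam : ZMod (2 ^ n)) := fun x y => by
    linear_combination (x * (2 * y + 1) +
      (ε.evenParam : ZMod (2 ^ n)) * (2 * x ^ 2 + 2 * y ^ 2 + 2 * y)) * h0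
  have e10 : ∀ x y : ZMod (2 ^ n), 2 ^ j * ((2 * x + 1) * (2 * y) +
      (ε.evenParam : ZMod (2 ^ n)) * ((2 * x + 1) ^ 2 + (2 * y) ^ 2)) =
      2 ^ j * (ε.evenParam : ZMod (2 ^ n)) := fun x y => by
    linear_combination (y * (2 * x + 1) +
      (ε.evenParam : ZMod (2 ^ n)) * (2 * y ^ 2 + 2 * x ^ 2 + 2 * x)) * h0
  have e11 : ∀ x y : ZMod (2 ^ n), 2 ^ j * ((2 * x + 1) * (2 * y + 1) +
      (ε.evenParam : ZMod (2 ^ n)) * ((2 * x + 1) ^ 2 + (2 * y + 1) ^ 2)) =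
      2 ^ j * ((1 : ℤ) : ZMod (2 ^ n)) := fun x y => by
    push_cast
    linear_combination (2 * x * y + x + y +
      (ε.evenParam : ZMod (2 ^ n)) * (2 * x ^ 2 + 2 * x + 2 * y ^ 2 + 2 * y + 1)) * h0
  simp only [e00, e01, e10, e11] at h1
  have h4 : stdAddChar (4 : ZMod 8) = -1 := by
    have := stdAddChar_half (n := 3) (j := 2) rfl (a := 1) (by decide)
    exact this
  have hc : ∀ c : ℂ, ∑ _x : ZMod (2 ^ n), ∑ _y : ZMod (2 ^ n), c = 2 ^ n * 2 ^ n * c := fun c => by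
    simp [mul_assoc]
  simp only [hc, AddChar.map_zero_eq_one, ha] at h1
  rw [gaussII]
  cases ε
  · simp only [FineSign.evenParam, FineSign.four, Int.cast_zero, mul_zero,
      AddChar.map_zero_eq_one] at h1 ⊢
    linear_combination (1 / 4 : ℂ) * h1
  · simp only [FineSign.evenParam, FineSign.four, h4, ha] at h1 ⊢
    linear_combination (1 / 4 : ℂ) * h1

/-- When one coordinate is odd, the sum over the other vanishes: shifting it by 2^(n-j-2) moves the
argument by half a period. Only the pairs with both coordinates even survive. -/
theorem gaussII_step {n j : ℕ} (h : j + 2 ≤ n) (a : ℤ) :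
    4 * gaussII n j a = gaussII n (j + 2) a := by
  have h1 := four_mul_sum_zmod (n := n) (by omega) fun x y =>
    stdAddChar (2 ^ j * (x * y + (a : ZMod (2 ^ n)) * (x ^ 2 + y ^ 2)))
  have key : ∀ b x : ZMod (2 ^ n), ∑ y : ZMod (2 ^ n), stdAddChar (2 ^ j * ((2 * x + 1) * (2 * y + b) +
      (a : ZMod (2 ^ n)) * ((2 * x + 1) ^ 2 + (2 * y + b) ^ 2))) = 0 := fun b x => by
    clear h1
    obtain ⟨e, rfl⟩ := Nat.exists_eq_add_of_le h
    refine sum_eq_zero_of_shift _ (2 ^ e) fun y => ?_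
    have h0 : (2 : ZMod (2 ^ (j + 2 + e))) ^ (j + 2 + e) = 0 := two_pow_eq_zero_of_le le_rfl
    have h2 : (2 : ZMod (2 ^ (j + 2 + e))) ^ j * ((2 * x + 1) * (2 * (y + 2 ^ e) + b) +
        (a : ZMod (2 ^ (j + 2 + e))) * ((2 * x + 1) ^ 2 + (2 * (y + 2 ^ e) + b) ^ 2)) =
        2 ^ j * ((2 * x + 1) * (2 * y + b) +
        (a : ZMod (2 ^ (j + 2 + e))) * ((2 * x + 1) ^ 2 + (2 * y + b) ^ 2)) +
        2 ^ (j + 1 + e) * ((1 : ℤ) : ZMod (2 ^ (j + 2 + e))) := by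
      push_cast
      ring_nf at h0 ⊢
      linear_combination (x + (a : ZMod (2 ^ (j + 2 + e))) * (2 * y + b + 2 ^ e)) * h0
    rw [h2, AddChar.map_add_eq_mul, stdAddChar_half (by ring) (by decide)]
    ring
  have k0 := key 0
  have k1 := key 1
  simp only [add_zero] at k0
  have k2 : ∑ x : ZMod (2 ^ n), ∑ y : ZMod (2 ^ n), stdAddChar (2 ^ j * ((2 * x) * (2 * y + 1) +
      (a : ZMod (2 ^ n)) * ((2 * x) ^ 2 + (2 * y + 1) ^ 2))) = 0 := by
    rw [Finset.sum_comm]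
    refine Finset.sum_eq_zero fun y _ => ?_
    rw [← k0 y]
    refine Finset.sum_congr rfl fun x _ => congrArg _ ?_
    ring
  rw [gaussII, h1, k2, Finset.sum_eq_zero fun x _ => k0 x, Finset.sum_eq_zero fun x _ => k1 x, gaussII,
    add_zero, add_zero, add_zero]
  refine Finset.sum_congr rfl fun x _ => Finset.sum_congr rfl fun y _ => congrArg _ ?_
  ring

theorem gaussII_eq {n : ℕ} (ε : FineSign) (r : ℕ) :
    ∀ j, n = j + r → ∃ ρ : ℝ, 0 < ρ ∧ gaussII n j ε.evenParam =
      ρ * stdAddChar ((r : ZMod 8) * ε.four) := by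
  induction r using Nat.strong_induction_on with
  | _ r ih =>
    intro j hj
    obtain rfl | rfl | hr : r = 0 ∨ r = 1 ∨ 2 ≤ r := by omega
    · refine ⟨2 ^ n * 2 ^ n, by positivity, ?_⟩
      rw [gaussII_of_le (n := n) (j := j) (by omega)]
      simp [AddChar.map_zero_eq_one]
    · refine ⟨2 ^ n * 2 ^ n / 2, by positivity, ?_⟩
      rw [gaussII_of_eq_add_one hj]
      simp
    · obtain ⟨r, rfl⟩ : ∃ r', r = r' + 2 := ⟨r - 2, by omega⟩
      obtain ⟨ρ, hρ, h⟩ := ih r (by omega) (j + 2) (by omega)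
      have h1 := gaussII_step (n := n) (j := j) (by omega) ε.evenParam
      have h3 : (2 : ZMod 8) * ε.four = 0 := by cases ε <;> decide
      have h4 : ((r + 2 : ℕ) : ZMod 8) * ε.four = r * ε.four := by
        push_cast; linear_combination h3
      refine ⟨ρ / 4, by positivity, ?_⟩
      rw [h4, Complex.ofReal_div, Complex.ofReal_ofNat]
      rw [h] at h1
      linear_combination (1 / 4 : ℂ) * h1

end GaussSumsEven

theorem stdAddChar_sum {N : ℕ} [NeZero N] {ι : Type*} (s : Finset ι) (f : ι → ZMod N) :
    ZMod.stdAddChar (∑ i ∈ s, f i) = ∏ i ∈ s, ZMod.stdAddChar (f i) := by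
  classical
  induction s using Finset.induction_on with
  | empty => simp [AddChar.map_zero_eq_one]
  | insert a s ha ih => rw [Finset.sum_insert ha, Finset.prod_insert ha, AddChar.map_add_eq_mul, ih]

/-! ### Phases of terms and factorization of the Gauss sum -/

namespace FineTerm

open ZMod

/-- The contribution of a term to the phase of the Gauss sum at scale `2 ^ m`. -/
def phase (m : ℤ) (t : FineTerm) : ZMod 8 :=
  if t.logScale < m then
    match t with
    | typeII k ε => ((m - k : ℤ) : ZMod 8) * ε.four
    | typeI k ε s => s.beta + ((m - k + 1 : ℤ) : ZMod 8) * ε.four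
  else 0

/-- The Gauss sum of a term. -/
noncomputable def termGauss (n : ℕ) (K : ℤ) (t : FineTerm) : ℂ :=
  ∑ x : Fin t.dim → ZMod (2 ^ n), stdAddChar (2 ^ (t.logScale + K).toNat * baseForm _ t x x)

theorem termGauss_typeI (n : ℕ) (K k : ℤ) (ε : FineSign) (s : FineSubscript) :
    termGauss n K (typeI k ε s) = gaussI n (k + K).toNat (ε.oddity s) := by
  refine Fintype.sum_equiv (Equiv.funUnique (Fin 1) (ZMod (2 ^ n))) _ _ fun x => congrArg _ ?_
  change (2 : ZMod (2 ^ n)) ^ (k + K).toNat * (∑ b : Fin 1, (∑ a : Fin 1, x a *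
    (((!![ε.oddity s] : Matrix (Fin 1) (Fin 1) ℤ) a b : ℤ) : ZMod (2 ^ n))) * x b) =
    2 ^ (k + K).toNat * ((ε.oddity s : ZMod (2 ^ n)) * (x 0) ^ 2)
  simp only [Fin.sum_univ_one, Matrix.of_apply, Matrix.cons_val_zero]
  ring

/-- The norms of an even plane carry an extra factor 2, which accounts for the exponent increased by
1. -/
theorem termGauss_typeII (n : ℕ) (K k : ℤ) (ε : FineSign) :
    termGauss n K (typeII k ε) = gaussII n ((k + K).toNat + 1) ε.evenParam := by
  rw [gaussII, ← Fintype.sum_prod_type']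
  refine Fintype.sum_equiv (finTwoArrowEquiv (ZMod (2 ^ n))) _ _ fun x => congrArg _ ?_
  change Fin 2 → ZMod (2 ^ n) at x
  change (2 : ZMod (2 ^ n)) ^ (k + K).toNat * (∑ b : Fin 2, (∑ a : Fin 2, x a * _) * x b) =
    2 ^ ((k + K).toNat + 1) * (x 0 * x 1 + (ε.evenParam : ZMod (2 ^ n)) * ((x 0) ^ 2 + (x 1) ^ 2))
  cases ε <;>
  simp [intGram, Fin.sum_univ_two, FineSign.evenParam] <;>
  ring

/-- With n = m + 1 + K, a term of scale 2^k has n - j = m - k + 1 in type I and m - k in type II.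
The argument vanishes modulo 2^n for k > m, and for k = m in type II. The bound 2 ≤ m + K ensures n
≥ 3. -/
theorem termGauss_eq {m K : ℤ} (hm : 2 ≤ m + K) (t : FineTerm) (ht : 0 ≤ t.logScale + K)
    (h : ¬ (t.IsTypeI ∧ t.logScale = m)) :
    ∃ ρ : ℝ, 0 < ρ ∧ termGauss (m + 1 + K).toNat K t = ρ * stdAddChar (phase m t) := by
  rcases t with ⟨k, ε⟩ | ⟨k, ε, s⟩ <;> simp only [logScale, IsTypeI, true_and] at ht h
  · rw [termGauss_typeII]
    rcases lt_or_ge k m with hk | hk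
    · obtain ⟨ρ, hρ, h1⟩ := gaussII_eq (n := (m + 1 + K).toNat) ε (m - k).toNat ((k + K).toNat + 1)
        (by omega)
      refine ⟨ρ, hρ, h1.trans ?_⟩
      have h2 : (((m - k).toNat : ℕ) : ZMod 8) = ((m - k : ℤ) : ZMod 8) := by
        rw [← Int.cast_natCast, Int.toNat_of_nonneg (by omega)]
      rw [h2, phase, if_pos (by exact hk)]
    · refine ⟨2 ^ (m + 1 + K).toNat * 2 ^ (m + 1 + K).toNat, by positivity, ?_⟩
      rw [gaussII_of_le (by omega), phase, if_neg (by simpa [logScale] using hk)]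
      simp [AddChar.map_zero_eq_one]
  · rw [termGauss_typeI]
    rcases lt_or_ge k m with hk | hk
    · obtain ⟨ρ, hρ, h1⟩ := gaussI_eq (n := (m + 1 + K).toNat) (by omega) ε s (m - k + 1).toNat
        (k + K).toNat (by omega) (by omega)
      refine ⟨ρ, hρ, h1.trans ?_⟩
      have h2 : (((m - k + 1).toNat : ℕ) : ZMod 8) = ((m - k + 1 : ℤ) : ZMod 8) := by
        rw [← Int.cast_natCast, Int.toNat_of_nonneg (by omega)]
      rw [h2, phase, if_pos (by omega), if_pos (by exact hk)]
    · refine ⟨2 ^ (m + 1 + K).toNat, by positivity, ?_⟩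
      rw [gaussI_of_le (by omega), phase, if_neg (by simpa [logScale] using hk)]
      simp [AddChar.map_zero_eq_one]

theorem termGauss_eq_zero {m K : ℤ} (hm : 0 ≤ m + K) (t : FineTerm) (ht : t.IsTypeI)
    (h : t.logScale = m) : termGauss (m + 1 + K).toNat K t = 0 := by
  rcases t with ⟨k, ε⟩ | ⟨k, ε, s⟩
  · exact ht.elim
  · rw [termGauss_typeI]
    simp only [logScale] at h
    exact gaussI_of_eq_add_one (by omega) (ε.odd_oddity s)

theorem sum_stdAddChar_familyForm {ι : Type} [Fintype ι] [DecidableEq ι] (t : ι → FineTerm) (K : ℤ) (n : ℕ) :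
    ∑ z : ∀ i, Fin (t i).dim → ZMod (2 ^ n), stdAddChar (familyForm _ t K z z) =
      ∏ i, termGauss n K (t i) := by
  simp only [termGauss]
  rw [Finset.prod_univ_sum, Fintype.piFinset_univ]
  refine Finset.sum_congr rfl fun z _ => ?_
  rw [familyForm, stdAddChar_sum]

theorem prod_termGauss_eq_of_isometric {ι κ : Type} [Fintype ι] [Fintype κ] {t : ι → FineTerm}
    {t' : κ → FineTerm} (h : (sumLattice t).Isometric (sumLattice t')) {K : ℤ}
    (hK : ∀ i, 0 ≤ (t i).logScale + K) (hK' : ∀ i, 0 ≤ (t' i).logScale + K) (n : ℕ) :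
    ∏ i, termGauss n K (t i) = ∏ i, termGauss n K (t' i) := by
  classical
  obtain ⟨e, he⟩ := exists_zmod_equiv h hK hK' n
  rw [← sum_stdAddChar_familyForm, ← sum_stdAddChar_familyForm]
  refine Fintype.sum_equiv e _ _ fun z => ?_
  rw [he]

end FineTerm

/-! ### Invariants read off from the Gauss sums -/

namespace FineSymbol

open FineTerm ZMod

/-- There is a type I term of scale `2 ^ m`. -/
def HasTypeI (F : FineSymbol) (m : ℤ) : Prop :=
  ∃ t ∈ F.terms, t.IsTypeI ∧ t.logScale = m

/-- The phase of the Gauss sum of a fine symbol at scale `2 ^ m`. -/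
def totalPhase (F : FineSymbol) (m : ℤ) : ZMod 8 :=
  (F.terms.map (phase m)).sum

theorem prod_termGauss_eq (F : FineSymbol) {m K : ℤ} (hm : 2 ≤ m + K)
    (hF : ∀ t ∈ F.terms, 1 ≤ t.logScale + K) (h : ¬ F.HasTypeI m) :
    ∃ ρ : ℝ, 0 < ρ ∧ ∏ i : F.terms.ToType, termGauss (m + 1 + K).toNat K i.1 =
      ρ * stdAddChar (F.totalPhase m) := by
  have h1 : ∀ i : F.terms.ToType, ∃ ρ : ℝ, 0 < ρ ∧ termGauss (m + 1 + K).toNat K i.1 =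
      ρ * stdAddChar (phase m i.1) := fun i =>
    termGauss_eq hm i.1 (by have := hF i.1 Multiset.coe_mem; omega)
      fun hi => h ⟨i.1, Multiset.coe_mem, hi⟩
  choose ρ hρ hi using h1
  refine ⟨∏ i, ρ i, Finset.prod_pos fun i _ => hρ i, ?_⟩
  rw [totalPhase, ← sum_terms, stdAddChar_sum, Complex.ofReal_prod,
    ← Finset.prod_mul_distrib]
  exact Finset.prod_congr rfl fun i _ => hi i

theorem prod_termGauss_eq_zero (F : FineSymbol) {m K : ℤ} (hm : 2 ≤ m + K) (h : F.HasTypeI m) :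
    ∏ i : F.terms.ToType, termGauss (m + 1 + K).toNat K i.1 = 0 := by
  obtain ⟨t, ht, h1, h2⟩ := h
  refine Finset.prod_eq_zero (i := Multiset.mkToType F.terms t ⟨0, Multiset.count_pos.mpr ht⟩)
    (Finset.mem_univ _) ?_
  exact termGauss_eq_zero (by omega) t h1 h2

/-- A type I term of scale 2^m makes the Gauss sum vanish; without one the sum is a positive real
times a root of unity. -/
theorem hasTypeI_iff_of_isometric {F F' : FineSymbol} (h : F.lattice.Isometric F'.lattice) (m : ℤ) :
    F.HasTypeI m ↔ F'.HasTypeI m := by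
  have key : ∀ {F F' : FineSymbol}, F.lattice.Isometric F'.lattice → F.HasTypeI m → F'.HasTypeI m := by
    intro F F' h hm
    by_contra hm'
    obtain ⟨K, hk, hK, hK'⟩ := exists_shift F F' (2 - m)
    obtain ⟨ρ, hρ, h1⟩ := F'.prod_termGauss_eq (m := m) (K := K) (by omega) hK' hm'
    have h2 := F.prod_termGauss_eq_zero (m := m) (K := K) (by omega) hm
    have h3 := prod_termGauss_eq_of_isometric h (K := K)
      (fun i => by have := hK i.1 Multiset.coe_mem; omega)
      (fun i => by have := hK' i.1 Multiset.coe_mem; omega) (m + 1 + K).toNat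
    rw [h1, h2] at h3
    have h4 := congrArg norm h3
    rw [norm_mul, AddChar.norm_apply] at h4
    simp at h4
    exact (abs_pos_of_pos hρ).ne h4
  exact ⟨key h, key h.symm⟩

/-- Comparing norms equates the positive factors. The remaining eighth roots of unity determine
their exponents in `ZMod 8`. -/
theorem totalPhase_eq_of_isometric {F F' : FineSymbol} (h : F.lattice.Isometric F'.lattice) {m : ℤ}
    (hm : ¬ F.HasTypeI m) : F.totalPhase m = F'.totalPhase m := by
  obtain ⟨K, hk, hK, hK'⟩ := exists_shift F F' (2 - m)
  obtain ⟨ρ, hρ, h1⟩ := F.prod_termGauss_eq (m := m) (K := K) (by omega) hK hm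
  obtain ⟨ρ', hρ', h2⟩ := F'.prod_termGauss_eq (m := m) (K := K) (by omega) hK'
    (by rwa [← hasTypeI_iff_of_isometric h])
  have h3 := prod_termGauss_eq_of_isometric h (K := K)
    (fun i => by have := hK i.1 Multiset.coe_mem; omega)
    (fun i => by have := hK' i.1 Multiset.coe_mem; omega) (m + 1 + K).toNat
  rw [h1, h2] at h3
  have h4 := congrArg norm h3
  rw [norm_mul, norm_mul, AddChar.norm_apply, AddChar.norm_apply, mul_one, mul_one,
    Complex.norm_of_nonneg hρ.le, Complex.norm_of_nonneg hρ'.le] at h4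
  rw [h4] at h3
  exact injective_stdAddChar (mul_left_cancel₀ (by exact_mod_cast hρ'.ne') h3)

end FineSymbol

/-! ### Elementary operations on fine symbols with a fixed shape -/

theorem FineSign.four_neg (ε : FineSign) : ε.neg.four = ε.four + 4 := by cases ε <;> decide

theorem FineSign.two_mul_four (ε : FineSign) : 2 * ε.four = 0 := by cases ε <;> decide

theorem FineSign.neg_eq_of_ne {ε δ : FineSign} (h : ε ≠ δ) : ε.neg = δ := by
  cases ε <;> cases δ <;> first | rfl | exact absurd rfl h

theorem FineSubscript.swap_eq_of_ne {s s' : FineSubscript} (h : s ≠ s') : s.swap = s' := by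
  cases s <;> cases s' <;> first | rfl | exact absurd rfl h

namespace FineTerm

open TwoAdicLattice

/-- The sign of a term. -/
def sign : FineTerm → FineSign
  | typeII _ ε => ε
  | typeI _ ε _ => ε

/-- The subscript of a term of type I. -/
def subscript : FineTerm → FineSubscript
  | typeII _ _ => .G
  | typeI _ _ s => s

theorem eq_typeI_of_isTypeI {t : FineTerm} (h : t.IsTypeI) :
    typeI t.logScale t.sign t.subscript = t := by
  rcases t with ⟨k, ε⟩ | ⟨k, ε, s⟩
  · exact h.elim
  · rfl

/-- For unequal signs, exchanging the subscripts amounts to negating both signs and reordering. -/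
theorem typeI_osum_typeI_swap_same (k : ℤ) (ε ε' : FineSign) (s s' : FineSubscript) :
    (osum (typeI k ε s).lattice (typeI k ε' s').lattice).Isometric
      (osum (typeI k ε s').lattice (typeI k ε' s).lattice) := by
  by_cases h : ε = ε'
  · subst h; exact osum_comm _ _
  · obtain rfl := FineSign.neg_eq_of_ne h
    refine (typeI_osum_typeI_neg_same k ε ε.neg s s').trans ?_
    rw [FineSign.neg_neg]
    exact osum_comm _ _

end FineTerm

namespace FineSymbol

open FineTerm TwoAdicLattice

/-- All scales between `2 ^ a` and `2 ^ b` carry terms of type I. -/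
def Conn (F : FineSymbol) (a b : ℤ) : Prop :=
  ∀ m ∈ Set.uIcc a b, F.HasTypeI m

/-- The compartment containing a given scale. -/
theorem isCompartment_filter (F : FineSymbol) {c : ℤ}
    [DecidablePred fun t : FineTerm => t.IsTypeI ∧ F.Conn c t.logScale] (hc : F.HasTypeI c) :
    F.IsCompartment (F.terms.filter fun t => t.IsTypeI ∧ F.Conn c t.logScale) := by
  have hset : {k : ℤ | ∃ t ∈ F.terms.filter fun t => t.IsTypeI ∧ F.Conn c t.logScale, t.logScale = k} =
      Set.ordConnectedComponent {m | F.HasTypeI m} c := by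
    ext m
    rw [Set.mem_ordConnectedComponent]
    constructor
    · rintro ⟨t, ht, rfl⟩
      exact (Multiset.mem_filter.mp ht).2.2
    · intro h
      obtain ⟨t, ht, h1, h2⟩ := h Set.right_mem_uIcc
      exact ⟨t, Multiset.mem_filter.mpr ⟨ht, h1, by rw [h2]; exact h⟩, h2⟩
  have hcc : c ∈ Set.ordConnectedComponent {m | F.HasTypeI m} c := by
    rw [Set.mem_ordConnectedComponent]
    intro m hm
    rw [Set.uIcc_self, Set.mem_singleton_iff] at hm
    rw [hm]; exact hc
  refine ⟨⟨Multiset.filter_le _ _, fun h => ?_, fun t ht => (Multiset.mem_filter.mp ht).2.1, ?_⟩, ?_⟩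
  · rw [← hset, h] at hcc
    simp at hcc
  · rw [hset]; infer_instance
  -- Maximality: a larger consecutive collection still has a term of scale 2^c, so by convexity each
  -- of its scales is joined to c through type I scales.
  · rintro C ⟨hC, -, hI, hord⟩ hle
    refine Multiset.le_filter.mpr ⟨hC, fun t ht => ⟨hI t ht, fun m hm => ?_⟩⟩
    rw [← hset] at hcc
    obtain ⟨u, hu, rfl⟩ := hcc
    obtain ⟨v, hv, rfl⟩ := hord.uIcc_subset ⟨u, Multiset.mem_of_le hle hu, rfl⟩ ⟨t, ht, rfl⟩ hm
    exact ⟨v, Multiset.mem_of_le hC hv, hI v hv, rfl⟩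

theorem giverPermutation_of_swap {F F' : FineSymbol} {k k' : ℤ} {ε ε' : FineSign}
    {s s' : FineSubscript} {A S : Multiset FineTerm}
    (hC : F.IsCompartment (typeI k ε s ::ₘ typeI k' ε' s' ::ₘ A))
    (hF : F.terms = (typeI k ε s ::ₘ typeI k' ε' s' ::ₘ A) + S)
    (hF' : F'.terms = (typeI k ε s' ::ₘ typeI k' ε' s ::ₘ A) + S) : F.GiverPermutation F' := by
  induction A using Quotient.inductionOn with | _ l
  have hl : ∀ t ∈ l, typeI t.logScale t.sign t.subscript = t := fun t ht =>
    eq_typeI_of_isTypeI (hC.prop.2.2.1 t (by simp [ht]))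
  let κ : Fin (l.length + 2) → ℤ := Fin.cons k (Fin.cons k' fun i => (l.get i).logScale)
  let δ : Fin (l.length + 2) → FineSign := Fin.cons ε (Fin.cons ε' fun i => (l.get i).sign)
  let τ : Fin (l.length + 2) → FineSubscript := Fin.cons s (Fin.cons s' fun i => (l.get i).subscript)
  have hfin : (List.ofFn fun i : Fin l.length =>
      typeI (l.get i).logScale (l.get i).sign (l.get i).subscript) = l := by
    have h1 : (fun i : Fin l.length =>
      typeI (l.get i).logScale (l.get i).sign (l.get i).subscript) = l.get :=
      funext fun i => hl _ (l.get_mem i)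
    rw [h1, List.ofFn_get]
  have e1 : (Finset.univ.val.map fun i => typeI (κ i) (δ i) (τ i)) =
      (typeI k ε s ::ₘ typeI k' ε' s' ::ₘ (l : Multiset FineTerm)) := by
    rw [Fin.univ_val_map, List.ofFn_succ, List.ofFn_succ]
    exact congrArg (fun l : List FineTerm => ((typeI k ε s :: typeI k' ε' s' :: l : List _) : Multiset FineTerm)) hfin
  have e2 : (Finset.univ.val.map fun i => typeI (κ i) (δ i) (τ (Equiv.swap 0 1 i))) =
      (typeI k ε s' ::ₘ typeI k' ε' s ::ₘ (l : Multiset FineTerm)) := by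
    rw [Fin.univ_val_map, List.ofFn_succ, List.ofFn_succ]
    have h2 : ∀ i : Fin l.length, Equiv.swap (0 : Fin (l.length + 2)) 1 i.succ.succ = i.succ.succ :=
      fun i => Equiv.swap_apply_of_ne_of_ne (by simp [Fin.ext_iff]) (by simp [Fin.ext_iff])
    simp only [Equiv.swap_apply_left, h2]
    have h3 : Equiv.swap (0 : Fin (l.length + 2)) 1 (Fin.succ 0) = 0 := Equiv.swap_apply_right _ _
    rw [h3]
    exact congrArg (fun l : List FineTerm => ((typeI k ε s' :: typeI k' ε' s :: l : List _) : Multiset FineTerm)) hfin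
  exact ⟨_, κ, δ, τ, Equiv.swap 0 1, S, by rw [e1]; exact hC, by rw [e1]; exact hF,
    by rw [e2]; exact hF'⟩

/-- Isometric lattices, and symbols related by operations. -/
def Equivalent (F F' : FineSymbol) : Prop :=
  F.lattice.Isometric F'.lattice ∧ F.Related F'

theorem Equivalent.refl (F : FineSymbol) : F.Equivalent F :=
  ⟨.refl _, .refl⟩

theorem Equivalent.trans {F G H : FineSymbol} (h : F.Equivalent G) (h' : G.Equivalent H) :
    F.Equivalent H :=
  ⟨h.1.trans h'.1, Relation.ReflTransGen.trans h.2 h'.2⟩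

theorem SignWalk.equivalent {F F' : FineSymbol} (h : F.SignWalk F') : F.Equivalent F' :=
  ⟨h.isometric, .single (.inl h)⟩

theorem hasTypeI_of_mem {F : FineSymbol} {k : ℤ} {ε : FineSign} {s : FineSubscript}
    (h : typeI k ε s ∈ F.terms) : F.HasTypeI k :=
  ⟨_, h, trivial, rfl⟩

theorem conn_self {F : FineSymbol} {k : ℤ} (h : F.HasTypeI k) : F.Conn k k := by
  intro m hm
  rw [Set.uIcc_self, Set.mem_singleton_iff] at hm
  rwa [hm]

/-- Connected scales lie in one compartment, so the exchange is a single giver permutation whatever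
the distance; that it is an isometry is known at first only for equal or adjacent scales. -/
theorem giverPermutation_of_conn {F F' : FineSymbol} {k k' : ℤ} {ε ε' : FineSign}
    {s s' : FineSubscript} {S : Multiset FineTerm} (hconn : F.Conn k k')
    (hF : F.terms = typeI k ε s ::ₘ typeI k' ε' s' ::ₘ S)
    (hF' : F'.terms = typeI k ε s' ::ₘ typeI k' ε' s ::ₘ S) : F.GiverPermutation F' := by
  classical
  have hk : F.HasTypeI k := hconn k Set.left_mem_uIcc
  have hC := F.isCompartment_filter hk
  have h1 : (typeI k ε s).IsTypeI ∧ F.Conn k (typeI k ε s).logScale := ⟨trivial, conn_self hk⟩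
  have h2 : (typeI k' ε' s').IsTypeI ∧ F.Conn k (typeI k' ε' s').logScale := ⟨trivial, hconn⟩
  rw [hF, Multiset.filter_cons_of_pos (p := fun t : FineTerm => t.IsTypeI ∧ F.Conn k t.logScale) _ h1,
    Multiset.filter_cons_of_pos (p := fun t : FineTerm => t.IsTypeI ∧ F.Conn k t.logScale) _ h2] at hC
  refine giverPermutation_of_swap (S := S.filter fun t => ¬ (t.IsTypeI ∧ F.Conn k t.logScale)) hC ?_ ?_
  · rw [Multiset.cons_add, Multiset.cons_add, Multiset.filter_add_not, hF]
  · rw [Multiset.cons_add, Multiset.cons_add, Multiset.filter_add_not, hF']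

theorem equivalent_swap_of_isometric {F F' : FineSymbol} {k k' : ℤ} {ε ε' : FineSign}
    {s s' : FineSubscript} {S : Multiset FineTerm} (hk : k' = k ∨ k' = k + 1)
    (hF : F.terms = typeI k ε s ::ₘ typeI k' ε' s' ::ₘ S)
    (hF' : F'.terms = typeI k ε s' ::ₘ typeI k' ε' s ::ₘ S) : F.Equivalent F' := by
  have h1 : F.HasTypeI k := hasTypeI_of_mem (ε := ε) (s := s) (by rw [hF]; simp)
  have h2 : F.HasTypeI k' := hasTypeI_of_mem (ε := ε') (s := s') (by rw [hF]; simp)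
  refine ⟨isometric_of_pair hF hF' ?_, .single (.inr (.inl (giverPermutation_of_conn ?_ hF hF')))⟩
  · rcases hk with rfl | rfl
    · exact typeI_osum_typeI_swap_same _ ε ε' s s'
    · exact typeI_osum_typeI_swap k ε ε' s s'
  · intro m hm
    rw [Set.uIcc_of_le (by omega)] at hm
    have hm' : m = k ∨ m = k' := by have := hm.1; have := hm.2; omega
    rcases hm' with rfl | rfl <;> assumption

theorem equivalent_convert {F F' : FineSymbol} {k : ℤ} {ε₁ ε₂ ε₃ ε₄ : FineSign}
    {s : FineSubscript} {S : Multiset FineTerm}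
    (hF : F.terms = typeI k ε₁ s ::ₘ typeI k ε₂ s ::ₘ typeI k ε₃ s ::ₘ typeI k ε₄ s ::ₘ S)
    (hF' : F'.terms = typeI k ε₁ s.swap ::ₘ typeI k ε₂ s.swap ::ₘ typeI k ε₃ s.swap ::ₘ
      typeI k ε₄ s.swap ::ₘ S) : F.Equivalent F' := by
  classical
  refine ⟨isometric_of_quadruple hF hF' ?_, .single (.inr (.inr ?_))⟩
  · cases s
    · exact typeI_four_givers k ε₁ ε₂ ε₃ ε₄
    · exact (typeI_four_givers k ε₁ ε₂ ε₃ ε₄).symm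
  · have hk : F.HasTypeI k := hasTypeI_of_mem (ε := ε₁) (s := s) (by rw [hF]; simp)
    refine ⟨_, typeI k ε₁ s ::ₘ typeI k ε₂ s ::ₘ typeI k ε₃ s ::ₘ typeI k ε₄ s ::ₘ 0, S,
      F.isCompartment_filter hk, ?_, rfl, ?_, ?_, ?_⟩
    · refine Multiset.le_filter.mpr ⟨?_, ?_⟩
      · rw [hF]
        simp
      · intro t ht
        simp only [Multiset.mem_cons, Multiset.notMem_zero, or_false] at ht
        rcases ht with rfl | rfl | rfl | rfl <;> exact ⟨trivial, conn_self hk⟩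
    · cases s
      · left; simp [IsGiver]
      · right; simp [IsReceiver]
    · rw [hF]; simp
    · rw [hF']; simp [swapSubscript]

end FineSymbol

/-! ### Symbols of a fixed shape: signs and subscripts as functions on an index set -/

namespace FineTerm

/-- The term with a given scale, type, sign and subscript (which is ignored in type II). -/
def mk' (k : ℤ) (b : Bool) (ε : FineSign) (s : FineSubscript) : FineTerm :=
  match b with
  | true => typeI k ε s
  | false => typeII k ε

theorem mk'_logScale (k : ℤ) (b : Bool) (ε : FineSign) (s : FineSubscript) :
    (mk' k b ε s).logScale = k := by cases b <;> rfl

theorem mk'_isTypeI (k : ℤ) (b : Bool) (ε : FineSign) (s : FineSubscript) :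
    (mk' k b ε s).IsTypeI ↔ b = true := by cases b <;> simp [mk', IsTypeI]

theorem mk'_negSign (k : ℤ) (b : Bool) (ε : FineSign) (s : FineSubscript) :
    (mk' k b ε s).negSign = mk' k b ε.neg s := by cases b <;> rfl

theorem mk'_swapSubscript (k : ℤ) (b : Bool) (ε : FineSign) (s : FineSubscript) :
    (mk' k b ε s).swapSubscript = mk' k b ε s.swap := by cases b <;> rfl

end FineTerm

/-- Scales and types for an indexed family of terms. -/
structure ScaleShape (ι : Type) where
  scale : ι → ℤ
  isI : ι → Bool
  same : ∀ i j, scale i = scale j → isI i = isI j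

namespace ScaleShape

open FineTerm FineSymbol

set_option linter.unusedSectionVars false

variable {ι : Type} [Fintype ι] [DecidableEq ι] (C : ScaleShape ι)

/-- The terms of a symbol of given shape. -/
def term (ε : ι → FineSign) (s : ι → FineSubscript) (i : ι) : FineTerm :=
  mk' (C.scale i) (C.isI i) (ε i) (s i)

/-- The fine symbol with given shape, signs and subscripts. -/
def symbol (ε : ι → FineSign) (s : ι → FineSubscript) : FineSymbol where
  terms := Finset.univ.val.map (C.term ε s)
  same_type := by
    intro t ht u hu h
    obtain ⟨i, -, rfl⟩ := Multiset.mem_map.mp ht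
    obtain ⟨j, -, rfl⟩ := Multiset.mem_map.mp hu
    simp only [term, mk'_logScale, mk'_isTypeI] at h ⊢
    rw [C.same i j h]

/-- The scale `2 ^ m` carries a type I term. -/
def HasI (m : ℤ) : Prop := ∃ i, C.isI i = true ∧ C.scale i = m

theorem symbol_hasTypeI (ε : ι → FineSign) (s : ι → FineSubscript) (m : ℤ) :
    (C.symbol ε s).HasTypeI m ↔ C.HasI m := by
  constructor
  · rintro ⟨t, ht, h1, h2⟩
    obtain ⟨i, -, rfl⟩ := Multiset.mem_map.mp ht
    simp only [term, mk'_logScale, mk'_isTypeI] at h1 h2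
    exact ⟨i, h1, h2⟩
  · rintro ⟨i, h1, h2⟩
    refine ⟨C.term ε s i, Multiset.mem_map_of_mem _ (Finset.mem_univ_val i), ?_, ?_⟩
    · simpa [term, mk'_isTypeI] using h1
    · simpa [term, mk'_logScale] using h2

/-- All scales between `2 ^ a` and `2 ^ b` carry terms of type I. -/
def Conn (a b : ℤ) : Prop := ∀ m ∈ Set.uIcc a b, C.HasI m

theorem exists_pair_decomposition {ε ε₁ : ι → FineSign} {s s₁ : ι → FineSubscript} {i j : ι}
    (hij : i ≠ j) (h : ∀ x, x ≠ i → x ≠ j → ε₁ x = ε x ∧ s₁ x = s x) :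
    ∃ S, (C.symbol ε s).terms = C.term ε s i ::ₘ C.term ε s j ::ₘ S ∧
      (C.symbol ε₁ s₁).terms = C.term ε₁ s₁ i ::ₘ C.term ε₁ s₁ j ::ₘ S := by
  have h1 : (Finset.univ : Finset ι).val = i ::ₘ j ::ₘ ((Finset.univ.erase i).erase j).val := by
    rw [Finset.erase_val, Multiset.cons_erase, Finset.erase_val,
      Multiset.cons_erase (Finset.mem_univ_val _)]
    exact Finset.mem_erase.mpr ⟨hij.symm, Finset.mem_univ _⟩
  refine ⟨((Finset.univ.erase i).erase j).val.map (C.term ε s), ?_, ?_⟩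
  · simp only [symbol]; rw [h1, Multiset.map_cons, Multiset.map_cons]
  · simp only [symbol]; rw [h1, Multiset.map_cons, Multiset.map_cons]
    congr 2
    refine Multiset.map_congr rfl fun x hx => ?_
    have hx' := Finset.mem_erase.mp hx
    obtain ⟨e1, e2⟩ := h x (Finset.mem_erase.mp hx'.2).1 hx'.1
    rw [term, term, e1, e2]

/-- Negate the signs at two indices. -/
def flip (i j : ι) (ε : ι → FineSign) (x : ι) : FineSign :=
  if x = i ∨ x = j then (ε x).neg else ε x

/-- Exchange givers and receivers on a set of indices. -/
def convert (A : Finset ι) (s : ι → FineSubscript) (x : ι) : FineSubscript :=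
  if x ∈ A then (s x).swap else s x

theorem flip_flip (i j : ι) (ε : ι → FineSign) : flip i j (flip i j ε) = ε := by
  funext x
  by_cases h : x = i ∨ x = j <;> simp [flip, h, FineSign.neg_neg]

theorem term_flip_of_mem {i j x : ι} (hx : x = i ∨ x = j) (ε : ι → FineSign)
    (s : ι → FineSubscript) : C.term (flip i j ε) s x = (C.term ε s x).negSign := by
  rw [term, term, mk'_negSign, flip, if_pos hx]

theorem term_flip_convert_of_mem {i j x : ι} (hx : x = i ∨ x = j) (ε : ι → FineSign)
    (s : ι → FineSubscript) :
    C.term (flip i j ε) (convert {i, j} s) x = (C.term ε s x).negSign.swapSubscript := by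
  rw [term, term, mk'_negSign, mk'_swapSubscript, flip, if_pos hx, convert, if_pos (by simpa using hx)]

theorem flip_apply_of_ne {i j x : ι} (hi : x ≠ i) (hj : x ≠ j) (ε : ι → FineSign) :
    flip i j ε x = ε x := by simp [flip, hi, hj]

theorem equivalent_flip_same {i j : ι} (hij : i ≠ j) (h : C.scale i = C.scale j) (ε : ι → FineSign)
    (s : ι → FineSubscript) : (C.symbol ε s).Equivalent (C.symbol (flip i j ε) s) := by
  obtain ⟨S, h1, h2⟩ := C.exists_pair_decomposition (ε := ε) (ε₁ := flip i j ε) (s := s) (s₁ := s)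
    hij fun x hi hj => ⟨flip_apply_of_ne hi hj ε, rfl⟩
  rw [term_flip_of_mem _ (.inl rfl), term_flip_of_mem _ (.inr rfl)] at h2
  exact SignWalk.equivalent (.sameScale _ _ S (by simpa [term, mk'_logScale] using h) h1 h2)

theorem equivalent_flip_adjacent {i j : ι} (h : C.scale j = C.scale i + 1)
    (ht : C.isI i ≠ C.isI j) (ε : ι → FineSign)
    (s : ι → FineSubscript) : (C.symbol ε s).Equivalent (C.symbol (flip i j ε) s) := by
  have hij : i ≠ j := by rintro rfl; omega
  obtain ⟨S, h1, h2⟩ := C.exists_pair_decomposition (ε := ε) (ε₁ := flip i j ε) (s := s) (s₁ := s)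
    hij fun x hi hj => ⟨flip_apply_of_ne hi hj ε, rfl⟩
  rw [term_flip_of_mem _ (.inl rfl), term_flip_of_mem _ (.inr rfl)] at h2
  refine SignWalk.equivalent (.adjacentDifferentTypes _ _ S (.inr ?_) ?_ h1 h2)
  · simpa [term, mk'_logScale] using h
  · simp only [term, mk'_isTypeI]
    intro h; exact ht (Bool.eq_iff_iff.mpr h)

theorem equivalent_flip_four {i j : ι} (h : C.scale j = C.scale i + 2)
    (hi : C.isI i = true) (hj : C.isI j = true) (ε : ι → FineSign)
    (s : ι → FineSubscript) : (C.symbol ε s).Equivalent (C.symbol (flip i j ε) s) := by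
  have hij : i ≠ j := by rintro rfl; omega
  obtain ⟨S, h1, h2⟩ := C.exists_pair_decomposition (ε := ε) (ε₁ := flip i j ε) (s := s) (s₁ := s)
    hij fun x hi hj => ⟨flip_apply_of_ne hi hj ε, rfl⟩
  rw [term_flip_of_mem _ (.inl rfl), term_flip_of_mem _ (.inr rfl)] at h2
  refine SignWalk.equivalent (.differByFour _ _ S (.inr ?_) ?_ h1 h2)
  · simpa [term, mk'_logScale] using h
  · simp only [term, mk'_isTypeI]
    exact ⟨hi, hj⟩

theorem equivalent_flip_convert {i j : ι} (h : C.scale j = C.scale i + 1)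
    (hi : C.isI i = true) (hj : C.isI j = true) (ε : ι → FineSign)
    (s : ι → FineSubscript) (hs : s i = s j) :
    (C.symbol ε s).Equivalent (C.symbol (flip i j ε) (convert {i, j} s)) := by
  have hij : i ≠ j := by rintro rfl; omega
  obtain ⟨S, h1, h2⟩ := C.exists_pair_decomposition (ε := ε) (ε₁ := flip i j ε) (s := s)
    (s₁ := convert {i, j} s) hij fun x hi hj => ⟨flip_apply_of_ne hi hj ε, by simp [convert, hi, hj]⟩
  rw [term_flip_convert_of_mem _ (.inl rfl), term_flip_convert_of_mem _ (.inr rfl)] at h2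
  refine SignWalk.equivalent (.adjacentSameStatus _ _ S (.inr ?_) ?_ h1 h2)
  · simpa [term, mk'_logScale] using h
  · simp only [term, hi, hj, mk', hs]
    cases s j <;> simp [IsGiver, IsReceiver]

theorem equivalent_swap_near {i j : ι} (hij : i ≠ j)
    (h : C.scale j = C.scale i ∨ C.scale j = C.scale i + 1)
    (hi : C.isI i = true) (hj : C.isI j = true) (ε : ι → FineSign)
    (s : ι → FineSubscript) : (C.symbol ε s).Equivalent (C.symbol ε (s ∘ Equiv.swap i j)) := by
  obtain ⟨S, h1, h2⟩ := C.exists_pair_decomposition (ε := ε) (ε₁ := ε) (s := s)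
    (s₁ := s ∘ Equiv.swap i j) hij fun x hi hj =>
      ⟨rfl, by simp [Equiv.swap_apply_of_ne_of_ne hi hj]⟩
  simp only [term, hi, hj, mk', Function.comp, Equiv.swap_apply_left, Equiv.swap_apply_right] at h1 h2
  exact equivalent_swap_of_isometric h h1 h2

/-- With l at the next scale, (i j) = (i l)(l j)(i l); thus distant exchanges are products of
exchanges at equal or adjacent scales, and inherit their isometries. -/
theorem equivalent_swap_of_le (n : ℕ) : ∀ {i j : ι}, i ≠ j → C.scale j = C.scale i + n →
    C.isI i = true → C.isI j = true → C.Conn (C.scale i) (C.scale j) → ∀ (ε : ι → FineSign)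
    (s : ι → FineSubscript), (C.symbol ε s).Equivalent (C.symbol ε (s ∘ Equiv.swap i j)) := by
  induction n with
  | zero =>
    intro i j hij h hi hj _ ε s
    exact C.equivalent_swap_near hij (.inl (by simpa using h)) hi hj ε s
  | succ n ih =>
    intro i j hij h hi hj hc ε s
    rcases Nat.eq_zero_or_pos n with rfl | hn
    · exact C.equivalent_swap_near hij (.inr (by simpa using h)) hi hj ε s
    push_cast at h
    obtain ⟨l, hl, hl'⟩ := hc (C.scale i + 1) (by rw [Set.uIcc_of_le (by omega)]; constructor <;> omega)
    have hil : i ≠ l := by rintro rfl; omega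
    have hlj : l ≠ j := by rintro rfl; omega
    have hc' : C.Conn (C.scale l) (C.scale j) := fun m hm => hc m (by
      rw [Set.uIcc_of_le (by omega)] at hm ⊢
      exact ⟨by have := hm.1; omega, hm.2⟩)
    have e1 := fun s => C.equivalent_swap_near hil (.inr hl') hi hl ε s
    have e2 := fun s => ih hlj (by omega) hl hj hc' ε s
    have := (e1 s).trans ((e2 _).trans (e1 _))
    have e3 : ((s ∘ Equiv.swap i l) ∘ Equiv.swap l j) ∘ Equiv.swap i l = s ∘ Equiv.swap i j := by
      funext x
      have h4 := Equiv.swap_mul_swap_mul_swap (x := j) (y := l) (z := i) hlj.symm hij.symm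
      have h5 := congrArg (fun p : Equiv.Perm ι => s (p x)) h4
      simp only [Equiv.Perm.mul_apply] at h5
      rw [Equiv.swap_comm l i, Equiv.swap_comm j l] at h5
      simpa [Function.comp] using h5
    rwa [e3] at this

theorem equivalent_swap {i j : ι} (hi : C.isI i = true) (hj : C.isI j = true)
    (hc : C.Conn (C.scale i) (C.scale j)) (ε : ι → FineSign) (s : ι → FineSubscript) :
    (C.symbol ε s).Equivalent (C.symbol ε (s ∘ Equiv.swap i j)) := by
  by_cases hij : i = j
  · subst hij
    rw [Equiv.swap_self]; exact .refl _
  rcases le_total (C.scale i) (C.scale j) with h | h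
  · exact C.equivalent_swap_of_le (C.scale j - C.scale i).toNat hij (by omega) hi hj hc ε s
  · rw [Equiv.swap_comm]
    refine C.equivalent_swap_of_le (C.scale i - C.scale j).toNat (Ne.symm hij) (by omega) hj hi ?_ ε s
    intro m hm
    exact hc m (by rwa [Set.uIcc_comm])

theorem Conn.symm {C : ScaleShape ι} {a b : ℤ} (h : C.Conn a b) : C.Conn b a := fun m hm =>
  h m (by rwa [Set.uIcc_comm])

theorem Conn.trans {C : ScaleShape ι} {a b c : ℤ} (h : C.Conn a b) (h' : C.Conn b c) :
    C.Conn a c := fun m hm => by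
  rcases Set.uIcc_subset_uIcc_union_uIcc hm with h1 | h1
  · exact h m h1
  · exact h' m h1

theorem equivalent_convert_same {a b c d : ι} (hab : a ≠ b) (hac : a ≠ c) (had : a ≠ d)
    (hbc : b ≠ c) (hbd : b ≠ d) (hcd : c ≠ d) (ha : C.isI a = true)
    (kb : C.scale b = C.scale a) (kc : C.scale c = C.scale a) (kd : C.scale d = C.scale a)
    (ε : ι → FineSign) (s : ι → FineSubscript) (sb : s b = s a) (sc : s c = s a) (sd : s d = s a) :
    (C.symbol ε s).Equivalent (C.symbol ε (convert {a, b, c, d} s)) := by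
  have hb := C.same b a kb
  have hc := C.same c a kc
  have hd := C.same d a kd
  rw [ha] at hb hc hd
  set U := (((Finset.univ.erase a).erase b).erase c).erase d with hU
  have h1 : (Finset.univ : Finset ι).val = a ::ₘ b ::ₘ c ::ₘ d ::ₘ U.val := by
    rw [hU, Finset.erase_val, Multiset.cons_erase, Finset.erase_val, Multiset.cons_erase,
      Finset.erase_val, Multiset.cons_erase, Finset.erase_val,
      Multiset.cons_erase (Finset.mem_univ_val _)]
    · show b ∈ Finset.univ.erase a
      simp [hab.symm]
    · show c ∈ (Finset.univ.erase a).erase b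
      simp [hbc.symm, hac.symm]
    · show d ∈ ((Finset.univ.erase a).erase b).erase c
      simp [hcd.symm, hbd.symm, had.symm]
  refine equivalent_convert (k := C.scale a) (s := s a) (ε₁ := ε a) (ε₂ := ε b) (ε₃ := ε c)
    (ε₄ := ε d) (S := U.val.map (C.term ε s)) ?_ ?_
  · simp only [symbol]
    rw [h1]
    simp only [Multiset.map_cons, term, mk', ha, hb, hc, hd, kb, kc, kd, sb, sc, sd]
  · simp only [symbol]
    rw [h1]
    simp only [Multiset.map_cons, term, mk', ha, hb, hc, hd, kb, kc, kd]
    have e : ∀ x ∈ ({a, b, c, d} : Finset ι), convert {a, b, c, d} s x = (s a).swap := by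
      intro x hx
      rw [convert, if_pos hx]
      simp only [Finset.mem_insert, Finset.mem_singleton] at hx
      rcases hx with rfl | rfl | rfl | rfl
      · rfl
      · rw [sb]
      · rw [sc]
      · rw [sd]
    rw [e a (by simp), e b (by simp), e c (by simp), e d (by simp)]
    congr 4
    refine Multiset.map_congr rfl fun x hx => ?_
    have hx' : x ∉ ({a, b, c, d} : Finset ι) := by
      have hx : x ∈ U := hx
      simp only [hU, Finset.mem_erase] at hx
      simp only [Finset.mem_insert, Finset.mem_singleton]
      tauto
    have hc : convert {a, b, c, d} s x = s x := if_neg hx'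
    rw [term, hc, term]

/-- Walk signs between i and j, which converts both; exchange their subscripts with those of p and
q; then walk again. The signs return, and all four subscripts have been converted. -/
theorem equivalent_convert_adjacent {i j p q : ι} (hij : C.scale j = C.scale i + 1)
    (hip : i ≠ p) (hiq : i ≠ q) (hjp : j ≠ p) (hjq : j ≠ q) (hpq : p ≠ q)
    (hi : C.isI i = true) (hj : C.isI j = true) (hp : C.isI p = true) (hq : C.isI q = true)
    (cp : C.Conn (C.scale i) (C.scale p)) (cq : C.Conn (C.scale j) (C.scale q))
    (ε : ι → FineSign) (s : ι → FineSubscript) (sj : s j = s i) (sp : s p = s i) (sq : s q = s i) :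
    (C.symbol ε s).Equivalent (C.symbol ε (convert {i, j, p, q} s)) := by
  have hne : i ≠ j := by rintro rfl; omega
  have e1 := C.equivalent_flip_convert hij hi hj ε s sj.symm
  have e2 := C.equivalent_swap hi hp cp (flip i j ε) (convert {i, j} s)
  have e3 := C.equivalent_swap hj hq cq (flip i j ε) (convert {i, j} s ∘ Equiv.swap i p)
  have hsi : ((convert {i, j} s ∘ Equiv.swap i p) ∘ Equiv.swap j q) i = s i := by
    simp [Equiv.swap_apply_of_ne_of_ne hne hiq, convert, hip.symm, hjp.symm, sp]
  have hsj : ((convert {i, j} s ∘ Equiv.swap i p) ∘ Equiv.swap j q) j = s i := by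
    simp [Equiv.swap_apply_of_ne_of_ne hiq.symm hpq.symm, convert, hiq.symm, hjq.symm, sq]
  have e4 := C.equivalent_flip_convert hij hi hj (flip i j ε)
    ((convert {i, j} s ∘ Equiv.swap i p) ∘ Equiv.swap j q) (hsi.trans hsj.symm)
  have e5 := e1.trans (e2.trans (e3.trans e4))
  rw [flip_flip] at e5
  convert e5 using 2
  funext x
  by_cases h1 : x = i
  · subst h1
    rw [convert, convert, if_pos (by simp), if_pos (by simp), hsi]
  by_cases h2 : x = j
  · subst h2
    rw [convert, convert, if_pos (by simp), if_pos (by simp), hsj, sj]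
  have h12 : x ∉ ({i, j} : Finset ι) := by simp [h1, h2]
  rw [convert, convert, if_neg h12]
  by_cases h3 : x = p
  · subst h3
    simp [Equiv.swap_apply_of_ne_of_ne h2 hpq, convert, sp]
  by_cases h4 : x = q
  · subst h4
    simp [Equiv.swap_apply_of_ne_of_ne (Ne.symm hne) hjp, convert, sq, sj]
  simp [Equiv.swap_apply_of_ne_of_ne h2 h4, Equiv.swap_apply_of_ne_of_ne h1 h3, convert, h1, h2, h3, h4]

theorem equivalent_convert_near {i j p q : ι}
    (hij : C.scale j = C.scale i + 1 ∨ C.scale i = C.scale j + 1)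
    (hip : i ≠ p) (hiq : i ≠ q) (hjp : j ≠ p) (hjq : j ≠ q) (hpq : p ≠ q)
    (hi : C.isI i = true) (hj : C.isI j = true) (hp : C.isI p = true) (hq : C.isI q = true)
    (cj : C.Conn (C.scale i) (C.scale j))
    (cp : C.Conn (C.scale i) (C.scale p)) (cq : C.Conn (C.scale i) (C.scale q))
    (ε : ι → FineSign) (s : ι → FineSubscript) (sj : s j = s i) (sp : s p = s i) (sq : s q = s i) :
    (C.symbol ε s).Equivalent (C.symbol ε (convert {i, j, p, q} s)) := by
  rcases hij with hij | hij
  · exact C.equivalent_convert_adjacent hij hip hiq hjp hjq hpq hi hj hp hq cp (cj.symm.trans cq)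
      ε s sj sp sq
  · rw [Finset.insert_comm]
    exact C.equivalent_convert_adjacent hij hjp hjq hip hiq hpq hj hi hp hq (cj.symm.trans cp) cq
      ε s sj.symm (sp.trans sj.symm) (sq.trans sj.symm)

/-- Conversion of four equal subscripts within a compartment. -/
theorem equivalent_convert_four {a : ι} {A : Finset ι} (haA : a ∈ A) (hA : A.card = 4)
    (hI : ∀ x ∈ A, C.isI x = true) (hc : ∀ x ∈ A, C.Conn (C.scale a) (C.scale x))
    (ε : ι → FineSign) (s : ι → FineSubscript) (hs : ∀ x ∈ A, s x = s a) :
    (C.symbol ε s).Equivalent (C.symbol ε (convert A s)) := by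
  have card_pair : ∀ b ∈ A, b ≠ a → ∃ p q, p ≠ q ∧ p ≠ a ∧ p ≠ b ∧ q ≠ a ∧ q ≠ b ∧
      A = {a, b, p, q} := by
    intro b hb hba
    have h2 : ((A.erase a).erase b).card = 2 := by
      rw [Finset.card_erase_of_mem (Finset.mem_erase.mpr ⟨hba, hb⟩), Finset.card_erase_of_mem haA, hA]
    obtain ⟨p, q, hpq, h3⟩ := Finset.card_eq_two.mp h2
    have hp : p ∈ (A.erase a).erase b := by rw [h3]; simp
    have hq : q ∈ (A.erase a).erase b := by rw [h3]; simp
    simp only [Finset.mem_erase] at hp hq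
    refine ⟨p, q, hpq, hp.2.1, hp.1, hq.2.1, hq.1, ?_⟩
    rw [← h3, Finset.insert_erase (Finset.mem_erase.mpr ⟨hba, hb⟩), Finset.insert_erase haA]
  by_cases hall : ∀ x ∈ A, C.scale x = C.scale a
  · obtain ⟨b, hb, hba⟩ : ∃ b ∈ A, b ≠ a := Finset.exists_mem_ne (by omega) a
    obtain ⟨p, q, hpq, hpa, hpb, hqa, hqb, rfl⟩ := card_pair b hb hba
    exact C.equivalent_convert_same hba.symm hpa.symm hqa.symm hpb.symm hqb.symm hpq (hI _ (by simp))
      (hall _ (by simp)) (hall _ (by simp)) (hall _ (by simp)) ε s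
      (hs _ (by simp)) (hs _ (by simp)) (hs _ (by simp))
  -- Not all four scales agree, so the compartment contains a term l at a scale adjacent to that of
  -- a, possibly outside A.
  push Not at hall
  obtain ⟨x, hx, hxa⟩ := hall
  obtain ⟨l, hl, hla, hlc⟩ : ∃ l, C.isI l = true ∧
      (C.scale l = C.scale a + 1 ∨ C.scale a = C.scale l + 1) ∧ C.Conn (C.scale a) (C.scale l) := by
    have hcx := hc x hx
    rcases lt_or_gt_of_ne hxa with h | h
    · obtain ⟨l, hl, hl'⟩ := hcx (C.scale a - 1)
        (by rw [Set.uIcc_of_ge h.le]; constructor <;> omega)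
      refine ⟨l, hl, .inr (by omega), fun m hm => hcx m ?_⟩
      rw [Set.uIcc_of_ge (by omega)] at hm ⊢
      exact ⟨by have := hm.1; omega, hm.2⟩
    · obtain ⟨l, hl, hl'⟩ := hcx (C.scale a + 1)
        (by rw [Set.uIcc_of_le h.le]; constructor <;> omega)
      refine ⟨l, hl, .inl (by omega), fun m hm => hcx m ?_⟩
      rw [Set.uIcc_of_le (by omega)] at hm ⊢
      exact ⟨hm.1, by have := hm.2; omega⟩
  have hne : l ≠ a := by rintro rfl; omega
  by_cases hlA : l ∈ A
  · obtain ⟨p, q, hpq, hpa, hpb, hqa, hqb, rfl⟩ := card_pair l hlA hne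
    exact C.equivalent_convert_near hla hpa.symm hqa.symm hpb.symm hqb.symm hpq (hI _ haA) hl
      (hI _ (by simp)) (hI _ (by simp)) hlc (hc _ (by simp)) (hc _ (by simp)) ε s
      (hs _ hlA) (hs _ (by simp)) (hs _ (by simp))
  -- Let l stand in for some b: exchange their subscripts, convert A with b replaced by l, and
  -- exchange back.
  · obtain ⟨b, hb, hba⟩ : ∃ b ∈ A, b ≠ a := Finset.exists_mem_ne (by omega) a
    obtain ⟨p, q, hpq, hpa, hpb, hqa, hqb, rfl⟩ := card_pair b hb hba
    have hlb : l ≠ b := fun h => hlA (h ▸ hb)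
    have hlp : l ≠ p := fun h => hlA (by simp [h])
    have hlq : l ≠ q := fun h => hlA (by simp [h])
    have cbl : C.Conn (C.scale b) (C.scale l) := (hc b hb).symm.trans hlc
    have e1 := C.equivalent_swap (hI b hb) hl cbl ε s
    have ea : (s ∘ Equiv.swap b l) a = s a := by
      simp [Equiv.swap_apply_of_ne_of_ne hba.symm hne.symm]
    have ep : (s ∘ Equiv.swap b l) p = s a := by
      simp [Equiv.swap_apply_of_ne_of_ne hpb hlp.symm, hs p]
    have eq' : (s ∘ Equiv.swap b l) q = s a := by
      simp [Equiv.swap_apply_of_ne_of_ne hqb hlq.symm, hs q]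
    have el : (s ∘ Equiv.swap b l) l = s a := by simp [hs b]
    have e2 := C.equivalent_convert_near hla hpa.symm hqa.symm hlp hlq hpq (hI _ haA) hl
      (hI _ (by simp)) (hI _ (by simp)) hlc (hc _ (by simp)) (hc _ (by simp)) ε (s ∘ Equiv.swap b l)
      (el.trans ea.symm) (ep.trans ea.symm) (eq'.trans ea.symm)
    have e3 := C.equivalent_swap (hI b hb) hl cbl ε (convert {a, l, p, q} (s ∘ Equiv.swap b l))
    have e4 := e1.trans (e2.trans e3)
    convert e4 using 2
    funext y
    by_cases h1 : y = b
    · subst h1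
      simp [convert, hs y]
    by_cases h2 : y = l
    · subst h2
      simp [convert, hne, hlb, hlp, hlq, hba, hpb.symm, hqb.symm, hlb.symm]
    · simp [convert, Equiv.swap_apply_of_ne_of_ne h1 h2, h1, h2]

/-! ### Comparison of phases and agreement of signs -/

theorem phase_term (ε : ι → FineSign) (s : ι → FineSubscript) (m : ℤ) (i : ι) :
    phase m (C.term ε s i) = if C.scale i < m then
      (if C.isI i = true then (s i).beta + ((m - C.scale i + 1 : ℤ) : ZMod 8) * (ε i).four
        else ((m - C.scale i : ℤ) : ZMod 8) * (ε i).four) else 0 := by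
  cases h : C.isI i <;> simp [phase, term, mk', h, logScale]

theorem phase_term_of_lt (ε : ι → FineSign) (s : ι → FineSubscript) {m : ℤ} {i : ι}
    (h : C.scale i < m) : phase m (C.term ε s i) =
      if C.isI i = true then (s i).beta + ((m - C.scale i + 1 : ℤ) : ZMod 8) * (ε i).four
        else ((m - C.scale i : ℤ) : ZMod 8) * (ε i).four := by
  rw [phase_term, if_pos h]

theorem phase_term_of_le (ε : ι → FineSign) (s : ι → FineSubscript) {m : ℤ} {i : ι}
    (h : m ≤ C.scale i) : phase m (C.term ε s i) = 0 := by
  rw [phase_term, if_neg (not_lt.mpr h)]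

theorem totalPhase_symbol (ε : ι → FineSign) (s : ι → FineSubscript) (m : ℤ) :
    (C.symbol ε s).totalPhase m = ∑ i, phase m (C.term ε s i) := by
  rw [totalPhase, symbol, Multiset.map_map]; rfl

/-- Two choices of signs and subscripts have the same Gauss sum phases. -/
def PhaseEq (ε : ι → FineSign) (s : ι → FineSubscript) (ε' : ι → FineSign)
    (s' : ι → FineSubscript) : Prop :=
  ∀ m, ¬ C.HasI m → (C.symbol ε s).totalPhase m = (C.symbol ε' s').totalPhase m

theorem PhaseEq.of_equivalent {C : ScaleShape ι} {ε ε₁ ε' : ι → FineSign}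
    {s s₁ s' : ι → FineSubscript} (h : C.PhaseEq ε s ε' s')
    (e : (C.symbol ε s).Equivalent (C.symbol ε₁ s₁)) : C.PhaseEq ε₁ s₁ ε' s' := fun m hm => by
  rw [← h m hm, totalPhase_eq_of_isometric e.1 (by rwa [C.symbol_hasTypeI])]

/-- Four times the number of sign disagreements up to scale `2 ^ c`. -/
def signDiff (ε ε' : ι → FineSign) (c : ℤ) : ZMod 8 :=
  ∑ i, if C.scale i ≤ c then (ε i).four - (ε' i).four else 0

theorem two_mul_signDiff (ε ε' : ι → FineSign) (c : ℤ) : 2 * C.signDiff ε ε' c = 0 := by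
  rw [signDiff, Finset.mul_sum]
  refine Finset.sum_eq_zero fun i _ => ?_
  split_ifs
  · rw [mul_sub, FineSign.two_mul_four, FineSign.two_mul_four, sub_zero]
  · simp

theorem signDiff_eq_four {ε ε' : ι → FineSign} {c : ℤ} (h : C.signDiff ε ε' c ≠ 0) :
    C.signDiff ε ε' c = 4 := by
  have h2 := C.two_mul_signDiff ε ε' c
  generalize C.signDiff ε ε' c = x at h h2
  revert x; decide

theorem signDiff_flip {i j : ι} (hij : C.scale i < C.scale j) (ε ε' : ι → FineSign) (c : ℤ) :
    C.signDiff (flip i j ε) ε' c = C.signDiff ε ε' c +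
      if C.scale i ≤ c ∧ c < C.scale j then 4 else 0 := by
  have hne : i ≠ j := by rintro rfl; omega
  have h1 : ∀ x, (if C.scale x ≤ c then (flip i j ε x).four - (ε' x).four else 0 : ZMod 8) =
      (if C.scale x ≤ c then (ε x).four - (ε' x).four else 0) +
      ((if x = i then (if C.scale i ≤ c then 4 else 0) else 0) +
        if x = j then (if C.scale j ≤ c then 4 else 0) else 0) := by
    intro x
    by_cases hi : x = i
    · subst hi
      simp only [flip, true_or, if_true, if_neg hne, FineSign.four_neg]
      split_ifs <;> ring
    by_cases hj : x = j
    · subst hj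
      simp only [flip, or_true, if_true, if_neg hi, FineSign.four_neg]
      split_ifs <;> ring
    · simp [flip, hi, hj]
  rw [signDiff, Finset.sum_congr rfl fun x _ => h1 x, Finset.sum_add_distrib, signDiff,
    Finset.sum_add_distrib, Finset.sum_ite_eq' _ i, Finset.sum_ite_eq' _ j]
  congr 1
  simp only [Finset.mem_univ, if_true]
  by_cases h2 : C.scale i ≤ c <;> by_cases h3 : C.scale j ≤ c
  · rw [if_pos h2, if_pos h3, if_neg (by omega)]; decide
  · rw [if_pos h2, if_neg h3, if_pos (by omega), add_zero]
  · omega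
  · rw [if_neg h2, if_neg h3, if_neg (by omega), add_zero]

theorem signDiff_eq_of_forall_ne (ε ε' : ι → FineSign) {c : ℤ} (h : ∀ i, C.scale i ≠ c + 1) :
    C.signDiff ε ε' (c + 1) = C.signDiff ε ε' c := by
  refine Finset.sum_congr rfl fun i _ => if_congr ?_ rfl rfl
  have := h i
  omega

/-- From m = c to m = c + 1 the coefficient of each sign at scales up to 2^c grows by one, while
subscripts contribute equally to both phases. The difference of phases therefore counts minus signs.
-/
theorem signDiff_eq_zero {ε ε' : ι → FineSign} {s s' : ι → FineSubscript}
    (h : C.PhaseEq ε s ε' s') {c : ℤ} (h1 : ¬ C.HasI c) (h2 : ¬ C.HasI (c + 1)) :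
    C.signDiff ε ε' c = 0 := by
  have e1 := h _ h1
  have e2 := h _ h2
  rw [totalPhase_symbol, totalPhase_symbol] at e1 e2
  have key : ∀ (ε : ι → FineSign) (s : ι → FineSubscript) (i : ι),
      phase (c + 1) (C.term ε s i) - phase c (C.term ε s i) =
      if C.scale i ≤ c then (ε i).four else 0 := by
    intro ε s i
    rcases lt_trichotomy (C.scale i) c with h3 | h3 | h3
    · rw [C.phase_term_of_lt ε s h3, C.phase_term_of_lt ε s (h3.trans (lt_add_one c)), if_pos h3.le]
      split_ifs <;> push_cast <;> ring
    · rw [C.phase_term_of_le ε s h3.ge, C.phase_term_of_lt ε s (h3.trans_lt (lt_add_one c)),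
        if_pos h3.le, if_neg fun h4 => h1 ⟨i, h4, h3⟩, h3]
      push_cast; ring
    · rw [C.phase_term_of_le ε s h3.le, C.phase_term_of_le ε s (show c + 1 ≤ C.scale i by omega),
        if_neg (not_le.mpr h3), sub_zero]
  have e3 : ∑ i, (phase (c + 1) (C.term ε s i) - phase c (C.term ε s i)) =
      ∑ i, (phase (c + 1) (C.term ε' s' i) - phase c (C.term ε' s' i)) := by
    rw [Finset.sum_sub_distrib, Finset.sum_sub_distrib, e1, e2]
  simp only [key] at e3
  rw [← sub_eq_zero, ← Finset.sum_sub_distrib] at e3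
  rw [← e3, signDiff]
  refine Finset.sum_congr rfl fun i _ => ?_
  split_ifs <;> simp

/-- The terms i and j form a whole compartment. Between the phases on its two sides, sign
coefficients change by an odd amount up to the scale of i and by 2 at j, and the two subscripts
enter once. -/
theorem signDiff_add_beta {ε ε' : ι → FineSign} {s s' : ι → FineSubscript}
    (h : C.PhaseEq ε s ε' s') {i j : ι} (hij : C.scale j = C.scale i + 1)
    (hi : C.isI i = true) (hj : C.isI j = true)
    (h1 : ¬ C.HasI (C.scale i - 1)) (h2 : ¬ C.HasI (C.scale i + 2))
    (h3 : ∀ x, x ≠ i → x ≠ j → C.scale x ≠ C.scale i ∧ C.scale x ≠ C.scale j) :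
    C.signDiff ε ε' (C.scale i) + (((s i).beta - (s' i).beta) + ((s j).beta - (s' j).beta)) = 0 := by
  have hne : i ≠ j := by rintro rfl; omega
  have e1 := h _ h1
  have e2 := h _ h2
  rw [totalPhase_symbol, totalPhase_symbol] at e1 e2
  have key : ∀ (ε : ι → FineSign) (s : ι → FineSubscript) (x : ι),
      phase (C.scale i + 2) (C.term ε s x) - phase (C.scale i - 1) (C.term ε s x) =
      (if C.scale x ≤ C.scale i then (ε x).four else 0) +
        ((if x = i then (s i).beta else 0) + if x = j then (s j).beta else 0) := by
    intro ε s x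
    have h4 := (ε x).two_mul_four
    by_cases hxi : x = i
    · subst hxi
      rw [C.phase_term_of_lt ε s (show C.scale x < C.scale x + 2 by omega),
        C.phase_term_of_le ε s (show C.scale x - 1 ≤ C.scale x by omega), if_pos le_rfl, if_pos hi,
        if_pos rfl, if_neg hne]
      push_cast; linear_combination h4
    by_cases hxj : x = j
    · subst hxj
      rw [C.phase_term_of_lt ε s (show C.scale x < C.scale i + 2 by omega),
        C.phase_term_of_le ε s (show C.scale i - 1 ≤ C.scale x by omega),
        if_neg (show ¬ C.scale x ≤ C.scale i by omega), if_pos hj, if_pos rfl, if_neg hxi, hij]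
      push_cast; linear_combination h4
    have h5 := h3 x hxi hxj
    rw [if_neg hxi, if_neg hxj, add_zero, add_zero]
    rcases lt_trichotomy (C.scale x) (C.scale i - 1) with h6 | h6 | h6
    · rw [C.phase_term_of_lt ε s (show C.scale x < C.scale i + 2 by omega),
        C.phase_term_of_lt ε s h6, if_pos (show C.scale x ≤ C.scale i by omega)]
      split_ifs <;> push_cast <;> linear_combination h4
    · rw [C.phase_term_of_lt ε s (show C.scale x < C.scale i + 2 by omega),
        C.phase_term_of_le ε s h6.ge, if_pos (show C.scale x ≤ C.scale i by omega),
        if_neg fun h7 => h1 ⟨x, h7, h6⟩, h6]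
      push_cast; linear_combination h4
    · rw [C.phase_term_of_le ε s (show C.scale i + 2 ≤ C.scale x by omega),
        C.phase_term_of_le ε s h6.le, if_neg (show ¬ C.scale x ≤ C.scale i by omega), sub_zero]
  have e3 : ∑ x, (phase (C.scale i + 2) (C.term ε s x) - phase (C.scale i - 1) (C.term ε s x)) =
      ∑ x, (phase (C.scale i + 2) (C.term ε' s' x) - phase (C.scale i - 1) (C.term ε' s' x)) := by
    rw [Finset.sum_sub_distrib, Finset.sum_sub_distrib, e1, e2]
  simp only [key, Finset.sum_add_distrib, Finset.sum_ite_eq', Finset.mem_univ, if_true] at e3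
  have e4 : C.signDiff ε ε' (C.scale i) = (∑ x, if C.scale x ≤ C.scale i then (ε x).four else 0) -
      ∑ x, if C.scale x ≤ C.scale i then (ε' x).four else 0 := by
    rw [← Finset.sum_sub_distrib, signDiff]
    refine Finset.sum_congr rfl fun i _ => ?_
    split_ifs <;> simp
  rw [e4]
  linear_combination e3

/-- The walk needs equal subscripts. A third term of the compartment can supply one by exchange. If
there is none, opposite subscripts at i and j have sum 0, and the phases would force 4 to be a sum
of two terms ±1 modulo 8. -/
theorem exists_equivalent_flip_of_adjacent {ε ε' : ι → FineSign} {s s' : ι → FineSubscript}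
    (h : C.PhaseEq ε s ε' s') {i j : ι} (hij : C.scale j = C.scale i + 1)
    (hi : C.isI i = true) (hj : C.isI j = true) (hD : C.signDiff ε ε' (C.scale i) ≠ 0) :
    ∃ s₁, (C.symbol ε s).Equivalent (C.symbol (flip i j ε) s₁) := by
  have hne : i ≠ j := by rintro rfl; omega
  by_cases hs : s i = s j
  · exact ⟨_, C.equivalent_flip_convert hij hi hj ε s hs⟩
  have hIi : C.HasI (C.scale i) := ⟨i, hi, rfl⟩
  have hIj : C.HasI (C.scale j) := ⟨j, hj, rfl⟩
  have hcij : C.Conn (C.scale i) (C.scale j) := by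
    intro m hm
    rw [Set.uIcc_of_le (by omega)] at hm
    have hm' : m = C.scale i ∨ m = C.scale j := by have := hm.1; have := hm.2; omega
    rcases hm' with rfl | rfl <;> assumption
  by_cases hl : ∃ l, l ≠ i ∧ l ≠ j ∧ C.isI l = true ∧ C.Conn (C.scale i) (C.scale l)
  · obtain ⟨l, hli, hlj, hlI, hlc⟩ := hl
    by_cases hsl : s l = s i
    · have e1 := C.equivalent_swap hj hlI (hcij.symm.trans hlc) ε s
      exact ⟨_, e1.trans (C.equivalent_flip_convert hij hi hj ε _
        (by simp [Equiv.swap_apply_of_ne_of_ne hne hli.symm, hsl]))⟩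
    · have hsl' : s l = s j := by
        rw [← FineSubscript.swap_eq_of_ne (Ne.symm hsl), FineSubscript.swap_eq_of_ne hs]
      have e1 := C.equivalent_swap hi hlI hlc ε s
      exact ⟨_, e1.trans (C.equivalent_flip_convert hij hi hj ε _
        (by simp [Equiv.swap_apply_of_ne_of_ne hne.symm hlj.symm, hsl']))⟩
  · push Not at hl
    exfalso
    have hself : C.Conn (C.scale i) (C.scale i) := by
      intro m hm
      rw [Set.uIcc_self, Set.mem_singleton_iff] at hm
      rwa [hm]
    have h0 := C.signDiff_add_beta h hij hi hj ?_ ?_ ?_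
    · rw [C.signDiff_eq_four hD] at h0
      have h1 := FineSubscript.swap_eq_of_ne hs
      rw [← h1] at h0
      generalize s i = a at h0
      generalize s' i = b at h0
      generalize s' j = c at h0
      cases a <;> cases b <;> cases c <;> exact absurd h0 (by decide)
    · rintro ⟨l, hl1, hl2⟩
      refine hl l (by rintro rfl; omega) (by rintro rfl; omega) hl1 fun m hm => ?_
      rw [Set.uIcc_of_ge (by omega)] at hm
      have hm' : m = C.scale i ∨ m = C.scale l := by have := hm.1; have := hm.2; omega
      rcases hm' with rfl | rfl
      · exact hIi
      · exact ⟨l, hl1, rfl⟩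
    · rintro ⟨l, hl1, hl2⟩
      refine hl l (by rintro rfl; omega) (by rintro rfl; omega) hl1 (hcij.trans fun m hm => ?_)
      rw [Set.uIcc_of_le (by omega)] at hm
      have hm' : m = C.scale j ∨ m = C.scale l := by have := hm.1; have := hm.2; omega
      rcases hm' with rfl | rfl
      · exact hIj
      · exact ⟨l, hl1, rfl⟩
    · intro x hxi hxj
      refine ⟨fun hx => hl x hxi hxj ((C.same _ _ hx).trans hi) (by rwa [hx]),
        fun hx => hl x hxi hxj ((C.same _ _ hx).trans hj) (by rwa [hx])⟩

/-- A sign disagreement across c is carried over by a walk between scales c and c + 1, or over an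
empty scale by a walk of ratio 4. The phases guarantee the type I terms that this needs. -/
theorem exists_equivalent_flip {ε ε' : ι → FineSign} {s s' : ι → FineSubscript}
    (h : C.PhaseEq ε s ε' s') {c : ℤ} (hD : C.signDiff ε ε' c ≠ 0) :
    ∃ i j s₁, C.scale i < C.scale j ∧
      (∀ x, C.scale i ≤ x → x < C.scale j → C.signDiff ε ε' x ≠ 0) ∧
      (C.symbol ε s).Equivalent (C.symbol (flip i j ε) s₁) := by
  have adj : ∀ i j, C.scale i = c → C.scale j = c + 1 → C.isI i ≠ C.isI j →
      ∃ i j s₁, C.scale i < C.scale j ∧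
      (∀ x, C.scale i ≤ x → x < C.scale j → C.signDiff ε ε' x ≠ 0) ∧
      (C.symbol ε s).Equivalent (C.symbol (flip i j ε) s₁) := by
    intro i j hi hj hij
    refine ⟨i, j, s, by omega, fun x h1 h2 => ?_, C.equivalent_flip_adjacent (by omega) hij ε s⟩
    rwa [show x = c by omega]
  have four : ∀ d i j, C.signDiff ε ε' d ≠ 0 → C.signDiff ε ε' (d + 1) ≠ 0 → C.scale i = d →
      C.scale j = d + 2 → C.isI i = true → C.isI j = true →
      ∃ i j s₁, C.scale i < C.scale j ∧
      (∀ x, C.scale i ≤ x → x < C.scale j → C.signDiff ε ε' x ≠ 0) ∧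
      (C.symbol ε s).Equivalent (C.symbol (flip i j ε) s₁) := by
    intro d i j h1 h2 hi hj hi' hj'
    refine ⟨i, j, s, by omega, fun x h3 h4 => ?_, C.equivalent_flip_four (by omega) hi' hj' ε s⟩
    have h5 : x = d ∨ x = d + 1 := by omega
    rcases h5 with rfl | rfl <;> assumption
  by_cases h1 : C.HasI c <;> by_cases h2 : C.HasI (c + 1)
  · obtain ⟨i, hi, hic⟩ := h1
    obtain ⟨j, hj, hjc⟩ := h2
    obtain ⟨s₁, hs₁⟩ := C.exists_equivalent_flip_of_adjacent h (i := i) (j := j) (by omega) hi hj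
      (by rwa [hic])
    refine ⟨i, j, s₁, by omega, fun x h3 h4 => ?_, hs₁⟩
    rwa [show x = c by omega]
  · obtain ⟨i, hi, hic⟩ := h1
    by_cases h3 : ∃ j, C.scale j = c + 1
    · obtain ⟨j, hj⟩ := h3
      exact adj i j hic hj fun h4 => h2 ⟨j, h4 ▸ hi, hj⟩
    · push Not at h3
      -- Nothing lives at c + 1, so the disagreement persists there; neither c + 1 nor c + 2
      -- carrying type I terms would contradict the phases.
      have h4 : C.signDiff ε ε' (c + 1) ≠ 0 := by rwa [C.signDiff_eq_of_forall_ne ε ε' h3]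
      obtain ⟨l, hl, hlc⟩ : C.HasI (c + 1 + 1) := by
        by_contra h5
        exact h4 (C.signDiff_eq_zero h h2 h5)
      exact four c i l hD h4 hic (by omega) hi hl
  · obtain ⟨j, hj, hjc⟩ := h2
    by_cases h3 : ∃ i, C.scale i = c
    · obtain ⟨i, hi⟩ := h3
      exact adj i j hi hjc fun h4 => h1 ⟨i, h4 ▸ hj, hi⟩
    · push Not at h3
      obtain ⟨d, rfl⟩ : ∃ d, c = d + 1 := ⟨c - 1, by ring⟩
      have h4 : C.signDiff ε ε' d ≠ 0 := by rwa [← C.signDiff_eq_of_forall_ne ε ε' h3]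
      obtain ⟨l, hl, hlc⟩ : C.HasI d := by
        by_contra h5
        exact h4 (C.signDiff_eq_zero h h5 h1)
      exact four d l j h4 hD hlc (by omega) hl hj
  · exact absurd (C.signDiff_eq_zero h h1 h2) hD

/-- Below all scales the sum is empty; above all scales the phases force it to vanish. -/
theorem finite_signDiff_ne_zero {ε ε' : ι → FineSign} {s s' : ι → FineSubscript}
    (h : C.PhaseEq ε s ε' s') : {c | C.signDiff ε ε' c ≠ 0}.Finite := by
  refine (Set.finite_iUnion fun i => Set.finite_iUnion fun j =>
    Set.finite_Icc (C.scale i) (C.scale j)).subset fun c hc => ?_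
  obtain ⟨i, hi⟩ : ∃ i, C.scale i ≤ c := by
    by_contra h1
    push Not at h1
    exact hc (Finset.sum_eq_zero fun i _ => if_neg (not_le.mpr (h1 i)))
  obtain ⟨j, hj⟩ : ∃ j, c ≤ C.scale j := by
    by_contra h1
    push Not at h1
    refine hc (C.signDiff_eq_zero h ?_ ?_)
    · rintro ⟨l, -, hl⟩; have := h1 l; omega
    · rintro ⟨l, -, hl⟩; have := h1 l; omega
  exact Set.mem_iUnion.mpr ⟨i, Set.mem_iUnion.mpr ⟨j, hi, hj⟩⟩

/-- Sign walking makes the products of signs up to each scale agree. -/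
theorem exists_equivalent_signDiff_eq_zero (ε' : ι → FineSign) (s' : ι → FineSubscript) (n : ℕ) :
    ∀ (ε : ι → FineSign) (s : ι → FineSubscript), C.PhaseEq ε s ε' s' →
      {c | C.signDiff ε ε' c ≠ 0}.ncard = n →
      ∃ ε₁ s₁, (C.symbol ε s).Equivalent (C.symbol ε₁ s₁) ∧ ∀ c, C.signDiff ε₁ ε' c = 0 := by
  induction n using Nat.strong_induction_on with
  | _ n ih =>
    intro ε s h hn
    by_cases hD : ∀ c, C.signDiff ε ε' c = 0
    · exact ⟨ε, s, .refl _, hD⟩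
    push Not at hD
    obtain ⟨c, hc⟩ := hD
    obtain ⟨i, j, s₁, hij, hx, e⟩ := C.exists_equivalent_flip h hc
    have h1 := h.of_equivalent e
    have hlt : {c | C.signDiff (flip i j ε) ε' c ≠ 0}.ncard < n := by
      rw [← hn]
      -- The walk adds 4 exactly on the interval from the scale of i up to that of j, where the
      -- difference was 4 throughout, so the set loses this interval and gains nothing.
      refine Set.ncard_lt_ncard ⟨fun x hx' => ?_, fun hsub => ?_⟩ (C.finite_signDiff_ne_zero h)
      · rw [Set.mem_ofPred_eq, C.signDiff_flip hij] at hx'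
        by_cases h3 : C.scale i ≤ x ∧ x < C.scale j
        · exact hx x h3.1 h3.2
        · rwa [if_neg h3, add_zero] at hx'
      · have h3 := hx _ le_rfl hij
        have h4 := hsub h3
        rw [Set.mem_ofPred_eq, C.signDiff_flip hij, if_pos ⟨le_rfl, hij⟩, C.signDiff_eq_four h3] at h4
        exact h4 (by decide)
    obtain ⟨ε₂, s₂, e₂, h₂⟩ := ih _ hlt _ s₁ h1 rfl
    exact ⟨ε₂, s₂, e.trans e₂, h₂⟩

theorem signDiff_flip_same {i j : ι} (hne : i ≠ j) (hij : C.scale i = C.scale j)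
    (ε ε' : ι → FineSign) (c : ℤ) : C.signDiff (flip i j ε) ε' c = C.signDiff ε ε' c := by
  have h1 : ∀ x, (if C.scale x ≤ c then (flip i j ε x).four - (ε' x).four else 0 : ZMod 8) =
      (if C.scale x ≤ c then (ε x).four - (ε' x).four else 0) +
      ((if x = i then (if C.scale i ≤ c then 4 else 0) else 0) +
        if x = j then (if C.scale i ≤ c then 4 else 0) else 0) := by
    intro x
    by_cases hi : x = i
    · subst hi
      simp only [flip, true_or, if_true, if_neg hne, FineSign.four_neg]
      split_ifs <;> ring
    by_cases hj : x = j
    · subst hj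
      simp only [flip, or_true, if_true, if_neg hi, FineSign.four_neg, hij]
      split_ifs <;> ring
    · simp [flip, hi, hj]
  rw [signDiff, Finset.sum_congr rfl fun x _ => h1 x, Finset.sum_add_distrib, signDiff,
    Finset.sum_add_distrib, Finset.sum_ite_eq' _ i, Finset.sum_ite_eq' _ j]
  simp only [Finset.mem_univ, if_true, add_eq_left]
  split_ifs <;> decide

/-- Subtracting consecutive values of `signDiff` shows that disagreements at each single scale are
even in number. -/
theorem exists_ne_same_scale {ε ε' : ι → FineSign} (h : ∀ c, C.signDiff ε ε' c = 0) {i : ι}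
    (hi : ε i ≠ ε' i) : ∃ j, i ≠ j ∧ C.scale i = C.scale j ∧ ε j ≠ ε' j := by
  by_contra hcon
  push Not at hcon
  have key : ∀ x, (if C.scale x ≤ C.scale i then (ε x).four - (ε' x).four else 0 : ZMod 8) -
      (if C.scale x ≤ C.scale i - 1 then (ε x).four - (ε' x).four else 0) =
      if x = i then (ε i).four - (ε' i).four else 0 := by
    intro x
    by_cases hx : x = i
    · subst hx
      rw [if_pos le_rfl, if_neg (by omega), if_pos rfl, sub_zero]
    · rw [if_neg hx]
      by_cases hs : C.scale i = C.scale x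
      · rw [hcon x (Ne.symm hx) hs]; simp
      · rw [if_congr (show C.scale x ≤ C.scale i ↔ C.scale x ≤ C.scale i - 1 by omega) rfl rfl,
          sub_self]
  have h1 : C.signDiff ε ε' (C.scale i) - C.signDiff ε ε' (C.scale i - 1) =
      (ε i).four - (ε' i).four := by
    rw [signDiff, signDiff, ← Finset.sum_sub_distrib, Finset.sum_congr rfl fun x _ => key x]
    simp
  rw [h, h, ← FineSign.neg_eq_of_ne hi, FineSign.four_neg] at h1
  revert h1
  cases ε i <;> decide

/-- Sign walking within each scale makes the signs agree. -/
theorem equivalent_of_signDiff_eq_zero (ε' : ι → FineSign) (s : ι → FineSubscript) (n : ℕ) :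
    ∀ ε : ι → FineSign, (∀ c, C.signDiff ε ε' c = 0) →
      (Finset.univ.filter fun x => ε x ≠ ε' x).card = n →
      (C.symbol ε s).Equivalent (C.symbol ε' s) := by
  induction n using Nat.strong_induction_on with
  | _ n ih =>
    intro ε h hn
    by_cases hE : ε = ε'
    · rw [hE]; exact .refl _
    obtain ⟨i, hi⟩ := Function.ne_iff.mp hE
    obtain ⟨j, hne, hij, hj⟩ := C.exists_ne_same_scale h hi
    refine (C.equivalent_flip_same hne hij ε s).trans (ih _ ?_ _
      (fun c => by rw [C.signDiff_flip_same hne hij, h]) rfl)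
    rw [← hn]
    refine Finset.card_lt_card ⟨fun x hx => ?_, fun hsub => ?_⟩
    · simp only [Finset.mem_filter, Finset.mem_univ, true_and] at hx ⊢
      by_cases h1 : x = i
      · rwa [h1]
      by_cases h2 : x = j
      · rwa [h2]
      rwa [flip_apply_of_ne h1 h2] at hx
    · have h1 := hsub (Finset.mem_filter.mpr ⟨Finset.mem_univ i, hi⟩)
      refine (Finset.mem_filter.mp h1).2 ?_
      rw [flip, if_pos (.inl rfl), FineSign.neg_eq_of_ne hi]

/-! ### Agreement of subscripts -/

theorem sum_beta_sub {ε : ι → FineSign} {s s' : ι → FineSubscript}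
    (h : C.PhaseEq ε s ε s') {a b : ℤ} (hab : a ≤ b) (ha : ¬ C.HasI a) (hb : ¬ C.HasI b) :
    (∑ x, if C.isI x = true ∧ a < C.scale x ∧ C.scale x < b then
      (s x).beta - (s' x).beta else 0) = 0 := by
  have e1 := h _ ha
  have e2 := h _ hb
  rw [totalPhase_symbol, totalPhase_symbol] at e1 e2
  -- The signs are the same on both sides and cancel. Terms below a contribute equally to the phases
  -- at a and b, so only subscripts strictly between remain.
  have key : ∀ x, (if C.isI x = true ∧ a < C.scale x ∧ C.scale x < b then
      (s x).beta - (s' x).beta else 0) =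
      (phase b (C.term ε s x) - phase b (C.term ε s' x)) -
        (phase a (C.term ε s x) - phase a (C.term ε s' x)) := by
    intro x
    rcases lt_trichotomy (C.scale x) a with h1 | h1 | h1
    · rw [C.phase_term_of_lt ε s h1, C.phase_term_of_lt ε s' h1,
        C.phase_term_of_lt ε s (h1.trans_le hab), C.phase_term_of_lt ε s' (h1.trans_le hab),
        if_neg fun h2 => h2.2.1.not_gt h1]
      split_ifs <;> ring
    · have h2 : ¬ C.isI x = true := fun h2 => ha ⟨x, h2, h1⟩
      rw [C.phase_term_of_le ε s h1.ge, C.phase_term_of_le ε s' h1.ge, phase_term, phase_term,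
        if_neg h2, if_neg h2, if_neg fun h3 => h2 h3.1]
      ring
    · rw [C.phase_term_of_le ε s h1.le, C.phase_term_of_le ε s' h1.le]
      by_cases h3 : C.scale x < b
      · rw [C.phase_term_of_lt ε s h3, C.phase_term_of_lt ε s' h3]
        by_cases h2 : C.isI x = true
        · rw [if_pos ⟨h2, h1, h3⟩, if_pos h2, if_pos h2]; ring
        · rw [if_neg fun h4 => h2 h4.1, if_neg h2, if_neg h2]; ring
      · rw [C.phase_term_of_le ε s (not_lt.mp h3), C.phase_term_of_le ε s' (not_lt.mp h3),
          if_neg fun h4 => h3 h4.2.2]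
        ring
  rw [Finset.sum_congr rfl fun x _ => key x, Finset.sum_sub_distrib, Finset.sum_sub_distrib,
    Finset.sum_sub_distrib, e1, e2]
  ring

theorem exists_not_hasI_lt (c : ℤ) : ∃ a < c, ¬ C.HasI a ∧ ∀ m, a < m → m < c → C.HasI m := by
  classical
  obtain ⟨l, hl⟩ := (Set.finite_range C.scale).bddBelow
  have hex : ∃ n : ℕ, ¬ C.HasI (c - 1 - n) := by
    refine ⟨(c - l).toNat, ?_⟩
    rintro ⟨i, -, hi⟩
    have := hl ⟨i, rfl⟩
    omega
  refine ⟨c - 1 - Nat.find hex, by omega, Nat.find_spec hex, fun m h1 h2 => ?_⟩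
  have h3 := Nat.find_min hex (m := (c - 1 - m).toNat) (by omega)
  rw [not_not] at h3
  rwa [show c - 1 - ((c - 1 - m).toNat : ℤ) = m by omega] at h3

theorem exists_not_hasI_gt (c : ℤ) : ∃ b > c, ¬ C.HasI b ∧ ∀ m, c < m → m < b → C.HasI m := by
  classical
  obtain ⟨l, hl⟩ := (Set.finite_range C.scale).bddAbove
  have hex : ∃ n : ℕ, ¬ C.HasI (c + 1 + n) := by
    refine ⟨(l - c).toNat, ?_⟩
    rintro ⟨i, -, hi⟩
    have := hl ⟨i, rfl⟩
    omega
  refine ⟨c + 1 + Nat.find hex, by omega, Nat.find_spec hex, fun m h1 h2 => ?_⟩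
  have h3 := Nat.find_min hex (m := (m - c - 1).toNat) (by omega)
  rw [not_not] at h3
  rwa [show c + 1 + ((m - c - 1).toNat : ℤ) = m by omega] at h3

/-- One can decrease the number of indices at which the subscripts differ. -/
theorem exists_equivalent_subscript {ε : ι → FineSign} {s s' : ι → FineSubscript}
    (h : C.PhaseEq ε s ε s') {i : ι} (hi : C.isI i = true) (hs : s i ≠ s' i) :
    ∃ s₁, (C.symbol ε s).Equivalent (C.symbol ε s₁) ∧ s₁ i = s' i ∧
      ∀ x, s x = s' x → s₁ x = s' x := by
  -- The nearest exponents a and b without type I terms on either side of i bound its compartment.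
  obtain ⟨a, hai, ha, ha'⟩ := C.exists_not_hasI_lt (C.scale i)
  obtain ⟨b, hib, hb, hb'⟩ := C.exists_not_hasI_gt (C.scale i)
  have hI : ∀ m, a < m → m < b → C.HasI m := fun m h1 h2 => by
    rcases lt_trichotomy m (C.scale i) with h3 | rfl | h3
    · exact ha' m h1 h3
    · exact ⟨i, hi, rfl⟩
    · exact hb' m h3 h2
  have hsum := C.sum_beta_sub h (hai.le.trans hib.le) ha hb
  set M := Finset.univ.filter fun x =>
    (C.isI x = true ∧ a < C.scale x ∧ C.scale x < b) ∧ s x ≠ s' x with hM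
  have hMI : ∀ x ∈ M, C.isI x = true := fun x hx => (Finset.mem_filter.mp hx).2.1.1
  have hMs : ∀ x ∈ M, s x ≠ s' x := fun x hx => (Finset.mem_filter.mp hx).2.2
  have hMc : ∀ x ∈ M, C.Conn (C.scale i) (C.scale x) := fun x hx m hm => by
    have hx := (Finset.mem_filter.mp hx).2.1
    exact hI m ((lt_min hai hx.2.1).trans_le hm.1) (hm.2.trans_lt (max_lt hib hx.2.2))
  have hiM : i ∈ M := Finset.mem_filter.mpr ⟨Finset.mem_univ i, ⟨hi, hai, hib⟩, hs⟩
  by_cases hj : ∃ j ∈ M, s j ≠ s i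
  -- Two mismatches of opposite kinds are both repaired by exchanging them.
  · obtain ⟨j, hj, hji⟩ := hj
    refine ⟨_, C.equivalent_swap hi (hMI j hj) (hMc j hj) ε s, ?_, fun x hx => ?_⟩
    · rw [Function.comp, Equiv.swap_apply_left, ← FineSubscript.swap_eq_of_ne hs,
        FineSubscript.swap_eq_of_ne (Ne.symm hji)]
    · rw [Function.comp, Equiv.swap_apply_of_ne_of_ne, hx]
      · rintro rfl; exact hs hx
      · rintro rfl; exact hMs x hj hx
  · push Not at hj
    -- All mismatches are of one kind, each contributing the same ±2 to a sum that is 0 modulo 8.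
    -- Their number is positive and divisible by 4.
    have hcard : 4 ≤ M.card := by
      have h1 : ∀ x, (if C.isI x = true ∧ a < C.scale x ∧ C.scale x < b then
          (s x).beta - (s' x).beta else 0) =
          if x ∈ M then (s i).beta - (s i).swap.beta else 0 := by
        intro x
        by_cases hx : x ∈ M
        · rw [if_pos hx, if_pos (Finset.mem_filter.mp hx).2.1, ← hj x hx,
            FineSubscript.swap_eq_of_ne (hMs x hx)]
        · rw [if_neg hx]
          split_ifs with h2
          · have h3 : s x = s' x := by
              by_contra h3
              exact hx (Finset.mem_filter.mpr ⟨Finset.mem_univ x, h2, h3⟩)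
            rw [h3, sub_self]
          · rfl
      rw [Finset.sum_congr rfl fun x _ => h1 x, Finset.sum_ite_mem, Finset.univ_inter,
        Finset.sum_const, nsmul_eq_mul] at hsum
      have h2 : ((M.card * 2 : ℕ) : ZMod 8) = 0 := by
        push_cast
        rcases hsi : s i with _ | _ <;> rw [hsi] at hsum
        · rw [← hsum]; congr 1
        · rw [← neg_eq_zero, ← hsum, ← mul_neg]; congr 1
      have h3 := (ZMod.natCast_eq_zero_iff _ 8).mp h2
      have h4 : 0 < M.card := Finset.card_pos.mpr ⟨i, hiM⟩
      omega
    obtain ⟨A, hiA, hAM, hA⟩ := Finset.exists_subsuperset_card_eq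
      (Finset.singleton_subset_iff.mpr hiM) (by simp) hcard
    rw [Finset.singleton_subset_iff] at hiA
    refine ⟨_, C.equivalent_convert_four hiA hA (fun x hx => hMI x (hAM hx))
      (fun x hx => hMc x (hAM hx)) ε s fun x hx => hj x (hAM hx), ?_, fun x hx => ?_⟩
    · rw [convert, if_pos hiA, FineSubscript.swap_eq_of_ne hs]
    · rw [convert, if_neg fun h1 => hMs x (hAM h1) hx, hx]

theorem symbol_congr {ε : ι → FineSign} {s s' : ι → FineSubscript}
    (h : ∀ x, C.isI x = true → s x = s' x) : C.symbol ε s = C.symbol ε s' := by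
  refine FineSymbol.ext (Multiset.map_congr rfl fun x _ => ?_)
  cases hx : C.isI x
  · simp [term, mk', hx]
  · rw [term, term, h x hx]

/-- Subscripts are determined by the phases up to giver permutation and conversion. -/
theorem equivalent_of_phaseEq_of_sign_eq (ε : ι → FineSign) (s' : ι → FineSubscript) (n : ℕ) :
    ∀ s : ι → FineSubscript, C.PhaseEq ε s ε s' →
      (Finset.univ.filter fun x => s x ≠ s' x).card = n →
      (C.symbol ε s).Equivalent (C.symbol ε s') := by
  induction n using Nat.strong_induction_on with
  | _ n ih =>
    intro s h hn
    by_cases hE : ∀ x, C.isI x = true → s x = s' x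
    · rw [C.symbol_congr hE]; exact .refl _
    push Not at hE
    obtain ⟨i, hi, his⟩ := hE
    obtain ⟨s₁, e, h1, h2⟩ := C.exists_equivalent_subscript h hi his
    refine e.trans (ih _ ?_ s₁ (h.of_equivalent e) rfl)
    rw [← hn]
    refine Finset.card_lt_card ⟨fun x hx => ?_, fun hsub => ?_⟩
    · simp only [Finset.mem_filter, Finset.mem_univ, true_and] at hx ⊢
      exact fun h3 => hx (h2 x h3)
    · exact (Finset.mem_filter.mp (hsub (Finset.mem_filter.mpr ⟨Finset.mem_univ i, his⟩))).2 h1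

/-- Symbols of the same shape with the same phases are equivalent. -/
theorem equivalent_of_phaseEq {ε ε' : ι → FineSign} {s s' : ι → FineSubscript}
    (h : C.PhaseEq ε s ε' s') : (C.symbol ε s).Equivalent (C.symbol ε' s') := by
  obtain ⟨ε₁, s₁, e₁, h₁⟩ := C.exists_equivalent_signDiff_eq_zero ε' s' _ ε s h rfl
  have e₂ := e₁.trans (C.equivalent_of_signDiff_eq_zero ε' s₁ _ ε₁ h₁ rfl)
  exact e₂.trans (C.equivalent_of_phaseEq_of_sign_eq ε' s' _ s₁ (h.of_equivalent e₂) rfl)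

end ScaleShape

/-! ### Invariants of arbitrary symbols -/

namespace FineTerm

/-- Whether a term has type I. -/
def isTypeI : FineTerm → Bool
  | typeII _ _ => false
  | typeI _ _ _ => true

theorem isTypeI_eq_true (t : FineTerm) : t.isTypeI = true ↔ t.IsTypeI := by
  cases t <;> simp [isTypeI, IsTypeI]

theorem mk'_eq (t : FineTerm) : mk' t.logScale t.isTypeI t.sign t.subscript = t := by
  cases t <;> rfl

/-- The scale and type of a term. -/
def shape (t : FineTerm) : ℤ × Bool := (t.logScale, t.isTypeI)

end FineTerm

theorem Multiset.exists_pairs_of_rel {α β : Type} {r : α → β → Prop} {A : Multiset α}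
    {B : Multiset β} (h : Multiset.Rel r A B) :
    ∃ Z : Multiset (α × β), Z.map Prod.fst = A ∧ Z.map Prod.snd = B ∧ ∀ p ∈ Z, r p.1 p.2 := by
  induction h with
  | zero => exact ⟨0, rfl, rfl, by simp⟩
  | @cons a b A B hab _ ih =>
    obtain ⟨Z, rfl, rfl, hZ⟩ := ih
    refine ⟨(a, b) ::ₘ Z, by simp, by simp, fun p hp => ?_⟩
    rcases Multiset.mem_cons.mp hp with rfl | hp
    · exact hab
    · exact hZ p hp

namespace FineSymbol

open FineTerm

/-- Symbols with the same scales and types, and the same Gauss sum phases. -/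
def SameInvariants (F F' : FineSymbol) : Prop :=
  F.terms.map shape = F'.terms.map shape ∧
    ∀ m, ¬ F.HasTypeI m → F.totalPhase m = F'.totalPhase m

/-- Equality of the multisets of shapes pairs the terms of the two symbols. The multiset of pairs
serves as a common index set, which brings both into one `ScaleShape`. -/
theorem SameInvariants.equivalent {F F' : FineSymbol} (h : F.SameInvariants F') :
    F.Equivalent F' := by
  classical
  obtain ⟨h1, h2⟩ := h
  obtain ⟨Z, hZ, hZ', hr⟩ := Multiset.exists_pairs_of_rel
    (Multiset.rel_map.mp (Multiset.rel_eq.mpr h1))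
  have hmem : ∀ i : Z.ToType, i.1.1 ∈ F.terms := fun i => by
    rw [← hZ]; exact Multiset.mem_map_of_mem _ (Multiset.coe_mem (x := i))
  let C : ScaleShape Z.ToType :=
    { scale := fun i => i.1.1.logScale
      isI := fun i => i.1.1.isTypeI
      same := fun i j hij => by
        have := F.same_type _ (hmem i) _ (hmem j) hij
        rwa [← isTypeI_eq_true, ← isTypeI_eq_true, ← Bool.eq_iff_iff] at this }
  have e : F = C.symbol (fun i => i.1.1.sign) fun i => i.1.1.subscript := by
    refine FineSymbol.ext ?_
    conv_lhs => rw [← hZ, ← Multiset.map_univ_coe Z, Multiset.map_map]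
    exact Multiset.map_congr rfl fun i _ => (mk'_eq i.1.1).symm
  have e' : F' = C.symbol (fun i => i.1.2.sign) fun i => i.1.2.subscript := by
    refine FineSymbol.ext ?_
    conv_lhs => rw [← hZ', ← Multiset.map_univ_coe Z, Multiset.map_map]
    refine Multiset.map_congr rfl fun i _ => ?_
    have h3 := hr _ (Multiset.coe_mem (x := i))
    simp only [shape, Prod.mk.injEq] at h3
    simp only [Function.comp, ScaleShape.term, C]
    rw [h3.1, h3.2, mk'_eq]
  rw [e, e']
  refine C.equivalent_of_phaseEq fun m hm => ?_
  rw [← e, ← e']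
  refine h2 m ?_
  rwa [e, C.symbol_hasTypeI]

theorem dimAt_eq_count (F : FineSymbol) (k : ℤ) :
    F.dimAt k = (F.terms.map shape).count (k, true) + 2 * (F.terms.map shape).count (k, false) := by
  rw [dimAt]
  induction F.terms using Multiset.induction_on with
  | empty => simp
  | cons t S ih =>
    rw [Multiset.map_cons, Multiset.sum_cons, ih, Multiset.map_cons, Multiset.count_cons,
      Multiset.count_cons]
    by_cases h : t.logScale = k
    · cases t <;> simp [logScale] at h <;> simp [shape, logScale, isTypeI, dim, h] <;> ring
    · simp [shape, h, Ne.symm h]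

theorem count_true_eq_zero_iff (F : FineSymbol) (k : ℤ) :
    (F.terms.map shape).count (k, true) = 0 ↔ ¬ F.HasTypeI k := by
  rw [Multiset.count_eq_zero, not_iff_not, Multiset.mem_map]
  refine exists_congr fun t => and_congr_right fun _ => ?_
  rw [shape, Prod.mk.injEq, isTypeI_eq_true, and_comm]

theorem count_false_eq_zero (F : FineSymbol) {k : ℤ} (h : F.HasTypeI k) :
    (F.terms.map shape).count (k, false) = 0 := by
  rw [Multiset.count_eq_zero, Multiset.mem_map]
  rintro ⟨t, ht, h1⟩
  obtain ⟨u, hu, h2, h3⟩ := h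
  rw [shape, Prod.mk.injEq] at h1
  have h4 := (F.same_type t ht u hu (h1.1.trans h3.symm)).mpr h2
  rw [← isTypeI_eq_true, h1.2] at h4
  exact absurd h4 (by decide)

/-- Each scale carries a single type, which the vanishing of Gauss sums detects; the rank then gives
the number of terms. -/
theorem sameInvariants_of_isometric {F F' : FineSymbol} (h : F.lattice.Isometric F'.lattice) :
    F.SameInvariants F' := by
  refine ⟨Multiset.ext.mpr ?_, fun m hm => totalPhase_eq_of_isometric h hm⟩
  rintro ⟨k, b⟩
  have h1 := dimAt_eq_of_isometric h k
  have h2 := hasTypeI_iff_of_isometric h k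
  rw [dimAt_eq_count, dimAt_eq_count] at h1
  by_cases hI : F.HasTypeI k
  · have h3 := F.count_false_eq_zero hI
    have h4 := F'.count_false_eq_zero (h2.mp hI)
    cases b
    · rw [h3, h4]
    · omega
  · have h3 := (F.count_true_eq_zero_iff k).mpr hI
    have h4 := (F'.count_true_eq_zero_iff k).mpr fun h5 => hI (h2.mpr h5)
    cases b
    · omega
    · rw [h3, h4]

/-! ### Invariance under giver permutation and conversion -/

theorem IsCompartment.lt_or_gt {F : FineSymbol} {C : Multiset FineTerm} (hC : F.IsCompartment C)
    {m : ℤ} (hm : ¬ F.HasTypeI m) : (∀ t ∈ C, t.logScale < m) ∨ ∀ t ∈ C, m < t.logScale := by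
  obtain ⟨hle, -, hI, hord⟩ := hC.prop
  by_contra hcon
  push Not at hcon
  obtain ⟨⟨t, ht, h1⟩, u, hu, h2⟩ := hcon
  -- A compartment reaching both sides of m would, by convexity of its scales, have a type I term at
  -- m.
  obtain ⟨v, hv, h3⟩ := hord.out ⟨u, hu, rfl⟩ ⟨t, ht, rfl⟩ ⟨h2, h1⟩
  exact hm ⟨v, Multiset.mem_of_le hle hv, hI v hv, h3⟩

theorem phase_typeI_of_lt {m k : ℤ} (h : k < m) (ε : FineSign) (s : FineSubscript) :
    phase m (typeI k ε s) = s.beta + ((m - k + 1 : ℤ) : ZMod 8) * ε.four := by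
  exact if_pos h

theorem phase_of_gt {m : ℤ} {t : FineTerm} (h : m < t.logScale) : phase m t = 0 := by
  exact if_neg h.not_gt

theorem swapSubscript_logScale (t : FineTerm) : t.swapSubscript.logScale = t.logScale := by
  cases t <;> rfl

/-- A compartment below 2^m enters the phase through its signs and the sum of its subscripts, which
a permutation keeps; one above does not enter at all. -/
theorem GiverPermutation.sameInvariants {F F' : FineSymbol} (h : F.GiverPermutation F') :
    F.SameInvariants F' := by
  obtain ⟨n, k, ε, s, σ, S, hC, hF, hF'⟩ := h
  refine ⟨?_, fun m hm => ?_⟩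
  · rw [hF, hF', Multiset.map_add, Multiset.map_add, Multiset.map_map, Multiset.map_map]
    rfl
  · rw [totalPhase, totalPhase, hF, hF', Multiset.map_add, Multiset.map_add, Multiset.sum_add,
      Multiset.sum_add, Multiset.map_map, Multiset.map_map]
    congr 1
    change ∑ i, phase m (typeI (k i) (ε i) (s i)) = ∑ i, phase m (typeI (k i) (ε i) (s (σ i)))
    rcases hC.lt_or_gt hm with h1 | h1
    · have h2 : ∀ i, k i < m := fun i => h1 _ (Multiset.mem_map_of_mem _ (Finset.mem_univ_val i))
      simp only [phase_typeI_of_lt (h2 _), Finset.sum_add_distrib]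
      rw [Equiv.sum_comp σ fun i => (s i).beta]
    · have h2 : ∀ i, m < k i := fun i => h1 _ (Multiset.mem_map_of_mem _ (Finset.mem_univ_val i))
      refine Finset.sum_congr rfl fun i _ => ?_
      rw [phase_of_gt (h2 i), phase_of_gt (h2 i)]

/-- Below 2^m each conversion changes the phase by the same ±2, and four of them give 8 = 0. -/
theorem sum_phase_swapSubscript {m : ℤ} {A : Multiset FineTerm} (hA : A.card = 4)
    (hs : (∀ t ∈ A, t.IsGiver) ∨ ∀ t ∈ A, t.IsReceiver)
    (hm : (∀ t ∈ A, t.logScale < m) ∨ ∀ t ∈ A, m < t.logScale) :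
    ((A.map swapSubscript).map (phase m)).sum = (A.map (phase m)).sum := by
  rw [Multiset.map_map]
  rcases hm with hm | hm
  · have key : ∀ c : ZMod 8, 4 * c = 0 → (∀ t ∈ A, phase m t.swapSubscript = phase m t + c) →
        (A.map (phase m ∘ swapSubscript)).sum = (A.map (phase m)).sum := by
      intro c hc h
      have h1 : A.map (phase m ∘ swapSubscript) = A.map fun t => phase m t + c :=
        Multiset.map_congr rfl h
      rw [h1, Multiset.sum_map_add, Multiset.map_const', Multiset.sum_replicate, hA, nsmul_eq_mul]
      push_cast
      rw [hc, add_zero]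
    rcases hs with hs | hs
    · refine key (-2) (by decide) fun t ht => ?_
      have h1 := hs t ht
      rcases t with ⟨k, ε⟩ | ⟨k, ε, _ | _⟩
      · exact h1.elim
      · rw [swapSubscript, FineSubscript.swap, phase_typeI_of_lt (k := k) (hm _ ht), phase_typeI_of_lt (k := k) (hm _ ht),
          FineSubscript.beta, FineSubscript.beta]
        ring
      · exact h1.elim
    · refine key 2 (by decide) fun t ht => ?_
      have h1 := hs t ht
      rcases t with ⟨k, ε⟩ | ⟨k, ε, _ | _⟩
      · exact h1.elim
      · exact h1.elim
      · rw [swapSubscript, FineSubscript.swap, phase_typeI_of_lt (k := k) (hm _ ht), phase_typeI_of_lt (k := k) (hm _ ht),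
          FineSubscript.beta, FineSubscript.beta]
        ring
  · refine congrArg _ (Multiset.map_congr rfl fun t ht => ?_)
    rw [Function.comp, phase_of_gt (hm t ht), phase_of_gt (by rw [swapSubscript_logScale]; exact hm t ht)]

theorem GiverConversion.sameInvariants {F F' : FineSymbol} (h : F.GiverConversion F') :
    F.SameInvariants F' := by
  obtain ⟨C, A, S, hC, hAC, hA, hs, hF, hF'⟩ := h
  refine ⟨?_, fun m hm => ?_⟩
  · rw [hF, hF', Multiset.map_add, Multiset.map_add, Multiset.map_map]
    congr 1
    refine Multiset.map_congr rfl fun t _ => ?_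
    cases t <;> rfl
  · rw [totalPhase, totalPhase, hF, hF', Multiset.map_add, Multiset.map_add, Multiset.sum_add,
      Multiset.sum_add, sum_phase_swapSubscript hA hs]
    exact (hC.lt_or_gt hm).imp (fun h t ht => h t (Multiset.mem_of_le hAC ht))
      fun h t ht => h t (Multiset.mem_of_le hAC ht)

/-- For giver permutations and conversions no direct isometry is built: they preserve the
invariants, and equal invariants already imply isometry through elementary operations. -/
theorem Move.isometric {F F' : FineSymbol} (h : F.Move F') : F.lattice.Isometric F'.lattice := by
  rcases h with h | h | h
  · exact h.isometric
  · exact h.sameInvariants.equivalent.1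
  · exact h.sameInvariants.equivalent.1

end FineSymbol

theorem mainTheorem2 (F F' : FineSymbol) :
    F.lattice.Isometric F'.lattice ↔ F.Related F' := by
  refine ⟨fun h => (FineSymbol.sameInvariants_of_isometric h).equivalent.2, fun h => ?_⟩
  induction h with
  | refl => exact .refl _
  | tail _ h ih => exact ih.trans h.isometric
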